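/- Let $G$ be a real Lie group with semisimple Lie algebra $\mathfrak g$, let $\mathfrak g=\mathfrak g_{-m}\oplus\dots\oplus\mathfrak g_m$ be a $|m|$-grading ($[\mathfrak g_i,\mathfrak g_j]\subset\mathfrak g_{i+j}$, negative part generated by $\mathfrak g_{-1}$), put $\mathfrak g^i=\bigoplus_{j\ge i}\mathfrak g_j$, $\mathfrak p=\mathfrak g^0$, $\mathfrak p_+=\mathfrak g^1$, and let $P\subset G$ be a corresponding parabolic subgroup, i.e. a closed subgroup with Lie algebra $\mathfrak p$ such that $\mathrm{Ad}(P)$ preserves all $\mathfrak g^i$. Let $(p:\mathcal G\to M,\omega)$ be a Cartan geometry of type $(G,P)$. Let $V$ be a finite-dimensional representation of $G$ on which the Casimir operator of $\mathfrak g$ acts by a scalar $c_0\in\mathbb R$ (e.g. $V$ irreducible), and let $VM=\mathcal G\times_PV$ be the corresponding tractor bundle with its tractor connection $\nabla^V$ ($\nabla^V_{\Pi(s)}\sigma=D_s\sigma+s\bullet\sigma$, where $D$ is the fundamental derivative, i.e. differentiation along $\omega^{-1}(s)$, and $\Pi:\mathcal AM=\mathcal G\times_P\mathfrak g\to\mathcal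 G\times_P(\mathfrak g/\mathfrak p)\cong TM$). Identify $\Omega^k(M,VM)$ with the smooth $P$-equivariant functions $\mathcal G\to\Lambda^k\mathfrak p_+\otimes V$, using the Killing form $B$ to identify $\mathfrak p_+\cong(\mathfrak g/\mathfrak p)^*$. Let $d^{\nabla^V}$ be the covariant exterior derivative, $\partial^*$ the Kostant codifferential (the Lie algebra homology differential of $\mathfrak p_+$ with coefficients in $V$, $\partial^*(Z\otimes v)=-Z\cdot v$ on $\mathfrak p_+\otimes V$), $\square^R=d^{\nabla^V}\partial^*+\partial^*d^{\nabla^V}$, and $\mathcal C=(B\otimes\mathrm{id})\circ D^2$ the curved Casimir operator. Then for every $k$ the operator $2\square^R-\mathcal C+c_0:\Omega^k(M,VM)\to\Omega^k(M,VM)$ is tensorial, i.e. linear over $C^\infty(M,\mathbb R)$. If, moreover, the geometry is regular, i.e. its curvature function $\kappa$ satisfies $\kappa(\mathfrak g^i,\mathfrak g^j)\subset\mathfrak g^{i+j+1}$ for all $i,j<0$, then this operator maps sections of each component of the natural filtration of $\Lambda^kT^*M\otimes VM$ to sections of the next smaller one: a form with values in $F^a$ is mapped to a form with values in $F^{a+1}$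 for every $a\in\mathbb R$. Here $V^r$ is the sum of the eigenspaces in $V$ of the grading element (the element of $\mathfrak g$ acting on each $\mathfrak g_i$ by $i$) with eigenvalue $\ge r$, and $F^a\subset\Lambda^k\mathfrak p_+\otimes V$ is spanned by all $Z_1\wedge\dots\wedge Z_k\otimes v$ with $Z_i\in\mathfrak g^{n_i}\cap\mathfrak p_+$, $v\in V^r$ and $n_1+\dots+n_k+r\ge a$. -/

import Mathlib

open scoped Manifold ContDiff TensorProduct

noncomputable section

namespace ParabolicGeometry

section Algebra

/-! ### Graded semisimple Lie algebras -/

/-- A `|depth|`-grading of a Lie algebra: `L = L_{-depth} ⊕ ⋯ ⊕ L_{depth}`, `[L_i, L_j] ⊆ L_{i+j}`,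
with the negative part generated by `L_{-1}`. For semisimple `L`, the parabolic subalgebras of `L`
are exactly the subalgebras `L_0 ⊕ ⋯ ⊕ L_{depth}` for such gradings. -/
structure Grading (L : Type*) [LieRing L] [LieAlgebra ℝ L] where
  gr : ℤ → Submodule ℝ L
  depth : ℕ
  isInternal : DirectSum.IsInternal gr
  bounded : ∀ i : ℤ, (depth : ℤ) < |i| → gr i = ⊥
  lie_mem : ∀ (i j : ℤ) (x y : L), x ∈ gr i → y ∈ gr j → ⁅x, y⁆ ∈ gr (i + j)
  generated : ∀ i : ℤ, i ≤ -1 →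
    gr (i - 1) ≤ Submodule.span ℝ {z | ∃ x ∈ gr (-1), ∃ y ∈ gr i, z = ⁅x, y⁆}

namespace Grading

variable {L : Type*} [LieRing L] [LieAlgebra ℝ L]

/-- The filtration component `L^i = L_i ⊕ L_{i+1} ⊕ ⋯`; so `𝔭 = L^0` and `𝔭₊ = L^1`. -/
def fil (Γ : Grading L) (i : ℤ) : Submodule ℝ L := ⨆ j : {j : ℤ // i ≤ j}, Γ.gr j

theorem gr_le_fil (Γ : Grading L) {i j : ℤ} (h : i ≤ j) : Γ.gr j ≤ Γ.fil i :=
  le_iSup (fun j : {j : ℤ // i ≤ j} => Γ.gr j) ⟨j, h⟩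

theorem fil_anti (Γ : Grading L) {i j : ℤ} (h : i ≤ j) : Γ.fil j ≤ Γ.fil i :=
  iSup_le fun l => Γ.gr_le_fil (h.trans l.2)

theorem lie_mem_fil (Γ : Grading L) {i j : ℤ} {x y : L} (hx : x ∈ Γ.fil i) (hy : y ∈ Γ.fil j) :
    ⁅x, y⁆ ∈ Γ.fil (i + j) := by
  refine Submodule.iSup_induction (fun l : {l : ℤ // i ≤ l} => Γ.gr l)
    (motive := fun x => ⁅x, y⁆ ∈ Γ.fil (i + j)) hx ?_ (by simp) ?_
  · intro a x hx
    refine Submodule.iSup_induction (fun l : {l : ℤ // j ≤ l} => Γ.gr l)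
      (motive := fun y => ⁅x, y⁆ ∈ Γ.fil (i + j)) hy ?_ (by simp) ?_
    · intro b y hy
      exact Γ.gr_le_fil (add_le_add a.2 b.2) (Γ.lie_mem a b x y hx hy)
    · intro y z hy hz
      rw [lie_add]
      exact add_mem hy hz
  · intro x z hx hz
    rw [add_lie]
    exact add_mem hx hz

/-- The Lie subalgebra `𝔭₊ = L^1`. -/
def pPlus (Γ : Grading L) : LieSubalgebra ℝ L where
  toSubmodule := Γ.fil 1
  lie_mem' hx hy := Γ.fil_anti (by norm_num) (Γ.lie_mem_fil hx hy)

/-- `E` is a grading element: `ad E` is multiplication by `i` on `L_i`. -/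
def IsGradingElement (Γ : Grading L) (E : L) : Prop :=
  ∀ (i : ℤ) (x : L), x ∈ Γ.gr i → ⁅E, x⁆ = (i : ℝ) • x

/-- A grading of a semisimple Lie algebra has exactly one grading element. -/
theorem existsUnique_gradingElement [FiniteDimensional ℝ L] [LieAlgebra.IsSemisimple ℝ L]
    (Γ : Grading L) : ∃! E : L, Γ.IsGradingElement E := by
  classical
  have htop : ∀ x : L, x ∈ ⨆ i, Γ.gr i := fun x => by
    rw [Γ.isInternal.submodule_iSup_eq_top]; trivial
  let e := LinearEquiv.ofBijective (DirectSum.coeLinearMap Γ.gr) Γ.isInternal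
  let D : L →ₗ[ℝ] L :=
    (DirectSum.toModule ℝ ℤ L fun i => (i : ℝ) • (Γ.gr i).subtype) ∘ₗ e.symm.toLinearMap
  have hD : ∀ (i : ℤ) (x : L), x ∈ Γ.gr i → D x = (i : ℝ) • x := by
    intro i x hx
    have h : e (DirectSum.lof ℝ ℤ (fun i => Γ.gr i) i ⟨x, hx⟩) = x :=
      DirectSum.coeLinearMap_lof Γ.gr i ⟨x, hx⟩
    have h' : e.symm x = DirectSum.lof ℝ ℤ (fun i => Γ.gr i) i ⟨x, hx⟩ := by
      rw [LinearEquiv.symm_apply_eq, h]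
    simp [D, h', DirectSum.toModule_lof]
  have hleib : ∀ x y : L, D ⁅x, y⁆ = ⁅x, D y⁆ - ⁅y, D x⁆ := by
    intro x y
    refine Submodule.iSup_induction Γ.gr
      (motive := fun x => D ⁅x, y⁆ = ⁅x, D y⁆ - ⁅y, D x⁆) (htop x) ?_ (by simp) ?_
    · intro i x hx
      refine Submodule.iSup_induction Γ.gr
        (motive := fun y => D ⁅x, y⁆ = ⁅x, D y⁆ - ⁅y, D x⁆) (htop y) ?_ (by simp) ?_
      · intro j y hy
        rw [hD _ _ (Γ.lie_mem i j x y hx hy), hD _ _ hx, hD _ _ hy, lie_smul, lie_smul,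
          ← lie_skew x y]
        push_cast
        module
      · intro y z hy hz
        rw [lie_add, map_add, hy, hz, map_add, lie_add, add_lie]
        abel
    · intro x z hx hz
      rw [add_lie, map_add, hx, hz, map_add, lie_add, add_lie]
      abel
  obtain ⟨E, hE⟩ := LieDerivation.IsKilling.exists_eq_ad (⟨D, hleib⟩ : LieDerivation ℝ L L)
  have hE' : ∀ x : L, ⁅E, x⁆ = D x := fun x => by
    have := congrArg (fun d : LieDerivation ℝ L L => d x) hE
    simpa using this
  refine ⟨E, fun i x hx => by rw [hE', hD i x hx], fun F hF => ?_⟩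
  have : LieDerivation.ad ℝ L (F - E) = 0 := by
    ext x
    refine Submodule.iSup_induction Γ.gr
      (motive := fun x => LieDerivation.ad ℝ L (F - E) x = (0 : LieDerivation ℝ L L) x)
      (htop x) ?_ (by simp) ?_
    · intro i x hx
      simp [hF i x hx, hE', hD i x hx]
    · intro x y hx hy
      rw [map_add, hx, hy, map_add]
  rw [LieDerivation.IsKilling.ad_apply_eq_zero_iff] at this
  exact sub_eq_zero.mp this

/-- The grading element of a graded semisimple Lie algebra. -/
def gradingElement [FiniteDimensional ℝ L] [LieAlgebra.IsSemisimple ℝ L] (Γ : Grading L) : L :=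
  Γ.existsUnique_gradingElement.choose

end Grading

variable {L : Type*} [LieRing L] [LieAlgebra ℝ L]
variable {V : Type*} [AddCommGroup V] [Module ℝ V]

/-- Contraction of a bilinear map with the Killing form: `∑ T(ξ_l, ξ^l)` for a basis `ξ_l` of `L`
and its dual basis `ξ^l` with respect to the Killing form. -/
def killingTrace [FiniteDimensional ℝ L] [LieAlgebra.IsSemisimple ℝ L]
    (T : L →ₗ[ℝ] L →ₗ[ℝ] V) : V :=
  ∑ l, T (Module.finBasis ℝ L l)
    (LinearMap.BilinForm.dualBasis (killingForm ℝ L)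
      (LieAlgebra.IsKilling.killingForm_nondegenerate ℝ L) (Module.finBasis ℝ L) l)

/-- The Casimir operator `∑ ξ_l ξ^l` of an infinitesimal representation `θ` of `L` on `V`. -/
def casimir [FiniteDimensional ℝ L] [LieAlgebra.IsSemisimple ℝ L]
    (θ : L →ₗ[ℝ] Module.End ℝ V) : Module.End ℝ V :=
  killingTrace ((LinearMap.mul ℝ (Module.End ℝ V)).compl₁₂ θ θ)

/-! ### The Kostant codifferential

We first write down the Lie algebra homology differential for a bilinear bracket `β` on `P` and a
bilinear action `τ` of `P` on `V`. The tensor product `Λ^k P ⊗ V` is written with the factors in the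
order `V ⊗ Λ^k P`. -/

section Homology

variable {P : Type*} [AddCommGroup P] [Module ℝ P] {V : Type*} [AddCommGroup V] [Module ℝ V]

/-- `Z ↦ (Z_1, …, Z_k) ↦ (v ↦ Z • v ⊗ Z_1 ∧ ⋯ ∧ Z_k)`. -/
def actTerm (τ : P →ₗ[ℝ] Module.End ℝ V) (k : ℕ) :
    P →ₗ[ℝ] P [⋀^Fin k]→ₗ[ℝ] (V →ₗ[ℝ] V ⊗[ℝ] (⋀[ℝ]^k P)) where
  toFun Z := ((TensorProduct.mk ℝ V (⋀[ℝ]^k P)).comp (τ Z)).flip.compAlternatingMap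
    (exteriorPower.ιMulti ℝ k)
  map_add' x y := by
    ext v w
    simp
  map_smul' c x := by
    ext v w
    simp [TensorProduct.smul_tmul']

/-- `Z, Z' ↦ (Z_1, …, Z_k) ↦ (v ↦ v ⊗ [Z, Z'] ∧ Z_1 ∧ ⋯ ∧ Z_k)`. -/
def bracketTerm (V : Type*) [AddCommGroup V] [Module ℝ V] (β : P →ₗ[ℝ] P →ₗ[ℝ] P) (k : ℕ) :
    P →ₗ[ℝ] P →ₗ[ℝ] P [⋀^Fin k]→ₗ[ℝ] (V →ₗ[ℝ] V ⊗[ℝ] (⋀[ℝ]^(k + 1) P)) :=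
  β.compr₂ (AlternatingMap.curryLeft
    ((TensorProduct.mk ℝ V (⋀[ℝ]^(k + 1) P)).flip.compAlternatingMap
      (exteriorPower.ιMulti ℝ (k + 1))))

/-- The alternating map in `Z_0, …, Z_k` (with values in linear maps of `v`) defining the homology
differential. For skew-symmetric `β`, the double alternation counts every pair `i < j` twice, whence
the factor `1 / 2`; see `homologyDiff_zero_apply` and `homologyDiff_succ_apply` for the explicit
formula. -/
def homologyAlt (β : P →ₗ[ℝ] P →ₗ[ℝ] P) (τ : P →ₗ[ℝ] Module.End ℝ V) :
    (k : ℕ) → P [⋀^Fin (k + 1)]→ₗ[ℝ] (V →ₗ[ℝ] V ⊗[ℝ] (⋀[ℝ]^k P))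
  | 0 => -AlternatingMap.alternatizeUncurryFin (actTerm τ 0)
  | k + 1 => -AlternatingMap.alternatizeUncurryFin (actTerm τ (k + 1)) -
      (1 / 2 : ℝ) • AlternatingMap.alternatizeUncurryFin
        (AlternatingMap.alternatizeUncurryFinLM ∘ₗ bracketTerm V β k)

/-- The Lie algebra homology differential `Λ^{k+1} P ⊗ V → Λ^k P ⊗ V`. -/
def homologyDiff (β : P →ₗ[ℝ] P →ₗ[ℝ] P) (τ : P →ₗ[ℝ] Module.End ℝ V) (k : ℕ) :
    V ⊗[ℝ] (⋀[ℝ]^(k + 1) P) →ₗ[ℝ] V ⊗[ℝ] (⋀[ℝ]^k P) :=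
  TensorProduct.lift (exteriorPower.alternatingMapLinearEquiv (homologyAlt β τ k)).flip

/-- On `P ⊗ V` the differential is `Z ⊗ v ↦ - Z • v`. -/
theorem homologyDiff_zero_apply (β : P →ₗ[ℝ] P →ₗ[ℝ] P) (τ : P →ₗ[ℝ] Module.End ℝ V)
    (Z : Fin 1 → P) (v : V) :
    homologyDiff β τ 0 (v ⊗ₜ[ℝ] exteriorPower.ιMulti ℝ 1 Z) =
      -(τ (Z 0) v ⊗ₜ[ℝ] exteriorPower.ιMulti ℝ 0 (Fin.removeNth 0 Z)) := by
  simp [homologyDiff, homologyAlt, actTerm, AlternatingMap.alternatizeUncurryFin_apply]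

theorem bracketTerm_alternatize (β : P →ₗ[ℝ] P →ₗ[ℝ] P) (hβ : ∀ x y, β y x = -β x y) (k : ℕ)
    (Z : Fin (k + 2) → P) (v : V) :
    AlternatingMap.alternatizeUncurryFin
        (AlternatingMap.alternatizeUncurryFinLM ∘ₗ bracketTerm V β k) Z v =
    ∑ i : Fin (k + 1), ∑ j ≥ i, (-1 : ℝ) ^ ((i : ℕ) + (j : ℕ)) • ((2 : ℝ) •
      (v ⊗ₜ[ℝ] exteriorPower.ιMulti ℝ (k + 1)
        (Fin.cons (β (Z i.castSucc) (Z j.succ)) (j.removeNth (i.castSucc.removeNth Z)) :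
          Fin (k + 1) → P))) := by
  have hneg : ∀ x y, bracketTerm V β k y x = -bracketTerm V β k x y := fun x y => by
    simp only [bracketTerm, LinearMap.compr₂_apply]
    rw [hβ x y, map_neg]
  rw [AlternatingMap.alternatizeUncurryFin_alternatizeUncurryFinLM_comp_apply,
    LinearMap.sum_apply]
  refine Finset.sum_congr rfl fun i _ => ?_
  rw [LinearMap.sum_apply]
  refine Finset.sum_congr rfl fun j _ => ?_
  rw [hneg (Z i.castSucc) (Z j.succ), AlternatingMap.neg_apply, sub_neg_eq_add, ← two_smul ℝ]
  rcases ((i : ℕ) + (j : ℕ)).even_or_odd with hi | hi <;>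
    simp [hi.neg_one_pow, bracketTerm, AlternatingMap.curryLeft_apply_apply, Matrix.vecCons]

/-- `Z_0 ∧ ⋯ ∧ Z_{k+1} ⊗ v ↦ ∑_i (-1)^{i+1} Z_0 ∧ ⋯ Ẑ_i ⋯ ∧ Z_{k+1} ⊗ Z_i • v`
`+ ∑_{i<j} (-1)^{i+j} [Z_i, Z_j] ∧ Z_0 ∧ ⋯ Ẑ_i ⋯ Ẑ_j ⋯ ∧ Z_{k+1} ⊗ v`; a pair `i < j` is encoded as
`i.castSucc`, `j.succ` with `i ≤ j`. -/
theorem homologyDiff_succ_apply (β : P →ₗ[ℝ] P →ₗ[ℝ] P) (hβ : ∀ x y, β y x = -β x y)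
    (τ : P →ₗ[ℝ] Module.End ℝ V) (k : ℕ) (Z : Fin (k + 2) → P) (v : V) :
    homologyDiff β τ (k + 1) (v ⊗ₜ[ℝ] exteriorPower.ιMulti ℝ (k + 2) Z) =
      ∑ i : Fin (k + 2), (-1 : ℝ) ^ ((i : ℕ) + 1) •
        (τ (Z i) v ⊗ₜ[ℝ] exteriorPower.ιMulti ℝ (k + 1) (i.removeNth Z)) +
      ∑ i : Fin (k + 1), ∑ j ≥ i, (-1 : ℝ) ^ ((i.castSucc : ℕ) + (j.succ : ℕ)) •
        (v ⊗ₜ[ℝ] exteriorPower.ιMulti ℝ (k + 1)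
          (Fin.cons (β (Z i.castSucc) (Z j.succ)) (j.removeNth (i.castSucc.removeNth Z)) :
            Fin (k + 1) → P)) := by
  have h : homologyDiff β τ (k + 1) (v ⊗ₜ[ℝ] exteriorPower.ιMulti ℝ (k + 2) Z) =
      homologyAlt β τ (k + 1) Z v := by
    simp [homologyDiff]
  have h1 : AlternatingMap.alternatizeUncurryFin (actTerm τ (k + 1)) Z v =
      ∑ i : Fin (k + 2), (-1 : ℝ) ^ (i : ℕ) •
        (τ (Z i) v ⊗ₜ[ℝ] exteriorPower.ιMulti ℝ (k + 1) (i.removeNth Z)) := by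
    rw [AlternatingMap.alternatizeUncurryFin_apply, LinearMap.sum_apply]
    refine Finset.sum_congr rfl fun i _ => ?_
    rcases (i : ℕ).even_or_odd with hi | hi <;> simp [hi.neg_one_pow, actTerm]
  have h2 := bracketTerm_alternatize (V := V) β hβ k Z v
  have h3 : homologyAlt β τ (k + 1) Z v =
      -(AlternatingMap.alternatizeUncurryFin (actTerm τ (k + 1)) Z v) -
        (1 / 2 : ℝ) • AlternatingMap.alternatizeUncurryFin
          (AlternatingMap.alternatizeUncurryFinLM ∘ₗ bracketTerm V β k) Z v := rfl
  rw [h, h3, h1, h2, sub_eq_add_neg, Finset.smul_sum, ← Finset.sum_neg_distrib,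
    ← Finset.sum_neg_distrib]
  congr 1
  · refine Finset.sum_congr rfl fun i _ => ?_
    rw [pow_succ]
    module
  · refine Finset.sum_congr rfl fun i _ => ?_
    rw [Finset.smul_sum, ← Finset.sum_neg_distrib]
    refine Finset.sum_congr rfl fun j _ => ?_
    rw [Fin.val_castSucc, Fin.val_succ, ← add_assoc, pow_succ]
    module

end Homology

/-- The Kostant codifferential `∂* : Λ^{k+1} 𝔭₊ ⊗ V → Λ^k 𝔭₊ ⊗ V`, i.e. the differential computing
the Lie algebra homology of `𝔭₊` with coefficients in `V`. -/
def kostantCodiff (Γ : Grading L) (θ : L →ₗ[ℝ] Module.End ℝ V) (k : ℕ) :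
    V ⊗[ℝ] (⋀[ℝ]^(k + 1) Γ.pPlus) →ₗ[ℝ] V ⊗[ℝ] (⋀[ℝ]^k Γ.pPlus) :=
  homologyDiff
    (LinearMap.mk₂ ℝ (fun Z Z' : Γ.pPlus => ⁅Z, Z'⁆) add_lie smul_lie lie_add lie_smul)
    (θ ∘ₗ Γ.pPlus.toSubmodule.subtype) k

/-- The `V`-valued form on `L` corresponding to an element of `Λ^k 𝔭₊ ⊗ V` under the
identification `𝔭₊ ≅ (L/𝔭)*` given by the Killing form `B`:
`Z_1 ∧ ⋯ ∧ Z_k ⊗ v` corresponds to `(X_1, …, X_k) ↦ det (B(Z_j, X_i)) v`. -/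
def toForm (Γ : Grading L) (k : ℕ) (w : V ⊗[ℝ] (⋀[ℝ]^k Γ.pPlus)) (X : Fin k → L) : V :=
  TensorProduct.lift
    (LinearMap.toSpanSingleton ℝ (Module.End ℝ V) LinearMap.id ∘ₗ
      Module.Dual.eval ℝ (⋀[ℝ]^k L) (exteriorPower.ιMulti ℝ k X) ∘ₗ
      exteriorPower.pairingDual ℝ L k ∘ₗ
      exteriorPower.map k (killingForm ℝ L ∘ₗ Γ.pPlus.toSubmodule.subtype)).flip w

theorem toForm_tmul (Γ : Grading L) (k : ℕ) (Z : Fin k → Γ.pPlus) (v : V) (X : Fin k → L) :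
    toForm Γ k (v ⊗ₜ[ℝ] exteriorPower.ιMulti ℝ k Z) X =
      Matrix.det (Matrix.of fun i j => killingForm ℝ L (Z j) (X i)) • v := by
  simp [toForm]

variable [FiniteDimensional ℝ L] [LieAlgebra.IsSemisimple ℝ L]

/-- The natural filtration of a representation of `L`: `V^a` is the sum of the eigenspaces of the
grading element for the eigenvalues `r ≥ a`. -/
def repFil (Γ : Grading L) (θ : L →ₗ[ℝ] Module.End ℝ V) (a : ℝ) : Submodule ℝ V :=
  Submodule.span ℝ {v | ∃ r : ℝ, a ≤ r ∧ θ Γ.gradingElement v = r • v}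

/-- The induced natural filtration of `Λ^k 𝔭₊ ⊗ V`: the component of degree `a` is spanned by the
`Z_1 ∧ ⋯ ∧ Z_k ⊗ v` with `Z_i ∈ L^{n_i}`, `v ∈ V^r` and `n_1 + ⋯ + n_k + r ≥ a`. -/
def formFil (Γ : Grading L) (θ : L →ₗ[ℝ] Module.End ℝ V) (k : ℕ) (a : ℝ) :
    Submodule ℝ (V ⊗[ℝ] (⋀[ℝ]^k Γ.pPlus)) :=
  Submodule.span ℝ {w | ∃ (n : Fin k → ℤ) (r : ℝ) (Z : Fin k → Γ.pPlus) (v : V),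
    (∀ i, (Z i : L) ∈ Γ.fil (n i)) ∧ v ∈ repFil Γ θ r ∧ a ≤ (∑ i, (n i : ℝ)) + r ∧
    w = v ⊗ₜ[ℝ] exteriorPower.ιMulti ℝ k Z}

end Algebra

/-! ### Calculus for functions with values in finite dimensional vector spaces -/

section Calculus

instance {E : Type*} [NormedAddCommGroup E] [NormedSpace ℝ E] [FiniteDimensional ℝ E]
    {N : Type*} [TopologicalSpace N] [ChartedSpace E N] (x : N) :
    FiniteDimensional ℝ (TangentSpace 𝓘(ℝ, E) x) :=
  inferInstanceAs (FiniteDimensional ℝ E)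

variable {E H : Type*} [NormedAddCommGroup E] [NormedSpace ℝ E] [TopologicalSpace H]
  (I : ModelWithCorners ℝ E H) {N : Type*} [TopologicalSpace N] [ChartedSpace H N]
  {W : Type*} [AddCommGroup W] [Module ℝ W]

/-- Smoothness of a map into a finite dimensional vector space: all its compositions with linear
functionals (equivalently, all its components in a basis) are smooth. -/
def IsSmooth (f : N → W) : Prop :=
  ∀ l : Module.Dual ℝ W, ContMDiff I 𝓘(ℝ, ℝ) ∞ (fun x => l (f x))

/-- The derivative of a map into a finite dimensional vector space, computed componentwise. -/
def differential [FiniteDimensional ℝ W] (f : N → W) (x : N) : TangentSpace I x →ₗ[ℝ] W :=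
  ∑ b, LinearMap.smulRight
    (((NormedSpace.fromTangentSpace (𝕜 := ℝ) _).toLinearEquiv.toLinearMap) ∘ₗ
      (mfderiv I 𝓘(ℝ, ℝ) (fun y => (Module.finBasis ℝ W).coord b (f y)) x).toLinearMap)
    (Module.finBasis ℝ W b)

end Calculus

/-! ### Parabolic subgroups and parabolic geometries -/

section Geometry

instance {E : Type*} [NormedAddCommGroup E] [NormedSpace ℝ E] [FiniteDimensional ℝ E] :
    CompleteSpace E :=
  FiniteDimensional.complete ℝ E

instance {E : Type*} [NormedAddCommGroup E] [NormedSpace ℝ E]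
    {G : Type*} [TopologicalSpace G] [ChartedSpace E G] [Group G] [LieGroup 𝓘(ℝ, E) ∞ G] :
    LieGroup 𝓘(ℝ, E) (minSmoothness ℝ 3) G := by
  rw [minSmoothness_of_isRCLikeNormedField]
  infer_instance

variable {EG : Type*} [NormedAddCommGroup EG] [NormedSpace ℝ EG] [FiniteDimensional ℝ EG]
  {G : Type*} [TopologicalSpace G] [ChartedSpace EG G] [Group G] [LieGroup 𝓘(ℝ, EG) ∞ G]

/-- The adjoint action of `G` on its Lie algebra: the derivative of conjugation at `1`. -/
def Ad (g : G) : GroupLieAlgebra 𝓘(ℝ, EG) G →ₗ[ℝ] GroupLieAlgebra 𝓘(ℝ, EG) G :=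
  show TangentSpace 𝓘(ℝ, EG) (1 : G) →ₗ[ℝ] TangentSpace 𝓘(ℝ, EG) (g * 1 * g⁻¹) from
    (mfderiv 𝓘(ℝ, EG) 𝓘(ℝ, EG) (fun x : G => g * x * g⁻¹) 1).toLinearMap

/-- The infinitesimal representation of the Lie algebra of `G` on `V`: the derivative at `1` of a
representation of `G` on `V`. -/
def infRep {V : Type*} [AddCommGroup V] [Module ℝ V] [FiniteDimensional ℝ V]
    (ρ : Representation ℝ G V) : GroupLieAlgebra 𝓘(ℝ, EG) G →ₗ[ℝ] Module.End ℝ V :=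
  differential 𝓘(ℝ, EG) (fun g : G => (ρ g : Module.End ℝ V)) 1

variable {EP : Type*} [NormedAddCommGroup EP] [NormedSpace ℝ EP] [FiniteDimensional ℝ EP]
  {P : Type*} [TopologicalSpace P] [ChartedSpace EP P] [Group P] [LieGroup 𝓘(ℝ, EP) ∞ P]

/-- The derivative at `1` of a homomorphism of Lie groups. -/
def homDeriv (j : P →* G) : GroupLieAlgebra 𝓘(ℝ, EP) P →ₗ[ℝ] GroupLieAlgebra 𝓘(ℝ, EG) G :=
  show TangentSpace 𝓘(ℝ, EP) (1 : P) →ₗ[ℝ] TangentSpace 𝓘(ℝ, EG) (j 1) from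
    (mfderiv 𝓘(ℝ, EP) 𝓘(ℝ, EG) j 1).toLinearMap

variable (P) in
/-- `P`, embedded into `G` by `incl`, is a parabolic subgroup of `G` corresponding to the grading
`Γ` of the Lie algebra of `G`: a closed Lie subgroup with Lie algebra `𝔭 = 𝔤^0` whose adjoint action
preserves the filtration `(𝔤^i)`. -/
structure ParabolicSubgroup (Γ : Grading (GroupLieAlgebra 𝓘(ℝ, EG) G)) where
  incl : P →* G
  contMDiff_incl : ContMDiff 𝓘(ℝ, EP) 𝓘(ℝ, EG) ∞ incl
  isClosedEmbedding_incl : Topology.IsClosedEmbedding incl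
  injective_homDeriv : Function.Injective (homDeriv (EG := EG) (EP := EP) incl)
  range_homDeriv : LinearMap.range (homDeriv (EG := EG) (EP := EP) incl) = Γ.fil 0
  Ad_mem : ∀ (p : P) (i : ℤ) (X : GroupLieAlgebra 𝓘(ℝ, EG) G),
    X ∈ Γ.fil i → Ad (EG := EG) (incl p) X ∈ Γ.fil i

variable {Γ : Grading (GroupLieAlgebra 𝓘(ℝ, EG) G)}

namespace ParabolicSubgroup

variable {V : Type*} [AddCommGroup V] [Module ℝ V]

/-- The adjoint action of `P` on `𝔭₊`. -/
def AdPlus (S : ParabolicSubgroup (EP := EP) P Γ) (p : P) : Γ.pPlus →ₗ[ℝ] Γ.pPlus :=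
  (Ad (EG := EG) (S.incl p)).restrict (p := Γ.pPlus.toSubmodule) (q := Γ.pPlus.toSubmodule)
    (fun X hX => S.Ad_mem p 1 X hX)

/-- The action of `P` on `Λ^k 𝔭₊ ⊗ V` for a representation `V` of `G`. -/
def formAction (S : ParabolicSubgroup (EP := EP) P Γ) (ρ : Representation ℝ G V) (k : ℕ) (p : P) :
    V ⊗[ℝ] (⋀[ℝ]^k Γ.pPlus) →ₗ[ℝ] V ⊗[ℝ] (⋀[ℝ]^k Γ.pPlus) :=
  TensorProduct.map (ρ (S.incl p)) (exteriorPower.map k (S.AdPlus p))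

end ParabolicSubgroup

variable {EM : Type*} [NormedAddCommGroup EM] [NormedSpace ℝ EM] [FiniteDimensional ℝ EM]
  (M : Type*) [TopologicalSpace M] [ChartedSpace EM M] [IsManifold 𝓘(ℝ, EM) ∞ M]
  {EB : Type*} [NormedAddCommGroup EB] [NormedSpace ℝ EB] [FiniteDimensional ℝ EB]
  (B : Type*) [TopologicalSpace B] [ChartedSpace EB B] [IsManifold 𝓘(ℝ, EB) ∞ B]

/-- A Cartan geometry of type `(G, P)` on `M`: a smooth principal right `P`-bundle `proj : B → M`
together with a Cartan connection `conn` (usually called `ω`) on its total space `B`. -/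
structure CartanGeometry (S : ParabolicSubgroup (EP := EP) P Γ) where
  act : B → P → B
  act_one : ∀ u, act u 1 = u
  act_mul : ∀ u p q, act u (p * q) = act (act u p) q
  contMDiff_act :
    ContMDiff (𝓘(ℝ, EB).prod 𝓘(ℝ, EP)) 𝓘(ℝ, EB) ∞ (fun z : B × P => act z.1 z.2)
  proj : B → M
  contMDiff_proj : ContMDiff 𝓘(ℝ, EB) 𝓘(ℝ, EM) ∞ proj
  proj_act : ∀ u p, proj (act u p) = proj u
  /-- smooth equivariant local trivializations -/
  locallyTrivial : ∀ x : M, ∃ e : Bundle.Trivialization P proj, x ∈ e.baseSet ∧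
    ContMDiffOn 𝓘(ℝ, EB) (𝓘(ℝ, EM).prod 𝓘(ℝ, EP)) ∞ e e.source ∧
    ContMDiffOn (𝓘(ℝ, EM).prod 𝓘(ℝ, EP)) 𝓘(ℝ, EB) ∞ e.toOpenPartialHomeomorph.symm e.target ∧
    ∀ u ∈ e.source, ∀ p, e (act u p) = ((e u).1, (e u).2 * p)
  conn : ∀ u : B, TangentSpace 𝓘(ℝ, EB) u →ₗ[ℝ] GroupLieAlgebra 𝓘(ℝ, EG) G
  /-- `conn` is a smooth one-form, i.e. smooth as a function on the tangent bundle -/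
  isSmooth_conn : IsSmooth 𝓘(ℝ, EB).tangent (fun v : TangentBundle 𝓘(ℝ, EB) B => conn v.1 v.2)
  bijective_conn : ∀ u, Function.Bijective (conn u)
  /-- `(r^p)^* ω = Ad(p⁻¹) ∘ ω` for `ω = conn` -/
  equivariant_conn : ∀ (p : P) (u : B) (v : TangentSpace 𝓘(ℝ, EB) u),
    conn (act u p) (mfderiv 𝓘(ℝ, EB) 𝓘(ℝ, EB) (fun w => act w p) u v) =
      Ad (EG := EG) (S.incl p⁻¹) (conn u v)
  /-- `conn` reproduces the generators of fundamental vector fields -/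
  fundamental_conn : ∀ (u : B) (A : GroupLieAlgebra 𝓘(ℝ, EP) P),
    conn (act u 1) (mfderiv 𝓘(ℝ, EP) 𝓘(ℝ, EB) (act u) 1 A) = homDeriv (EG := EG) S.incl A

namespace CartanGeometry

variable {M B} {S : ParabolicSubgroup (EP := EP) P Γ} (C : CartanGeometry (EM := EM) (EB := EB) M B S)

/-- The inverse `ω_u⁻¹ : 𝔤 → T_u B`. For fixed `X` this is the constant vector field `ω⁻¹(X)`. -/
def connInv (u : B) : GroupLieAlgebra 𝓘(ℝ, EG) G →ₗ[ℝ] TangentSpace 𝓘(ℝ, EB) u :=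
  (LinearEquiv.ofBijective (C.conn u) (C.bijective_conn u)).symm.toLinearMap

/-- The Lie bracket of the constant vector fields `ω⁻¹(X)` and `ω⁻¹(Y)`, expressed through the
connection `ω = conn`. -/
def bracket (u : B) (X Y : GroupLieAlgebra 𝓘(ℝ, EG) G) : GroupLieAlgebra 𝓘(ℝ, EG) G :=
  C.conn u (VectorField.mlieBracket 𝓘(ℝ, EB) (fun w => C.connInv w X) (fun w => C.connInv w Y) u)

/-- The curvature function `κ(X, Y) = [X, Y] - ω([ω⁻¹(X), ω⁻¹(Y)])` of the Cartan connection, i.e.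
`dω + [ω, ω] / 2` evaluated on constant vector fields. -/
def curvature (u : B) (X Y : GroupLieAlgebra 𝓘(ℝ, EG) G) : GroupLieAlgebra 𝓘(ℝ, EG) G :=
  ⁅X, Y⁆ - C.bracket u X Y

/-- Regularity: the curvature has positive homogeneity, i.e. `κ(𝔤^i, 𝔤^j) ⊆ 𝔤^{i+j+1}` for
`i, j < 0`. -/
def IsRegular : Prop :=
  ∀ (u : B) (i j : ℤ), i < 0 → j < 0 → ∀ X ∈ Γ.fil i, ∀ Y ∈ Γ.fil j,
    C.curvature u X Y ∈ Γ.fil (i + j + 1)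

section Operators

variable {W : Type*} [AddCommGroup W] [Module ℝ W] [FiniteDimensional ℝ W]

/-- The fundamental derivative `Dφ : B → Hom(𝔤, W)`, `Dφ(u)(X) = (ω⁻¹(X) · φ)(u)`. On `P`-equivariant
`φ` it is the fundamental derivative of the corresponding section: for `P`-equivariant `s : B → 𝔤`
the function `u ↦ Dφ(u)(s(u))` represents `D_s φ`. -/
def fundDeriv (φ : B → W) (u : B) : GroupLieAlgebra 𝓘(ℝ, EG) G →ₗ[ℝ] W :=
  differential 𝓘(ℝ, EB) φ u ∘ₗ C.connInv u

/-- The curved Casimir operator `(B ⊗ id) ∘ D²`, where `B` is the Killing form. -/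
def curvedCasimir [LieAlgebra.IsSemisimple ℝ (GroupLieAlgebra 𝓘(ℝ, EG) G)] (φ : B → W) (u : B) : W :=
  killingTrace (C.fundDeriv (C.fundDeriv φ) u)

end Operators

variable {V : Type*} [AddCommGroup V] [Module ℝ V] [FiniteDimensional ℝ V]

/-- The tractor connection in the direction of `ω⁻¹(X)`: `∇_X σ = D_X σ + X • σ`. On `P`-equivariant
`σ` it represents the tractor connection on `V M` (in the direction of the projection of `ω⁻¹(X)` to
`M`); on general `V`-valued functions it is the pull-back to `B` of that connection. -/
def tractorDeriv (ρ : Representation ℝ G V) (X : GroupLieAlgebra 𝓘(ℝ, EG) G) (σ : B → V) (u : B) : V :=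
  C.fundDeriv σ u X + infRep ρ X (σ u)

/-- The standard global formula for the exterior derivative, with the action of vector fields
replaced by the covariant derivative, for a `V M`-valued `k`-form pulled back to `B`, evaluated on the constant vector fields `ω⁻¹(X_0), …, ω⁻¹(X_k)`:
`∑_i (-1)^i ∇_{X_i} (φ(X_0, … X̂_i …, X_k))`
`+ ∑_{i<j} (-1)^{i+j} φ([X_i, X_j], X_0, … X̂_i … X̂_j …, X_k)`,
where the brackets are those of the vector fields `ω⁻¹(X_i)`. A pair `i < j` is encoded as
`i.castSucc`, `j.succ` with `i ≤ j`. -/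
def koszul (ρ : Representation ℝ G V) : (k : ℕ) → (B → V ⊗[ℝ] (⋀[ℝ]^k Γ.pPlus)) → B →
    (Fin (k + 1) → GroupLieAlgebra 𝓘(ℝ, EG) G) → V
  | 0, φ, u, X => C.tractorDeriv ρ (X 0) (fun w => toForm Γ 0 (φ w) (Fin.removeNth 0 X)) u
  | k + 1, φ, u, X =>
    ∑ i : Fin (k + 2), (-1 : ℝ) ^ (i : ℕ) •
      C.tractorDeriv ρ (X i) (fun w => toForm Γ (k + 1) (φ w) (i.removeNth X)) u +
    ∑ i : Fin (k + 1), ∑ j ≥ i, (-1 : ℝ) ^ ((i.castSucc : ℕ) + (j.succ : ℕ)) •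
      toForm Γ (k + 1) (φ u)
        (Fin.cons (C.bracket u (X i.castSucc) (X j.succ)) (j.removeNth (i.castSucc.removeNth X)))

/-- The covariant exterior derivative `d^∇`: the element of `Λ^{k+1} 𝔭₊ ⊗ V` representing the
horizontal form given by the global formula. -/
def covExtDeriv (ρ : Representation ℝ G V) (k : ℕ) (φ : B → V ⊗[ℝ] (⋀[ℝ]^k Γ.pPlus)) (u : B) :
    V ⊗[ℝ] (⋀[ℝ]^(k + 1) Γ.pPlus) :=
  Classical.epsilon fun ψ => ∀ X, toForm Γ (k + 1) ψ X = C.koszul ρ k φ u X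

/-- `□^R = ∂* d^∇ + d^∇ ∂*` on `V M`-valued `k`-forms (with `∂* = 0` on `0`-forms). -/
def boxR (ρ : Representation ℝ G V) : (k : ℕ) → (B → V ⊗[ℝ] (⋀[ℝ]^k Γ.pPlus)) →
    B → V ⊗[ℝ] (⋀[ℝ]^k Γ.pPlus)
  | 0, φ, u => kostantCodiff Γ (infRep ρ) 0 (C.covExtDeriv ρ 0 φ u)
  | k + 1, φ, u => kostantCodiff Γ (infRep ρ) (k + 1) (C.covExtDeriv ρ (k + 1) φ u) +
      C.covExtDeriv ρ k (fun w => kostantCodiff Γ (infRep ρ) k (φ w)) u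

/-- The operator `2 □^R - 𝒞 + c₀` on `V M`-valued `k`-forms. -/
def diffOp [LieAlgebra.IsSemisimple ℝ (GroupLieAlgebra 𝓘(ℝ, EG) G)] (ρ : Representation ℝ G V)
    (c₀ : ℝ) (k : ℕ) (φ : B → V ⊗[ℝ] (⋀[ℝ]^k Γ.pPlus)) (u : B) : V ⊗[ℝ] (⋀[ℝ]^k Γ.pPlus) :=
  (2 : ℝ) • C.boxR ρ k φ u - C.curvedCasimir φ u + c₀ • φ u

/-- `φ` represents a smooth `V M`-valued `k`-form, i.e. a smooth section of `Λ^k T*M ⊗ V M`: it is a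
smooth function `B → Λ^k 𝔭₊ ⊗ V` with `φ(u · p) = p⁻¹ · φ(u)`. -/
structure IsForm (ρ : Representation ℝ G V) (k : ℕ) (φ : B → V ⊗[ℝ] (⋀[ℝ]^k Γ.pPlus)) : Prop where
  smooth : IsSmooth 𝓘(ℝ, EB) φ
  equivariant : ∀ u p, φ (C.act u p) = S.formAction ρ k p⁻¹ (φ u)

end CartanGeometry

end Geometry

end ParabolicGeometry

/-! The idea is to work on the total space of the Cartan bundle with forms on all of 𝔤 instead of
𝔤/𝔭. The Killing form B makes V ⊗ Λ𝔤 a Fock space: exterior multiplications ε_x and contractions ι_x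
with B(x, ·) satisfy ε_x ι_y + ι_y ε_x = B(x, y), and Λ^k 𝔭₊ ⊗ V is the part of degree k killed by
all ι_a with a ∈ 𝔭. Let θ be the action of 𝔤 on V and Λ the total action on V ⊗ Λ𝔤. Since 𝔭₊ is a
subalgebra, the Kostant codifferential is the restriction of the homology differential ∂* of 𝔤
itself (`homolOp_fockIncl`), which is invariant under all of 𝔤.

On constant vector fields the bracket is [x, y] - κ(x, y), so the covariant exterior derivative
becomes Σ ε(ξ^l) D_{ξ_l} + ∂_𝔤 + ι_κ, with ∂_𝔤 the Chevalley–Eilenberg differential and ι_κ the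
insertion of the curvature (`extDiff_eq`). Two algebraic identities, ∂* ε_z + ε_z ∂* = -Λ_z
(`homolOp_create`) and ∂* ∂_𝔤 + ∂_𝔤 ∂* = -½ (Σ Λ(ξ_l)Λ(ξ^l) + Σ θ(ξ_l)θ(ξ^l)) (`homolOp_cohomOp`),
then give (`codiff_extDiff`) 2 □^R = -2 Σ Λ(ξ^l) D_{ξ_l} - Σ Λ(ξ_l)Λ(ξ^l) - c₀ + 2 (∂* ι_κ + ι_κ
∂*).

The first two terms are exactly the curved Casimir. By equivariance D_a = -Λ_a for a ∈ 𝔭, so the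
symmetrically twisted second derivative T(x, y) = D_x D_y + Λ_y D_x + Λ_x D_y + Λ_x Λ_y vanishes for
y ∈ 𝔭. Because 𝔭₊ and the negative part are dual under B, the trace of T reduces to D + Λ evaluated
on an element of 𝔤_0, hence to zero (`sum_twisted_derivatives`). So the operator is 2 (∂* ι_κ + ι_κ
∂*) (`formIncl_diffOp`), which at each point is a linear map applied to the value of the form. Under
regularity ι_κ raises the filtration degree by one (`insert_mem_formFil`), while ∂* preserves it
(`kostantCodiff_mem_formFil`).

The analytic input is that κ is smooth, equivariant and horizontal (`isSmooth_curvatureMap`,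
`curvatureMap_act`, `bracket_of_mem`). Horizontality rests on one computation,
`mlieBracket_fundamental`, which also shows that the derivative of Ad is ad. Horizontality of κ and
equivariance of the form make the global formula for d^∇ horizontal, so that the element chosen in
`covExtDeriv` exists and is unique. -/

namespace ParabolicGeometry

set_option linter.unusedSectionVars false

/-! ### Dual bases and contraction with a symmetric form -/

section DualPair

variable {L : Type*} [AddCommGroup L] [Module ℝ L] {κ : Type*} [Fintype κ]
  {M : Type*} [AddCommGroup M] [Module ℝ M]

/-- `e` and `e'` are dual families for the symmetric bilinear form `B`. -/
structure IsDualPair (B : LinearMap.BilinForm ℝ L) (e e' : κ → L) : Prop where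
  symm : ∀ x y, B x y = B y x
  expand : ∀ x, ∑ l, B x (e' l) • e l = x
  expand' : ∀ x, ∑ l, B x (e l) • e' l = x

namespace IsDualPair

variable {B : LinearMap.BilinForm ℝ L} {e e' : κ → L}

/-- Expanding f(e_l) in the first family and g(e'_l) in the second gives the same double sum, with
matrix B(f e_l, e'_m). This moves projections from one slot of a trace to the other. -/
theorem sum_adjoint (h : IsDualPair B e e') (T : L →ₗ[ℝ] L →ₗ[ℝ] M) {f g : L →ₗ[ℝ] L}
    (hfg : ∀ x y, B (f x) y = B x (g y)) :
    ∑ l, T (f (e l)) (e' l) = ∑ l, T (e l) (g (e' l)) := by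
  have h1 : ∀ l, T (f (e l)) (e' l) = ∑ m, B (f (e l)) (e' m) • T (e m) (e' l) := fun l => by
    conv_lhs => rw [← h.expand (f (e l))]
    simp
  have h2 : ∀ m, T (e m) (g (e' m)) = ∑ l, B (f (e l)) (e' m) • T (e m) (e' l) := fun m => by
    conv_lhs => rw [← h.expand' (g (e' m))]
    simp [hfg, h.symm (g (e' m))]
  simp_rw [h1, h2]
  exact Finset.sum_comm

/-- The tensor Σ e_l ⊗ e'_l is symmetric because B is. -/
theorem sum_symm (h : IsDualPair B e e') (T : L →ₗ[ℝ] L →ₗ[ℝ] M) :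
    ∑ l, T (e l) (e' l) = ∑ l, T (e' l) (e l) := by
  have h1 : ∀ l, T (e' l) (e l) = ∑ m, B (e' l) (e' m) • T (e m) (e l) := fun l => by
    conv_lhs => rw [← h.expand (e' l)]
    simp
  have h2 : ∀ m, T (e m) (e' m) = ∑ l, B (e' l) (e' m) • T (e m) (e l) := fun m => by
    conv_lhs => rw [← h.expand (e' m)]
    simp [h.symm (e' m)]
  simp_rw [h1, h2]
  exact Finset.sum_comm

theorem sum_contract (h : IsDualPair B e e') (S : L →ₗ[ℝ] M) (x : L) :
    ∑ l, B x (e l) • S (e' l) = S x := by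
  conv_rhs => rw [← h.expand' x]
  simp

theorem sum_contract' (h : IsDualPair B e e') (S : L →ₗ[ℝ] M) (x : L) :
    ∑ l, B x (e' l) • S (e l) = S x := by
  conv_rhs => rw [← h.expand x]
  simp

/-- Invariance of the contraction with dual bases. -/
theorem sum_lie {L : Type*} [LieRing L] [LieAlgebra ℝ L] {B : LinearMap.BilinForm ℝ L}
    {e e' : κ → L} (h : IsDualPair B e e')
    (hB : ∀ x y z : L, B ⁅x, y⁆ z = -B y ⁅x, z⁆) (T : L →ₗ[ℝ] L →ₗ[ℝ] M) (x : L) :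
    ∑ l, T ⁅x, e l⁆ (e' l) = -∑ l, T (e l) ⁅x, e' l⁆ := by
  have := h.sum_adjoint T (f := LieAlgebra.ad ℝ L x) (g := -LieAlgebra.ad ℝ L x)
    (fun y z => by rw [LieAlgebra.ad_apply, hB, LinearMap.neg_apply, LieAlgebra.ad_apply, map_neg])
  simpa only [LinearMap.neg_apply, LieAlgebra.ad_apply, map_neg, Finset.sum_neg_distrib] using this

end IsDualPair

end DualPair

/-! ### Creation and annihilation operators; the differentials of Lie algebra homology and
cohomology -/

section Fock

variable {L : Type*} [LieRing L] [LieAlgebra ℝ L] {κ : Type*} [Fintype κ]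
  {R : Type*} [Ring R] [Algebra ℝ R]

/-- Creation operators `ε`, annihilation operators `ι` and a commuting representation `θ` of a Lie
algebra with an invariant form `B`. -/
structure FockRelations (B : LinearMap.BilinForm ℝ L) (ε ι θ : L →ₗ[ℝ] R) : Prop where
  invariant : ∀ x y z : L, B ⁅x, y⁆ z = -B y ⁅x, z⁆
  create_create : ∀ x y, ε x * ε y + ε y * ε x = 0
  annihilate_annihilate : ∀ x y, ι x * ι y + ι y * ι x = 0
  create_annihilate : ∀ x y, ε x * ι y + ι y * ε x = B x y • 1
  commute_create : ∀ x y, θ x * ε y = ε y * θ x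
  commute_annihilate : ∀ x y, θ x * ι y = ι y * θ x
  lie_act : ∀ x y : L, θ ⁅x, y⁆ = θ x * θ y - θ y * θ x

namespace FockRelations

variable {B : LinearMap.BilinForm ℝ L} {e e' : κ → L} {ε ι θ : L →ₗ[ℝ] R}

variable (e e' ε ι θ) in
/-- The derivation extending `ad x`. -/
def adOp : L →ₗ[ℝ] R where
  toFun x := ∑ l, ε ⁅x, e l⁆ * ι (e' l)
  map_add' x y := by simp [add_mul, Finset.sum_add_distrib]
  map_smul' c x := by simp [Finset.smul_sum]

theorem adOp_apply (x : L) : adOp e e' ε ι x = ∑ l, ε ⁅x, e l⁆ * ι (e' l) := rfl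

variable (e e' ε ι θ) in
/-- The total action of the Lie algebra. -/
def lieOp : L →ₗ[ℝ] R := θ + adOp e e' ε ι

theorem lieOp_apply (x : L) : lieOp e e' ε ι θ x = θ x + adOp e e' ε ι x := rfl

variable (e e' ε ι θ) in
/-- The homology differential. -/
def homolOp : R :=
  -∑ l, θ (e' l) * ι (e l) - (1 / 2 : ℝ) • ∑ l, adOp e e' ε ι (e' l) * ι (e l)

variable (e e' ε ι θ) in
/-- The cohomology differential. -/
def cohomOp : R :=
  ∑ l, ε (e' l) * θ (e l) + (1 / 2 : ℝ) • ∑ l, ε (e' l) * adOp e e' ε ι (e l)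

variable (hD : IsDualPair B e e') (h : FockRelations B ε ι θ)
include hD h

/-- Moving ε_y through ε ι leaves only the contraction of ε_y with ι, since creation operators
anticommute. -/
theorem adOp_create (x y : L) :
    adOp e e' ε ι x * ε y - ε y * adOp e e' ε ι x = ε ⁅x, y⁆ := by
  have key : ∀ l, ε ⁅x, e l⁆ * ι (e' l) * ε y - ε y * (ε ⁅x, e l⁆ * ι (e' l)) =
      B y (e' l) • ε ⁅x, e l⁆ := fun l => by
    have h1 := h.create_annihilate y (e' l)
    have h2 := h.create_create ⁅x, e l⁆ y
    calc _ = ε ⁅x, e l⁆ * (ε y * ι (e' l) + ι (e' l) * ε y) -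
          (ε ⁅x, e l⁆ * ε y + ε y * ε ⁅x, e l⁆) * ι (e' l) := by noncomm_ring
      _ = _ := by rw [h1, h2]; simp
  rw [adOp_apply, Finset.sum_mul, Finset.mul_sum, ← Finset.sum_sub_distrib]
  simp_rw [key]
  exact hD.sum_contract' (ε ∘ₗ LieAlgebra.ad ℝ L x) y

theorem adOp_annihilate (x y : L) :
    adOp e e' ε ι x * ι y - ι y * adOp e e' ε ι x = ι ⁅x, y⁆ := by
  have key : ∀ l, ε ⁅x, e l⁆ * ι (e' l) * ι y - ι y * (ε ⁅x, e l⁆ * ι (e' l)) =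
      B ⁅x, y⁆ (e l) • ι (e' l) := fun l => by
    have h1 := h.create_annihilate ⁅x, e l⁆ y
    have h2 := h.annihilate_annihilate (e' l) y
    calc _ = ε ⁅x, e l⁆ * (ι (e' l) * ι y + ι y * ι (e' l)) -
          (ε ⁅x, e l⁆ * ι y + ι y * ε ⁅x, e l⁆) * ι (e' l) := by noncomm_ring
      _ = _ := by rw [h1, h2, h.invariant, hD.symm (e l)]; simp
  rw [adOp_apply, Finset.sum_mul, Finset.mul_sum, ← Finset.sum_sub_distrib]
  simp_rw [key]
  exact hD.sum_contract ι _

theorem adOp_eq (x : L) : adOp e e' ε ι x = -∑ l, ε (e l) * ι ⁅x, e' l⁆ :=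
  hD.sum_lie h.invariant ((LinearMap.mul ℝ R).compl₁₂ ε ι) x

theorem adOp_eq' (x : L) : adOp e e' ε ι x = -∑ l, ε (e' l) * ι ⁅x, e l⁆ := by
  rw [adOp_eq hD h]
  congr 1
  exact hD.sum_symm ((LinearMap.mul ℝ R).compl₁₂ ε (ι ∘ₗ (LieAlgebra.ad ℝ L x)))

theorem adOp_eq_symm (x : L) : adOp e e' ε ι x = ∑ l, ε ⁅x, e' l⁆ * ι (e l) :=
  hD.sum_symm ((LinearMap.mul ℝ R).compl₁₂ (ε ∘ₗ (LieAlgebra.ad ℝ L x)) ι)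

/-- Commuting with the derivation of x acts on the two factors of each summand separately;
invariance of B moves x off the second factor, and the Jacobi identity remains. -/
theorem adOp_lie (x y : L) : adOp e e' ε ι ⁅x, y⁆ =
    adOp e e' ε ι x * adOp e e' ε ι y - adOp e e' ε ι y * adOp e e' ε ι x := by
  have key : ∀ l, adOp e e' ε ι x * (ε ⁅y, e l⁆ * ι (e' l)) -
      ε ⁅y, e l⁆ * ι (e' l) * adOp e e' ε ι x =
      ε ⁅x, ⁅y, e l⁆⁆ * ι (e' l) + ε ⁅y, e l⁆ * ι ⁅x, e' l⁆ := fun l => by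
    rw [← adOp_create hD h x, ← adOp_annihilate hD h x]
    noncomm_ring
  have h3 := hD.sum_lie h.invariant
    ((LinearMap.mul ℝ R).compl₁₂ (ε ∘ₗ (LieAlgebra.ad ℝ L y)) ι) x
  simp only [LinearMap.compl₁₂_apply, LinearMap.comp_apply,
    LieAlgebra.ad_apply, LinearMap.mul_apply'] at h3
  rw [adOp_apply y, Finset.mul_sum, Finset.sum_mul, ← Finset.sum_sub_distrib]
  simp_rw [key]
  rw [Finset.sum_add_distrib, ← neg_eq_iff_eq_neg.mpr h3, ← sub_eq_add_neg,
    ← Finset.sum_sub_distrib, adOp_apply]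
  exact Finset.sum_congr rfl fun l _ => by rw [lie_lie, map_sub, sub_mul]

theorem adOp_act (x y : L) : adOp e e' ε ι x * θ y = θ y * adOp e e' ε ι x := by
  rw [adOp_apply, Finset.sum_mul, Finset.mul_sum]
  refine Finset.sum_congr rfl fun l _ => ?_
  rw [mul_assoc, ← h.commute_annihilate, ← mul_assoc, ← h.commute_create, mul_assoc]

theorem lieOp_create (x y : L) :
    lieOp e e' ε ι θ x * ε y - ε y * lieOp e e' ε ι θ x = ε ⁅x, y⁆ := by
  rw [← adOp_create hD h x y, lieOp_apply, add_mul, mul_add, h.commute_create]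
  abel

theorem lieOp_annihilate (x y : L) :
    lieOp e e' ε ι θ x * ι y - ι y * lieOp e e' ε ι θ x = ι ⁅x, y⁆ := by
  rw [← adOp_annihilate hD h x y, lieOp_apply, add_mul, mul_add, h.commute_annihilate]
  abel

theorem lieOp_act (x y : L) :
    lieOp e e' ε ι θ x * θ y - θ y * lieOp e e' ε ι θ x = θ ⁅x, y⁆ := by
  rw [h.lie_act, lieOp_apply, add_mul, mul_add, adOp_act hD h]
  abel

theorem lieOp_adOp (x y : L) :
    lieOp e e' ε ι θ x * adOp e e' ε ι y - adOp e e' ε ι y * lieOp e e' ε ι θ x =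
      adOp e e' ε ι ⁅x, y⁆ := by
  rw [adOp_lie hD h, lieOp_apply, add_mul, mul_add, adOp_act hD h]
  abel

theorem lieOp_lie (x y : L) : lieOp e e' ε ι θ ⁅x, y⁆ =
    lieOp e e' ε ι θ x * lieOp e e' ε ι θ y - lieOp e e' ε ι θ y * lieOp e e' ε ι θ x := by
  rw [lieOp_apply ⁅x, y⁆, ← lieOp_act hD h, ← lieOp_adOp hD h, lieOp_apply y, mul_add, add_mul]
  abel

/-- Anticommuting with ε_z produces the derivation of z twice in the quadratic part, once by
contracting with ι and once by commuting past `adOp`; this cancels the factor 1/2. It fixes the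
first order part of the Laplacian. -/
theorem homolOp_create (z : L) :
    homolOp e e' ε ι θ * ε z + ε z * homolOp e e' ε ι θ = -lieOp e e' ε ι θ z := by
  have h1 : ∀ l, θ (e' l) * ι (e l) * ε z + ε z * (θ (e' l) * ι (e l)) =
      B z (e l) • θ (e' l) := fun l => by
    calc _ = θ (e' l) * (ε z * ι (e l) + ι (e l) * ε z) := by
          rw [← mul_assoc (ε z), ← h.commute_create]; noncomm_ring
      _ = _ := by rw [h.create_annihilate]; simp
  have h2 : ∀ l, adOp e e' ε ι (e' l) * ι (e l) * ε z + ε z * (adOp e e' ε ι (e' l) * ι (e l)) =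
      B z (e l) • adOp e e' ε ι (e' l) + ε ⁅z, e' l⁆ * ι (e l) := fun l => by
    calc _ = adOp e e' ε ι (e' l) * (ε z * ι (e l) + ι (e l) * ε z) -
            (adOp e e' ε ι (e' l) * ε z - ε z * adOp e e' ε ι (e' l)) * ι (e l) := by noncomm_ring
      _ = _ := by rw [h.create_annihilate, adOp_create hD h, ← lie_skew z, map_neg, neg_mul, mul_smul_comm,
          mul_one, sub_eq_add_neg]
  have h3 : (∑ l, θ (e' l) * ι (e l)) * ε z + ε z * ∑ l, θ (e' l) * ι (e l) = θ z := by
    rw [Finset.sum_mul, Finset.mul_sum, ← Finset.sum_add_distrib]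
    simp_rw [h1]
    exact hD.sum_contract θ z
  have h4 : (∑ l, adOp e e' ε ι (e' l) * ι (e l)) * ε z +
      ε z * ∑ l, adOp e e' ε ι (e' l) * ι (e l) = (2 : ℝ) • adOp e e' ε ι z := by
    rw [Finset.sum_mul, Finset.mul_sum, ← Finset.sum_add_distrib]
    simp_rw [h2]
    rw [Finset.sum_add_distrib, ← adOp_eq_symm hD h, hD.sum_contract (adOp e e' ε ι) z, two_smul]
  have h5 : homolOp e e' ε ι θ * ε z + ε z * homolOp e e' ε ι θ =
      -((∑ l, θ (e' l) * ι (e l)) * ε z + ε z * ∑ l, θ (e' l) * ι (e l)) - (1 / 2 : ℝ) •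
      ((∑ l, adOp e e' ε ι (e' l) * ι (e l)) * ε z +
        ε z * ∑ l, adOp e e' ε ι (e' l) * ι (e l)) := by
    simp only [homolOp, sub_mul, mul_sub, smul_mul_assoc, mul_smul_comm, smul_add, neg_mul, mul_neg]
    abel
  rw [h5, h3, h4, smul_smul, lieOp_apply]
  norm_num
  abel

/-- Cartan's formula for the Chevalley–Eilenberg differential; as for `homolOp_create`, the factor
1/2 is absorbed by two equal contributions. -/
theorem annihilate_cohomOp (a : L) :
    ι a * cohomOp e e' ε ι θ + cohomOp e e' ε ι θ * ι a = lieOp e e' ε ι θ a := by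
  have h1 : ∀ l, ι a * (ε (e' l) * θ (e l)) + ε (e' l) * θ (e l) * ι a =
      B a (e' l) • θ (e l) := fun l => by
    calc _ = (ε (e' l) * ι a + ι a * ε (e' l)) * θ (e l) := by
          rw [mul_assoc (ε _), h.commute_annihilate]; noncomm_ring
      _ = _ := by rw [h.create_annihilate, hD.symm]; simp
  have h2 : ∀ l, ι a * (ε (e' l) * adOp e e' ε ι (e l)) + ε (e' l) * adOp e e' ε ι (e l) * ι a =
      B a (e' l) • adOp e e' ε ι (e l) - ε (e' l) * ι ⁅a, e l⁆ := fun l => by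
    calc _ = (ε (e' l) * ι a + ι a * ε (e' l)) * adOp e e' ε ι (e l) + ε (e' l) *
            (adOp e e' ε ι (e l) * ι a - ι a * adOp e e' ε ι (e l)) := by noncomm_ring
      _ = _ := by
        rw [h.create_annihilate, adOp_annihilate hD h, ← lie_skew a, hD.symm, map_neg, mul_neg,
          smul_mul_assoc, one_mul, sub_neg_eq_add]
  have h3 : ι a * ∑ l, ε (e' l) * θ (e l) + (∑ l, ε (e' l) * θ (e l)) * ι a = θ a := by
    rw [Finset.sum_mul, Finset.mul_sum, ← Finset.sum_add_distrib]
    simp_rw [h1]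
    exact hD.sum_contract' θ a
  have h4 : ι a * ∑ l, ε (e' l) * adOp e e' ε ι (e l) +
      (∑ l, ε (e' l) * adOp e e' ε ι (e l)) * ι a = (2 : ℝ) • adOp e e' ε ι a := by
    rw [Finset.sum_mul, Finset.mul_sum, ← Finset.sum_add_distrib]
    simp_rw [h2]
    rw [Finset.sum_sub_distrib, hD.sum_contract' (adOp e e' ε ι) a, two_smul, sub_eq_add_neg,
      ← adOp_eq' hD h]
  have h5 : ι a * cohomOp e e' ε ι θ + cohomOp e e' ε ι θ * ι a =
      (ι a * ∑ l, ε (e' l) * θ (e l) + (∑ l, ε (e' l) * θ (e l)) * ι a) + (1 / 2 : ℝ) •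
      (ι a * ∑ l, ε (e' l) * adOp e e' ε ι (e l) +
      (∑ l, ε (e' l) * adOp e e' ε ι (e l)) * ι a) := by
    simp only [cohomOp, add_mul, mul_add, smul_mul_assoc, mul_smul_comm, smul_add]
    abel
  rw [h5, h3, h4, smul_smul, lieOp_apply]
  norm_num

/-- Both parts of the differential are invariant contractions Σ S(e'_l) ι(e_l) with S equivariant,
so the two ways of moving x cancel. -/
theorem lieOp_homolOp (x : L) :
    lieOp e e' ε ι θ x * homolOp e e' ε ι θ = homolOp e e' ε ι θ * lieOp e e' ε ι θ x := by
  have key : ∀ S : L →ₗ[ℝ] R, (∀ y, lieOp e e' ε ι θ x * S y - S y * lieOp e e' ε ι θ x = S ⁅x, y⁆) →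
      lieOp e e' ε ι θ x * (∑ l, S (e' l) * ι (e l)) =
        (∑ l, S (e' l) * ι (e l)) * lieOp e e' ε ι θ x := fun S hS => by
    have h1 : ∀ l, lieOp e e' ε ι θ x * (S (e' l) * ι (e l)) -
        S (e' l) * ι (e l) * lieOp e e' ε ι θ x =
        S ⁅x, e' l⁆ * ι (e l) + S (e' l) * ι ⁅x, e l⁆ := fun l => by
      rw [← hS, ← lieOp_annihilate hD h]
      noncomm_ring
    have h2 := hD.sum_lie h.invariant ((LinearMap.mul ℝ R).compl₁₂ S ι).flip x
    simp only [LinearMap.compl₁₂_apply, LinearMap.flip_apply, LinearMap.mul_apply'] at h2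
    rw [← sub_eq_zero, Finset.mul_sum, Finset.sum_mul, ← Finset.sum_sub_distrib]
    simp_rw [h1]
    rw [Finset.sum_add_distrib, h2, add_neg_cancel]
  have h1 := key θ (lieOp_act hD h x)
  have h2 := key (adOp e e' ε ι) (lieOp_adOp hD h x)
  simp only [homolOp, sub_mul, mul_sub, smul_mul_assoc, mul_smul_comm, neg_mul, mul_neg, h1, h2]

/-- The action on V alone is not a symmetry of the differential; the defect comes only from the part
Σ θ ι. -/
theorem act_homolOp (x : L) : θ x * homolOp e e' ε ι θ - homolOp e e' ε ι θ * θ x =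
    -∑ l, θ ⁅x, e' l⁆ * ι (e l) := by
  have h1 : ∀ l, θ x * (θ (e' l) * ι (e l)) - θ (e' l) * ι (e l) * θ x = θ ⁅x, e' l⁆ * ι (e l) :=
    fun l => by
      rw [h.lie_act, mul_assoc (θ (e' l)), ← h.commute_annihilate]
      noncomm_ring
  have h2 : ∀ l, θ x * (adOp e e' ε ι (e' l) * ι (e l)) =
      adOp e e' ε ι (e' l) * ι (e l) * θ x := fun l => by
    rw [mul_assoc (adOp _ _ _ _ _), ← h.commute_annihilate, ← mul_assoc, ← mul_assoc, adOp_act hD h]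
  simp_rw [← h1]
  simp only [homolOp, sub_mul, mul_sub, smul_mul_assoc, mul_smul_comm, neg_mul, mul_neg,
    Finset.mul_sum, Finset.sum_mul, h2, Finset.sum_sub_distrib]
  abel

/-- The defects of `act_homolOp` add up to the mixed term between θ and Λ, which cancels in the
algebraic Laplacian. -/
theorem sum_create_act_homolOp :
    ∑ l, ε (e' l) * (θ (e l) * homolOp e e' ε ι θ - homolOp e e' ε ι θ * θ (e l)) =
      ∑ l, θ (e l) * adOp e e' ε ι (e' l) := by
  have h1 : ∀ m, ∑ l, ε (e' l) * (θ ⁅e l, e' m⁆ * ι (e m)) =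
      -∑ l, θ (e l) * (ε ⁅e' l, e' m⁆ * ι (e m)) := fun m => by
    have h2 := hD.sum_lie h.invariant ((LinearMap.mul ℝ R).compl₁₂ θ
      ((LinearMap.mulRight ℝ (ι (e m))) ∘ₗ ε)) (e' m)
    simp only [LinearMap.compl₁₂_apply, LinearMap.comp_apply, LinearMap.mulRight_apply,
      LinearMap.mul_apply'] at h2
    rw [← Finset.sum_neg_distrib, ← neg_inj, ← Finset.sum_neg_distrib]
    calc _ = ∑ l, θ ⁅e' m, e l⁆ * (ε (e' l) * ι (e m)) := by
          refine Finset.sum_congr rfl fun l _ => ?_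
          rw [← lie_skew, map_neg, ← mul_assoc (ε _), mul_neg, ← h.commute_create]
          noncomm_ring
      _ = _ := by
        rw [h2, Finset.sum_neg_distrib, neg_neg, ← Finset.sum_neg_distrib]
        refine Finset.sum_congr rfl fun l _ => ?_
        rw [← lie_skew, map_neg, neg_mul, mul_neg]
        simp
  simp_rw [act_homolOp hD h, mul_neg, Finset.mul_sum, Finset.sum_neg_distrib]
  rw [Finset.sum_comm]
  simp_rw [h1, Finset.sum_neg_distrib, neg_neg]
  rw [Finset.sum_comm]
  simp_rw [← Finset.mul_sum, ← adOp_eq_symm hD h]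

/-- The algebraic Laplacian is given by the Casimir operators of `lieOp` and `θ`. -/
theorem homolOp_cohomOp :
    homolOp e e' ε ι θ * cohomOp e e' ε ι θ + cohomOp e e' ε ι θ * homolOp e e' ε ι θ =
      -((1 / 2 : ℝ) • (∑ l, lieOp e e' ε ι θ (e l) * lieOp e e' ε ι θ (e' l) +
        ∑ l, θ (e l) * θ (e' l))) := by
  set H := homolOp e e' ε ι θ with hH
  set A := adOp e e' ε ι with hA
  set Λ := lieOp e e' ε ι θ with hΛ
  -- Since the adjoint part is Λ - θ, the differential θ + ½(Λ - θ) is the average of Λ and θ.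
  have h0 : cohomOp e e' ε ι θ = (1 / 2 : ℝ) • ∑ l, ε (e' l) * (Λ (e l) + θ (e l)) := by
    simp only [cohomOp, hΛ, lieOp_apply, mul_add, Finset.sum_add_distrib, smul_add, ← hA]
    module
  -- The anticommutator with ε gives -Λ, Λ commutes with H, and only the commutator of θ with H is
  -- left over.
  have h1 : ∀ l, H * (ε (e' l) * (Λ (e l) + θ (e l))) + ε (e' l) * (Λ (e l) + θ (e l)) * H =
      -(Λ (e' l) * (Λ (e l) + θ (e l))) + ε (e' l) * (θ (e l) * H - H * θ (e l)) := fun l => by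
    rw [← neg_mul, ← homolOp_create hD h]
    calc _ = (H * ε (e' l) + ε (e' l) * H) * (Λ (e l) + θ (e l)) +
          ε (e' l) * (θ (e l) * H - H * θ (e l)) + ε (e' l) * (Λ (e l) * H - H * Λ (e l)) := by
            noncomm_ring
      _ = _ := by rw [lieOp_homolOp hD h, sub_self, mul_zero, add_zero]
  -- The term θ A obtained here is the one cancelled by `sum_create_act_homolOp`.
  have h2 : ∀ l, Λ (e' l) * (Λ (e l) + θ (e l)) =
      Λ (e' l) * Λ (e l) + θ (e' l) * θ (e l) + θ (e l) * A (e' l) := fun l => by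
    rw [mul_add, hΛ, lieOp_apply (e' l), ← adOp_act hD h]
    noncomm_ring
  have h3 : ∑ l, Λ (e' l) * Λ (e l) = ∑ l, Λ (e l) * Λ (e' l) :=
    (hD.sum_symm ((LinearMap.mul ℝ R).compl₁₂ Λ Λ)).symm
  have h4 : ∑ l, θ (e' l) * θ (e l) = ∑ l, θ (e l) * θ (e' l) :=
    (hD.sum_symm ((LinearMap.mul ℝ R).compl₁₂ θ θ)).symm
  rw [h0, mul_smul_comm, smul_mul_assoc, ← smul_add, ← smul_neg, Finset.mul_sum, Finset.sum_mul,
    ← Finset.sum_add_distrib]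
  congr 1
  simp_rw [h1, h2]
  rw [Finset.sum_add_distrib, hH, sum_create_act_homolOp hD h, Finset.sum_neg_distrib,
    Finset.sum_add_distrib, Finset.sum_add_distrib, h3, h4]
  abel

end FockRelations

end Fock

/-! ### Insertion of two-forms, and invariance under isometric automorphisms -/

section FockInvariance

variable {L : Type*} [LieRing L] [LieAlgebra ℝ L] {κ : Type*} [Fintype κ]
  {R : Type*} [Ring R] [Algebra ℝ R]

theorem IsDualPair.sum_isometry {L : Type*} [AddCommGroup L] [Module ℝ L]
    {M : Type*} [AddCommGroup M] [Module ℝ M] {B : LinearMap.BilinForm ℝ L} {e e' : κ → L}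
    (h : IsDualPair B e e') (T : L →ₗ[ℝ] L →ₗ[ℝ] M) {a b : L →ₗ[ℝ] L}
    (hab : ∀ x y, B (a x) y = B x (b y)) (hinv : ∀ x, a (b x) = x) :
    ∑ l, T (a (e l)) (a (e' l)) = ∑ l, T (e l) (e' l) := by
  have := h.sum_adjoint (T.compl₂ a) hab
  simpa [hinv] using this

namespace FockRelations

variable {B : LinearMap.BilinForm ℝ L} {e e' : κ → L} {ε ι θ : L →ₗ[ℝ] R}

variable (e e' ε ι) in
/-- The insertion operator of a two-form `K` with values in the Lie algebra. -/
def insertOp (K : L →ₗ[ℝ] L →ₗ[ℝ] L) : R :=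
  (1 / 2 : ℝ) • ∑ l, ∑ m, ε (e' l) * ε (e' m) * ι (K (e l) (e m))

theorem insertOp_sub (K K' : L →ₗ[ℝ] L →ₗ[ℝ] L) :
    insertOp e e' ε ι (K - K') = insertOp e e' ε ι K - insertOp e e' ε ι K' := by
  simp [insertOp, mul_sub, Finset.sum_sub_distrib, smul_sub]

/-- Contracting ι_a with either of the two creation operators gives the same term, by skewness of K,
which removes the factor 1/2. In particular the result vanishes when K(a, ·) = 0. -/
theorem annihilate_insertOp (hD : IsDualPair B e e') (h : FockRelations B ε ι θ)
    (K : L →ₗ[ℝ] L →ₗ[ℝ] L) (hK : ∀ x y, K y x = -K x y) (a : L) :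
    ι a * insertOp e e' ε ι K + insertOp e e' ε ι K * ι a = ∑ m, ε (e' m) * ι (K a (e m)) := by
  have key : ∀ l m, ι a * (ε (e' l) * ε (e' m) * ι (K (e l) (e m))) +
      ε (e' l) * ε (e' m) * ι (K (e l) (e m)) * ι a =
      B a (e' l) • (ε (e' m) * ι (K (e l) (e m))) - B a (e' m) • (ε (e' l) * ι (K (e l) (e m))) :=
    fun l m => by
      have h1 := h.create_annihilate (e' l) a
      have h2 := h.create_annihilate (e' m) a
      have h3 := h.annihilate_annihilate (K (e l) (e m)) a
      calc _ = (ε (e' l) * ι a + ι a * ε (e' l)) * (ε (e' m) * ι (K (e l) (e m))) -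
            ε (e' l) * (ε (e' m) * ι a + ι a * ε (e' m)) * ι (K (e l) (e m)) +
            ε (e' l) * ε (e' m) * (ι (K (e l) (e m)) * ι a + ι a * ι (K (e l) (e m))) := by
              noncomm_ring
        _ = _ := by rw [h1, h2, h3, hD.symm a, hD.symm a]; simp
  have h4 : ∀ m, ∑ l, B a (e' l) • (ε (e' m) * ι (K (e l) (e m))) = ε (e' m) * ι (K a (e m)) :=
    fun m => hD.sum_contract' (LinearMap.mulLeft ℝ (ε (e' m)) ∘ₗ ι ∘ₗ K.flip (e m)) a
  have h5 : ∀ l, ∑ m, B a (e' m) • (ε (e' l) * ι (K (e l) (e m))) = -(ε (e' l) * ι (K a (e l))) :=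
    fun l => by
      rw [← mul_neg, ← map_neg, ← hK]
      exact hD.sum_contract' (LinearMap.mulLeft ℝ (ε (e' l)) ∘ₗ ι ∘ₗ K (e l)) a
  rw [insertOp, mul_smul_comm, smul_mul_assoc, ← smul_add, Finset.mul_sum, Finset.sum_mul,
    ← Finset.sum_add_distrib]
  simp_rw [Finset.mul_sum, Finset.sum_mul, ← Finset.sum_add_distrib, key, Finset.sum_sub_distrib,
    h5]
  rw [Finset.sum_comm]
  simp_rw [h4, Finset.sum_neg_distrib, sub_neg_eq_add, ← two_smul ℝ, smul_smul]
  norm_num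

/-- Inserting the Lie bracket is minus the bracket part of the Chevalley–Eilenberg differential.
This is what separates the curvature from the algebraic part of the exterior derivative. -/
theorem insertOp_lie (hD : IsDualPair B e e') (h : FockRelations B ε ι θ)
    (K : L →ₗ[ℝ] L →ₗ[ℝ] L) (hK : ∀ x y, K x y = ⁅x, y⁆) :
    insertOp e e' ε ι K = -((1 / 2 : ℝ) • ∑ l, ε (e' l) * adOp e e' ε ι (e l)) := by
  simp_rw [insertOp, adOp_eq' hD h, hK, mul_neg, Finset.sum_neg_distrib, smul_neg, neg_neg,
    Finset.mul_sum, mul_assoc]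

section Conjugation

variable (hD : IsDualPair B e e') {a b : L →ₗ[ℝ] L} (hab : ∀ x y, B (a x) y = B x (b y))
  (hinv : ∀ x, a (b x) = x) {u : R}
  (hε : ∀ x, u * ε x = ε (a x) * u) (hι : ∀ x, u * ι x = ι (a x) * u)
include hD hab hinv hε hι

theorem conj_adOp (ha : ∀ x y, a ⁅x, y⁆ = ⁅a x, a y⁆) (x : L) :
    u * adOp e e' ε ι x = adOp e e' ε ι (a x) * u := by
  rw [adOp_apply, adOp_apply, Finset.mul_sum]
  simp_rw [← mul_assoc, hε, mul_assoc, hι, ← mul_assoc, ha, ← Finset.sum_mul]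
  congr 1
  exact hD.sum_isometry ((LinearMap.mul ℝ R).compl₁₂ (ε ∘ₗ (LieAlgebra.ad ℝ L (a x))) ι)
    hab hinv

theorem conj_homolOp (hθ : ∀ x, u * θ x = θ (a x) * u) (ha : ∀ x y, a ⁅x, y⁆ = ⁅a x, a y⁆) :
    u * homolOp e e' ε ι θ = homolOp e e' ε ι θ * u := by
  have key : ∀ S : L →ₗ[ℝ] R, (∀ x, u * S x = S (a x) * u) →
      u * ∑ l, S (e' l) * ι (e l) = (∑ l, S (e' l) * ι (e l)) * u := fun S hS => by
    rw [Finset.mul_sum]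
    simp_rw [← mul_assoc, hS, mul_assoc, hι, ← mul_assoc, ← Finset.sum_mul]
    congr 1
    exact hD.sum_isometry ((LinearMap.mul ℝ R).compl₁₂ S ι).flip hab hinv
  rw [homolOp, mul_sub, sub_mul, mul_neg, neg_mul, mul_smul_comm, smul_mul_assoc, key θ hθ,
    key _ (conj_adOp hD hab hinv hε hι ha)]

/-- The isometry is removed from the two summation indices one at a time, since the dual families
enter only through invariant contractions. -/
theorem conj_insertOp (K K' : L →ₗ[ℝ] L →ₗ[ℝ] L) (hK : ∀ x y, a (K x y) = K' (a x) (a y)) :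
    u * insertOp e e' ε ι K = insertOp e e' ε ι K' * u := by
  have h1 : ∀ l m, u * (ε (e' l) * ε (e' m) * ι (K (e l) (e m))) =
      ε (a (e' l)) * ε (a (e' m)) * ι (K' (a (e l)) (a (e m))) * u := fun l m => by
    rw [mul_assoc, ← mul_assoc u, hε, mul_assoc, ← mul_assoc u, hε, mul_assoc, hι, hK]
    noncomm_ring
  have h2 : ∀ l, ∑ m, ε (a (e' l)) * ε (a (e' m)) * ι (K' (a (e l)) (a (e m))) =
      ∑ m, ε (a (e' l)) * ε (e' m) * ι (K' (a (e l)) (e m)) := fun l => by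
    simp_rw [mul_assoc, ← Finset.mul_sum]
    congr 1
    exact hD.sum_isometry ((LinearMap.mul ℝ R).compl₁₂ ε (ι ∘ₗ K' (a (e l)))).flip hab hinv
  have h3 : ∀ m, ∑ l, ε (a (e' l)) * ε (e' m) * ι (K' (a (e l)) (e m)) =
      ∑ l, ε (e' l) * ε (e' m) * ι (K' (e l) (e m)) := fun m => by
    simp_rw [mul_assoc]
    exact hD.sum_isometry ((LinearMap.mul ℝ R).compl₁₂ ε
      (LinearMap.mulLeft ℝ (ε (e' m)) ∘ₗ ι ∘ₗ K'.flip (e m))).flip hab hinv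
  rw [insertOp, insertOp, mul_smul_comm, smul_mul_assoc, Finset.mul_sum]
  simp_rw [Finset.mul_sum, h1, ← Finset.sum_mul]
  simp_rw [h2]
  rw [Finset.sum_comm]
  simp_rw [h3]
  rw [Finset.sum_comm]

end Conjugation

end FockRelations

end FockInvariance

/-! ### The Fock space `V ⊗ Λ L` -/

section FockSpace

/-- Exterior powers above the dimension vanish, so the grading has finitely many nonzero pieces. The
componentwise calculus needs the Fock space to be finite dimensional. -/
instance {L : Type*} [AddCommGroup L] [Module ℝ L] [FiniteDimensional ℝ L] :
    FiniteDimensional ℝ (ExteriorAlgebra ℝ L) := by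
  classical
  have h0 : ∀ i, Module.finrank ℝ L < i → (⋀[ℝ]^i L) = ⊥ := fun i hi => by
    have h1 := exteriorPower.finrank_eq ℝ (M := L) i
    rw [Nat.choose_eq_zero_of_lt hi] at h1
    exact Submodule.finrank_eq_zero.mp h1
  have h2 : ⨆ i, (⋀[ℝ]^i L) = ⊤ :=
    (DirectSum.Decomposition.isInternal (fun i : ℕ => ⋀[ℝ]^i L)).submodule_iSup_eq_top
  have h3 : (⨆ i : Fin (Module.finrank ℝ L + 1), (⋀[ℝ]^(i : ℕ) L)) = ⊤ := by
    rw [eq_top_iff, ← h2]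
    refine iSup_le fun i => ?_
    by_cases hi : Module.finrank ℝ L < i
    · rw [h0 i hi]; exact bot_le
    · exact le_iSup (fun i : Fin (Module.finrank ℝ L + 1) => (⋀[ℝ]^(i : ℕ) L)) ⟨i, by omega⟩
  have h4 : ∀ i : Fin (Module.finrank ℝ L + 1), (⋀[ℝ]^(i : ℕ) L).FG := fun i =>
    Module.Finite.iff_fg.mp inferInstance
  rw [FiniteDimensional, Module.finite_def, ← h3]
  exact Submodule.fg_iSup _ h4

variable (V : Type*) [AddCommGroup V] [Module ℝ V] (L : Type*)

section

variable [AddCommGroup L] [Module ℝ L]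

/-- The Fock space `V ⊗ Λ L`. -/
abbrev FockSpace : Type _ := V ⊗[ℝ] ExteriorAlgebra ℝ L

variable {L}

/-- Exterior multiplication by `x`. -/
def createOp : L →ₗ[ℝ] Module.End ℝ (FockSpace V L) :=
  LinearMap.lTensorHom V ∘ₗ LinearMap.mul ℝ (ExteriorAlgebra ℝ L) ∘ₗ ExteriorAlgebra.ι ℝ

/-- Contraction with the linear form `B x`. -/
def annihilateOp (B : LinearMap.BilinForm ℝ L) : L →ₗ[ℝ] Module.End ℝ (FockSpace V L) :=
  LinearMap.lTensorHom V ∘ₗ CliffordAlgebra.contractLeft ∘ₗ B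

variable {V}

/-- The action of `L` on the factor `V`. -/
def actOp (θ : L →ₗ[ℝ] Module.End ℝ V) : L →ₗ[ℝ] Module.End ℝ (FockSpace V L) :=
  LinearMap.rTensorHom (ExteriorAlgebra ℝ L) ∘ₗ θ

theorem createOp_tmul (x : L) (v : V) (a : ExteriorAlgebra ℝ L) :
    createOp V x (v ⊗ₜ a) = v ⊗ₜ (ExteriorAlgebra.ι ℝ x * a) := rfl

theorem annihilateOp_tmul (B : LinearMap.BilinForm ℝ L) (x : L) (v : V)
    (a : ExteriorAlgebra ℝ L) :
    annihilateOp V B x (v ⊗ₜ a) = v ⊗ₜ CliffordAlgebra.contractLeft (B x) a := rfl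

theorem actOp_tmul (θ : L →ₗ[ℝ] Module.End ℝ V) (x : L) (v : V) (a : ExteriorAlgebra ℝ L) :
    actOp θ x (v ⊗ₜ a) = θ x v ⊗ₜ a := rfl

theorem create_annihilateOp (B : LinearMap.BilinForm ℝ L) (hB : ∀ x y, B x y = B y x) (x y : L) :
    createOp V x * annihilateOp V B y + annihilateOp V B y * createOp V x = B x y • 1 := by
  refine TensorProduct.ext' fun v a => ?_
  simp only [LinearMap.add_apply, Module.End.mul_apply, createOp_tmul, annihilateOp_tmul,
    ExteriorAlgebra.ι, CliffordAlgebra.contractLeft_ι_mul, TensorProduct.tmul_sub,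
    LinearMap.smul_apply, Module.End.one_apply, hB x]
  rw [TensorProduct.tmul_smul]
  abel

theorem annihilate_annihilateOp (B : LinearMap.BilinForm ℝ L) (x y : L) :
    annihilateOp V B x * annihilateOp V B y + annihilateOp V B y * annihilateOp V B x = 0 := by
  refine TensorProduct.ext' fun v a => ?_
  simp only [LinearMap.add_apply, Module.End.mul_apply, annihilateOp_tmul]
  rw [CliffordAlgebra.contractLeft_comm (B x) (B y), TensorProduct.tmul_neg]
  simp

end

variable {V L} [LieRing L] [LieAlgebra ℝ L]

theorem fockRelations (B : LinearMap.BilinForm ℝ L) (hsymm : ∀ x y, B x y = B y x)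
    (hinv : ∀ x y z : L, B ⁅x, y⁆ z = -B y ⁅x, z⁆) (θ : L →ₗ[ℝ] Module.End ℝ V)
    (hθ : ∀ x y : L, θ ⁅x, y⁆ = θ x * θ y - θ y * θ x) :
    FockRelations B (createOp V) (annihilateOp V B) (actOp θ) where
  invariant := hinv
  create_create x y := by
    refine TensorProduct.ext' fun v a => ?_
    simp only [LinearMap.add_apply, Module.End.mul_apply, createOp_tmul, ← mul_assoc,
      ← TensorProduct.tmul_add, ← add_mul, LinearMap.zero_apply]
    rw [ExteriorAlgebra.ι_add_mul_swap, zero_mul, TensorProduct.tmul_zero]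
  annihilate_annihilate := annihilate_annihilateOp B
  create_annihilate := create_annihilateOp B hsymm
  commute_create x y := TensorProduct.ext' fun v a => rfl
  commute_annihilate x y := TensorProduct.ext' fun v a => rfl
  lie_act x y := by
    refine TensorProduct.ext' fun v a => ?_
    simp only [LinearMap.sub_apply, Module.End.mul_apply, actOp_tmul, hθ, TensorProduct.sub_tmul]

end FockSpace

/-! ### Decomposable elements and the antiderivation property of contraction -/

section Wedge

variable {V : Type*} [AddCommGroup V] [Module ℝ V] {L : Type*} [AddCommGroup L] [Module ℝ L]

theorem intPow_neg_one_smul {M : Type*} [AddCommGroup M] [Module ℝ M] (n : ℕ) (x : M) :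
    ((-1 : ℤ) ^ n) • x = ((-1 : ℝ) ^ n) • x := by
  rcases n.even_or_odd with h | h <;> simp [h.neg_one_pow]

/-- The decomposable element `v ⊗ Z_1 ∧ ⋯ ∧ Z_k` of the Fock space. -/
def wedge (k : ℕ) (v : V) (Z : Fin k → L) : FockSpace V L := v ⊗ₜ ExteriorAlgebra.ιMulti ℝ k Z

theorem wedge_succ (k : ℕ) (v : V) (Z : Fin (k + 1) → L) :
    wedge (k + 1) v Z = createOp V (Z 0) (wedge k v (Fin.tail Z)) := by
  rw [wedge, ExteriorAlgebra.ιMulti_succ_apply]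
  rfl

theorem wedge_cons (k : ℕ) (v : V) (x : L) (Z : Fin k → L) :
    wedge (k + 1) v (Fin.cons x Z : Fin (k + 1) → L) = createOp V x (wedge k v Z) := by
  rw [wedge_succ, Fin.cons_zero, Fin.tail_cons]

theorem annihilateOp_wedge_zero (B : LinearMap.BilinForm ℝ L) (x : L) (v : V) (Z : Fin 0 → L) :
    annihilateOp V B x (wedge 0 v Z) = 0 := by
  rw [wedge, ExteriorAlgebra.ιMulti_zero_apply, annihilateOp_tmul,
    CliffordAlgebra.contractLeft_one, TensorProduct.tmul_zero]

theorem annihilateOp_create (B : LinearMap.BilinForm ℝ L) (hB : ∀ x y, B x y = B y x) (x y : L)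
    (w : FockSpace V L) :
    annihilateOp V B y (createOp V x w) = B y x • w - createOp V x (annihilateOp V B y w) := by
  have h := LinearMap.congr_fun (create_annihilateOp (V := V) B hB x y) w
  simp only [LinearMap.add_apply, Module.End.mul_apply, LinearMap.smul_apply,
    Module.End.one_apply] at h
  rw [hB y, ← h]
  abel

theorem Fin.removeNth_succ_eq_cons {α : Type*} (k : ℕ) (i : Fin (k + 1)) (Z : Fin (k + 2) → α) :
    i.succ.removeNth Z = (Fin.cons (Z 0) (i.removeNth (Fin.tail Z)) : Fin (k + 1) → α) := by
  ext j
  refine Fin.cases ?_ (fun j => ?_) j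
  · simp [Fin.removeNth]
  · simp [Fin.removeNth, Fin.tail]

theorem Fin.removeNth_zero_eq_tail {α : Type*} (k : ℕ) (Z : Fin (k + 1) → α) :
    (0 : Fin (k + 1)).removeNth Z = Fin.tail Z := rfl

/-- Contraction is an antiderivation, so this is the Leibniz expansion, by induction on the first
factor. -/
theorem annihilateOp_wedge (B : LinearMap.BilinForm ℝ L) (hB : ∀ x y, B x y = B y x) (x : L)
    (k : ℕ) (v : V) (Z : Fin (k + 1) → L) :
    annihilateOp V B x (wedge (k + 1) v Z) =
      ∑ i : Fin (k + 1), (-1 : ℝ) ^ (i : ℕ) • B x (Z i) • wedge k v (i.removeNth Z) := by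
  induction k with
  | zero =>
    rw [wedge_succ, annihilateOp_create B hB, annihilateOp_wedge_zero]
    simp
  | succ k ih =>
    rw [wedge_succ, annihilateOp_create B hB, ih, Fin.sum_univ_succ (n := k + 1), Fin.removeNth_zero_eq_tail,
      sub_eq_add_neg, map_sum, ← Finset.sum_neg_distrib]
    congr 1
    · simp
    · refine Finset.sum_congr rfl fun i _ => ?_
      rw [Fin.removeNth_succ_eq_cons, wedge_cons, map_smul, map_smul, Fin.val_succ, pow_succ]
      simp [Fin.tail]

/-! ### Evaluation of elements of the Fock space as forms -/

variable (V L) in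
/-- The projection of the Fock space to its component of degree zero. -/
def vacuum : FockSpace V L →ₗ[ℝ] V :=
  (TensorProduct.rid ℝ V).toLinearMap ∘ₗ
    LinearMap.lTensor V (ExteriorAlgebra.algebraMapInv (R := ℝ) (M := L)).toLinearMap

theorem vacuum_create (x : L) (w : FockSpace V L) : vacuum V L (createOp V x w) = 0 := by
  have : vacuum V L ∘ₗ createOp V x = 0 := by
    refine TensorProduct.ext' fun v a => ?_
    simp [vacuum, createOp_tmul, ExteriorAlgebra.algebraMapInv]
  exact LinearMap.congr_fun this w

theorem vacuum_wedge_zero (v : V) (Z : Fin 0 → L) : vacuum V L (wedge 0 v Z) = v := by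
  simp [vacuum, wedge]

/-- Evaluation of an element of the Fock space as a `k`-form, using the bilinear form `B`. -/
def evalForm (B : LinearMap.BilinForm ℝ L) : (k : ℕ) → (Fin k → L) → FockSpace V L →ₗ[ℝ] V
  | 0, _ => vacuum V L
  | k + 1, X => evalForm B k (Fin.tail X) ∘ₗ annihilateOp V B (X 0)

theorem evalForm_succ (B : LinearMap.BilinForm ℝ L) (k : ℕ) (X : Fin (k + 1) → L)
    (w : FockSpace V L) :
    evalForm B (k + 1) X w = evalForm B k (Fin.tail X) (annihilateOp V B (X 0) w) := rfl

/-- Dual to `annihilateOp_wedge`: the arguments are contracted one after another past the created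
factor, each crossing giving a sign. -/
theorem evalForm_create (B : LinearMap.BilinForm ℝ L) (hB : ∀ x y, B x y = B y x) (k : ℕ)
    (X : Fin (k + 1) → L) (z : L) (w : FockSpace V L) :
    evalForm B (k + 1) X (createOp V z w) =
      ∑ i : Fin (k + 1), (-1 : ℝ) ^ (i : ℕ) • B (X i) z • evalForm B k (i.removeNth X) w := by
  induction k generalizing w with
  | zero =>
    rw [evalForm_succ, annihilateOp_create B hB]
    simp [evalForm, vacuum_create]
  | succ k ih =>
    rw [evalForm_succ, annihilateOp_create B hB, map_sub, ih, Fin.sum_univ_succ (n := k + 1),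
      Fin.removeNth_zero_eq_tail, sub_eq_add_neg, ← Finset.sum_neg_distrib]
    congr 1
    · simp
    · refine Finset.sum_congr rfl fun i _ => ?_
      rw [Fin.removeNth_succ_eq_cons, evalForm_succ B k (Fin.cons _ _), Fin.cons_zero,
        Fin.tail_cons, Fin.val_succ, pow_succ]
      simp [Fin.tail]

theorem evalForm_annihilate_self (B : LinearMap.BilinForm ℝ L) (k : ℕ) (X : Fin k → L) (j : Fin k)
    (w : FockSpace V L) : evalForm B k X (annihilateOp V B (X j) w) = 0 := by
  induction k generalizing w with
  | zero => exact j.elim0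
  | succ k ih =>
    have h := fun x y => LinearMap.congr_fun (annihilate_annihilateOp (V := V) B x y) w
    simp only [LinearMap.add_apply, Module.End.mul_apply, LinearMap.zero_apply] at h
    rw [evalForm_succ]
    refine Fin.cases ?_ (fun j => ?_) j
    -- The anticommutator of an annihilation operator with itself is twice its square.
    · have h1 := h (X 0) (X 0)
      rw [← two_smul ℝ, smul_eq_zero] at h1
      rw [h1.resolve_left two_ne_zero, map_zero]
    · rw [eq_neg_of_add_eq_zero_left (h (X 0) (X j.succ)), map_neg]
      have := ih (Fin.tail X) j (annihilateOp V B (X 0) w)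
      rw [Fin.tail] at this
      rw [this, neg_zero]

/-- `evalForm` as an alternating map. -/
def evalAlt (B : LinearMap.BilinForm ℝ L) (k : ℕ) :
    FockSpace V L →ₗ[ℝ] L [⋀^Fin k]→ₗ[ℝ] V where
  toFun w :=
    { toFun := fun X => evalForm B k X w
      map_update_add' := by
        intro inst X i x y
        obtain rfl : inst = instDecidableEqFin k := Subsingleton.elim _ _
        induction k generalizing w with
        | zero => exact i.elim0
        | succ k ih =>
          simp only [evalForm_succ]
          refine Fin.cases ?_ (fun i => ?_) i
          · simp [Fin.tail_update_zero]
          · simp [Fin.tail_update_succ, ih, Function.update_of_ne (Fin.succ_ne_zero i).symm]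
      map_update_smul' := by
        intro inst X i c x
        obtain rfl : inst = instDecidableEqFin k := Subsingleton.elim _ _
        induction k generalizing w with
        | zero => exact i.elim0
        | succ k ih =>
          simp only [evalForm_succ]
          refine Fin.cases ?_ (fun i => ?_) i
          · simp [Fin.tail_update_zero]
          · simp [Fin.tail_update_succ, ih, Function.update_of_ne (Fin.succ_ne_zero i).symm]
      map_eq_zero_of_eq' := by
        intro X i j h hij
        induction k generalizing w with
        | zero => exact i.elim0
        | succ k ih =>
          rw [evalForm_succ]
          induction i using Fin.cases with
          | zero =>
            induction j using Fin.cases with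
            | zero => exact absurd rfl hij
            | succ j => rw [h]; exact evalForm_annihilate_self B k (Fin.tail X) j w
          | succ i =>
            induction j using Fin.cases with
            | zero => rw [← h]; exact evalForm_annihilate_self B k (Fin.tail X) i w
            | succ j => exact ih _ (Fin.tail X) i j h (fun e => hij (by rw [e])) }
  map_add' w w' := by ext X; simp
  map_smul' c w := by ext X; simp

/-- Both sides satisfy the same recursion: `evalForm_create` is the Laplace expansion of the
determinant along its first column. -/
theorem evalForm_wedge (B : LinearMap.BilinForm ℝ L) (hB : ∀ x y, B x y = B y x) (k : ℕ)
    (v : V) (Z X : Fin k → L) :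
    evalForm B k X (wedge k v Z) = Matrix.det (Matrix.of fun i j => B (Z j) (X i)) • v := by
  induction k with
  | zero => simp [evalForm, vacuum_wedge_zero]
  | succ k ih =>
    rw [wedge_succ, evalForm_create B hB, Matrix.det_succ_column_zero, Finset.sum_smul]
    refine Finset.sum_congr rfl fun i _ => ?_
    rw [ih, smul_smul, smul_smul, Matrix.of_apply, hB (Z 0)]
    rfl

end Wedge

/-! ### Forms as elements of the Fock space -/

section Inclusion

variable {V : Type*} [AddCommGroup V] [Module ℝ V] {L : Type*} [AddCommGroup L] [Module ℝ L]
  {P : Type*} [AddCommGroup P] [Module ℝ P]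

/-- The map from `V ⊗ Λ^k P` to the Fock space induced by a linear map `P → L`. -/
def fockIncl (f : P →ₗ[ℝ] L) (k : ℕ) : V ⊗[ℝ] (⋀[ℝ]^k P) →ₗ[ℝ] FockSpace V L :=
  LinearMap.lTensor V ((⋀[ℝ]^k L).subtype ∘ₗ exteriorPower.map k f)

theorem fockIncl_tmul (f : P →ₗ[ℝ] L) (k : ℕ) (v : V) (Z : Fin k → P) :
    fockIncl f k (v ⊗ₜ exteriorPower.ιMulti ℝ k Z) = wedge k v (fun i => f (Z i)) := by
  simp [fockIncl, wedge, Function.comp_def]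

theorem fockIncl_injective {f : P →ₗ[ℝ] L} (hf : Function.Injective f) (k : ℕ) :
    Function.Injective (fockIncl (V := V) f k) := by
  refine Module.Flat.lTensor_preserves_injective_linearMap _ ?_
  rw [LinearMap.coe_comp]
  exact (Submodule.subtype_injective _).comp (exteriorPower.map_injective_field hf)

/-- No closure under scalars is required because scalars are absorbed into the factor v. -/
theorem forms_induction {k : ℕ} {p : V ⊗[ℝ] (⋀[ℝ]^k P) → Prop}
    (tmul : ∀ (v : V) (Z : Fin k → P), p (v ⊗ₜ exteriorPower.ιMulti ℝ k Z))
    (add : ∀ x y, p x → p y → p (x + y)) (w : V ⊗[ℝ] (⋀[ℝ]^k P)) : p w := by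
  have zero : p 0 := by simpa using tmul 0 0
  have key : ∀ (a : ⋀[ℝ]^k P) (v : V), p (v ⊗ₜ a) := by
    intro a
    have ha : a ∈ Submodule.span ℝ (Set.range (exteriorPower.ιMulti ℝ k (M := P))) := by
      rw [exteriorPower.ιMulti_span]; trivial
    induction ha using Submodule.span_induction with
    | mem x hx => obtain ⟨Z, rfl⟩ := hx; exact fun v => tmul v Z
    | zero => intro v; simpa using zero
    | add x y _ _ hx hy => intro v; rw [TensorProduct.tmul_add]; exact add _ _ (hx v) (hy v)
    | smul c x _ hx => intro v; rw [TensorProduct.tmul_smul, TensorProduct.smul_tmul']; exact hx _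
  induction w using TensorProduct.induction_on with
  | zero => exact zero
  | tmul v a => exact key a v
  | add x y hx hy => exact add x y hx hy

theorem createOp_fockIncl_mem (f : P →ₗ[ℝ] L) (k : ℕ) (z : P) (w : V ⊗[ℝ] (⋀[ℝ]^k P)) :
    createOp V (f z) (fockIncl f k w) ∈ LinearMap.range (fockIncl (V := V) f (k + 1)) := by
  induction w using forms_induction with
  | tmul v Z =>
    refine ⟨v ⊗ₜ exteriorPower.ιMulti ℝ (k + 1) (Fin.cons z Z), ?_⟩
    rw [fockIncl_tmul, fockIncl_tmul, wedge_succ]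
    rfl
  | add x y hx hy => rw [map_add, map_add]; exact add_mem hx hy

theorem annihilateOp_fockIncl_zero (B : LinearMap.BilinForm ℝ L) (x : L) (f : P →ₗ[ℝ] L)
    (w : V ⊗[ℝ] (⋀[ℝ]^0 P)) : annihilateOp V B x (fockIncl f 0 w) = 0 := by
  induction w using forms_induction with
  | tmul v Z => rw [fockIncl_tmul, annihilateOp_wedge_zero]
  | add x y hx hy => rw [map_add, map_add, hx, hy, add_zero]

theorem annihilateOp_fockIncl_mem (B : LinearMap.BilinForm ℝ L) (hB : ∀ x y, B x y = B y x) (x : L)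
    (f : P →ₗ[ℝ] L) (k : ℕ) (w : V ⊗[ℝ] (⋀[ℝ]^(k + 1) P)) :
    annihilateOp V B x (fockIncl f (k + 1) w) ∈ LinearMap.range (fockIncl (V := V) f k) := by
  induction w using forms_induction with
  | tmul v Z =>
    rw [fockIncl_tmul, annihilateOp_wedge B hB]
    refine Submodule.sum_mem _ fun i _ => Submodule.smul_mem _ _ (Submodule.smul_mem _ _ ?_)
    exact ⟨v ⊗ₜ exteriorPower.ιMulti ℝ k (i.removeNth Z), fockIncl_tmul _ _ _ _⟩
  | add x y hx hy => rw [map_add, map_add]; exact add_mem hx hy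

/-- The number operator acts on forms of degree `k` by `k`. -/
theorem numberOp_fockIncl {κ : Type*} [Fintype κ] {B : LinearMap.BilinForm ℝ L} {e e' : κ → L}
    (hD : IsDualPair B e e') (f : P →ₗ[ℝ] L) (k : ℕ) (w : V ⊗[ℝ] (⋀[ℝ]^k P)) :
    ∑ l, createOp V (e' l) (annihilateOp V B (e l) (fockIncl f k w)) =
      (k : ℝ) • fockIncl f k w := by
  have key : ∀ (k : ℕ) (v : V) (Z : Fin k → L),
      ∑ l, createOp V (e' l) (annihilateOp V B (e l) (wedge k v Z)) = (k : ℝ) • wedge k v Z := by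
    intro k v
    induction k with
    | zero => intro Z; simp [annihilateOp_wedge_zero]
    | succ k ih =>
      intro Z
      -- Pulling the first factor to the front makes the contraction with it contribute exactly one
      -- to the count.
      have h1 : ∀ x w, createOp V x (createOp V (Z 0) w) =
          -createOp V (Z 0) (createOp V x w) := fun x w => by
        have : createOp V x * createOp V (Z 0) + createOp V (Z 0) * createOp V x = 0 := by
          refine TensorProduct.ext' fun v a => ?_
          simp only [LinearMap.add_apply, Module.End.mul_apply, createOp_tmul, ← mul_assoc,
            ← TensorProduct.tmul_add, ← add_mul, LinearMap.zero_apply]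
          rw [ExteriorAlgebra.ι_add_mul_swap, zero_mul, TensorProduct.tmul_zero]
        exact eq_neg_of_add_eq_zero_left (LinearMap.congr_fun this w)
      have h2 := ih (Fin.tail Z)
      have h3 := hD.sum_contract ((createOp V).flip (wedge k v (Fin.tail Z))) (Z 0)
      simp only [LinearMap.flip_apply] at h3
      rw [wedge_succ]
      simp_rw [annihilateOp_create B hD.symm, map_sub, h1, map_smul, hD.symm _ (Z 0)]
      rw [Finset.sum_sub_distrib, h3, Finset.sum_neg_distrib, ← map_sum, h2, map_smul]
      push_cast
      module
  induction w using forms_induction with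
  | tmul v Z => rw [fockIncl_tmul, key]
  | add x y hx hy =>
    simp only [map_add, Finset.sum_add_distrib, smul_add] at *
    rw [hx, hy]

end Inclusion

/-! ### Comparison with the homology differential -/

section Codifferential

variable {V : Type*} [AddCommGroup V] [Module ℝ V] {L : Type*} [LieRing L] [LieAlgebra ℝ L]
  {P : Type*} [AddCommGroup P] [Module ℝ P] {κ : Type*} [Fintype κ]

open FockRelations

theorem homolOp_wedge_zero (B : LinearMap.BilinForm ℝ L) (e e' : κ → L)
    (θ : L →ₗ[ℝ] Module.End ℝ V) (v : V) (Z : Fin 0 → L) :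
    homolOp e e' (createOp V) (annihilateOp V B) (actOp θ) (wedge 0 v Z) = 0 := by
  simp [homolOp, LinearMap.sum_apply, annihilateOp_wedge_zero]

/-- Contracting the basis with the i-th factor puts that factor into S. With S the action on V or
the adjoint derivation this describes both halves of `homolOp`. -/
theorem sum_annihilateOp_wedge {B : LinearMap.BilinForm ℝ L} {e e' : κ → L}
    (hD : IsDualPair B e e') {M : Type*} [AddCommGroup M] [Module ℝ M]
    (S : L →ₗ[ℝ] FockSpace V L →ₗ[ℝ] M) (k : ℕ) (v : V) (Z : Fin (k + 1) → L) :
    ∑ l, S (e' l) (annihilateOp V B (e l) (wedge (k + 1) v Z)) =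
      ∑ i : Fin (k + 1), (-1 : ℝ) ^ (i : ℕ) • S (Z i) (wedge k v (i.removeNth Z)) := by
  simp_rw [annihilateOp_wedge B hD.symm, map_sum, map_smul]
  rw [Finset.sum_comm]
  refine Finset.sum_congr rfl fun i _ => ?_
  rw [← Finset.smul_sum]
  congr 1
  have := hD.sum_contract (S.flip (wedge k v (i.removeNth Z))) (Z i)
  simp_rw [hD.symm _ (Z i)]
  exact this

theorem homologyDiff_apply (β : P →ₗ[ℝ] P →ₗ[ℝ] P) (τ : P →ₗ[ℝ] Module.End ℝ V) (k : ℕ)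
    (v : V) (Z : Fin (k + 1) → P) :
    homologyDiff β τ k (v ⊗ₜ exteriorPower.ιMulti ℝ (k + 1) Z) = homologyAlt β τ k Z v := by
  simp [homologyDiff]

/-- The Lie algebra homology differential is induced by `homolOp`. -/
theorem homolOp_fockIncl {B : LinearMap.BilinForm ℝ L} {e e' : κ → L} (hD : IsDualPair B e e')
    (θ : L →ₗ[ℝ] Module.End ℝ V)
    (hF : FockRelations B (createOp V) (annihilateOp V B) (actOp θ)) (f : P →ₗ[ℝ] L)
    (β : P →ₗ[ℝ] P →ₗ[ℝ] P) (hβ : ∀ x y, f (β x y) = ⁅f x, f y⁆) (k : ℕ)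
    (w : V ⊗[ℝ] (⋀[ℝ]^(k + 1) P)) :
    homolOp e e' (createOp V) (annihilateOp V B) (actOp θ) (fockIncl f (k + 1) w) =
      fockIncl f k (homologyDiff β (θ ∘ₗ f) k w) := by
  induction w using forms_induction with
  | add x y hx hy => simp only [map_add, hx, hy]
  | tmul v Z =>
    have h1 : fockIncl f k (AlternatingMap.alternatizeUncurryFin (actTerm (θ ∘ₗ f) k) Z v) =
        ∑ l, actOp θ (e' l) (annihilateOp V B (e l) (wedge (k + 1) v (fun i => f (Z i)))) := by
      rw [sum_annihilateOp_wedge hD (actOp θ), AlternatingMap.alternatizeUncurryFin_apply,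
        LinearMap.sum_apply, map_sum]
      refine Finset.sum_congr rfl fun i _ => ?_
      rw [intPow_neg_one_smul, LinearMap.smul_apply, map_smul]
      congr 1
      exact fockIncl_tmul _ _ _ _
    rw [homologyDiff_apply, fockIncl_tmul]
    cases k with
    | zero =>
      -- In degree one the contraction lands in degree zero, where the adjoint derivation is zero,
      -- matching the missing bracket term in `homologyAlt`.
      have h2 : ∀ l, adOp e e' (createOp V) (annihilateOp V B) (e' l)
          (annihilateOp V B (e l) (wedge 1 v (fun i => f (Z i)))) = 0 := fun l => by
        rw [annihilateOp_wedge B hD.symm]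
        simp [adOp_apply, LinearMap.sum_apply, annihilateOp_wedge_zero]
      rw [homologyAlt, AlternatingMap.neg_apply, LinearMap.neg_apply, map_neg, h1]
      simp [homolOp, LinearMap.sum_apply, h2]
    | succ k =>
      -- The derivation contracts a second time, so two applications of `sum_annihilateOp_wedge`
      -- reproduce the nested alternation; the factors 1/2 on both sides agree.
      have h3 : fockIncl f (k + 1) (AlternatingMap.alternatizeUncurryFin
          (AlternatingMap.alternatizeUncurryFinLM ∘ₗ bracketTerm V β k) Z v) =
          ∑ l, adOp e e' (createOp V) (annihilateOp V B) (e' l)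
            (annihilateOp V B (e l) (wedge (k + 2) v (fun i => f (Z i)))) := by
        rw [sum_annihilateOp_wedge hD (adOp e e' (createOp V) (annihilateOp V B)),
          AlternatingMap.alternatizeUncurryFin_apply, LinearMap.sum_apply, map_sum]
        refine Finset.sum_congr rfl fun i _ => ?_
        rw [intPow_neg_one_smul, LinearMap.smul_apply, map_smul]
        congr 1
        rw [adOp_eq_symm hD hF]
        have h4 := sum_annihilateOp_wedge hD
          (createOp V ∘ₗ LieAlgebra.ad ℝ L (f (Z i))) k v (i.removeNth fun i => f (Z i))
        simp only [LinearMap.comp_apply, LieAlgebra.ad_apply] at h4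
        simp only [LinearMap.sum_apply, Module.End.mul_apply]
        rw [h4, LinearMap.comp_apply, AlternatingMap.alternatizeUncurryFinLM_apply,
          AlternatingMap.alternatizeUncurryFin_apply, LinearMap.sum_apply, map_sum]
        refine Finset.sum_congr rfl fun j _ => ?_
        rw [intPow_neg_one_smul, LinearMap.smul_apply, map_smul]
        congr 1
        refine (fockIncl_tmul f _ v _).trans ?_
        rw [wedge_succ]
        congr 1
        change createOp V (f (β (Z i) _)) = _
        rw [hβ]
        rfl
      rw [homologyAlt, AlternatingMap.sub_apply, LinearMap.sub_apply, map_sub,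
        AlternatingMap.neg_apply, LinearMap.neg_apply, map_neg, h1, AlternatingMap.smul_apply,
        LinearMap.smul_apply, map_smul, h3]
      simp [homolOp, LinearMap.sum_apply]

end Codifferential

/-! ### Projections of the grading and duality under the Killing form -/

section GradingProjections

variable {L : Type*} [LieRing L] [LieAlgebra ℝ L] [FiniteDimensional ℝ L]

namespace Grading

variable (Γ : Grading L)

theorem bijective_coeLinearMap : Function.Bijective (DirectSum.coeLinearMap Γ.gr) := Γ.isInternal

/-- The projection of `L` to `L_i`. -/
def proj (i : ℤ) : L →ₗ[ℝ] L :=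
  (Γ.gr i).subtype ∘ₗ DirectSum.component ℝ ℤ (fun i => Γ.gr i) i ∘ₗ
    (LinearEquiv.ofBijective (DirectSum.coeLinearMap Γ.gr) Γ.bijective_coeLinearMap).symm.toLinearMap

theorem proj_mem (i : ℤ) (x : L) : Γ.proj i x ∈ Γ.gr i := Subtype.coe_prop _

theorem proj_of_mem {i j : ℤ} {x : L} (hx : x ∈ Γ.gr j) :
    Γ.proj i x = if j = i then x else 0 := by
  have h : (LinearEquiv.ofBijective (DirectSum.coeLinearMap Γ.gr) Γ.bijective_coeLinearMap).symm x =
      DirectSum.lof ℝ ℤ (fun i => Γ.gr i) j ⟨x, hx⟩ := by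
    rw [LinearEquiv.symm_apply_eq]
    exact (DirectSum.coeLinearMap_lof Γ.gr j ⟨x, hx⟩).symm
  simp only [proj, LinearMap.comp_apply, LinearEquiv.coe_coe, h, Submodule.subtype_apply]
  split_ifs with hij
  · subst hij
    rw [DirectSum.component.lof_self]
  · rw [DirectSum.component.of, dif_neg hij, ZeroMemClass.coe_zero]

theorem proj_proj (i : ℤ) (x : L) : Γ.proj i (Γ.proj i x) = Γ.proj i x := by
  rw [Γ.proj_of_mem (Γ.proj_mem i x), if_pos rfl]

theorem homogeneous_induction {p : L → Prop} (gr : ∀ i, ∀ x ∈ Γ.gr i, p x)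
    (add : ∀ x y, p x → p y → p (x + y)) (x : L) : p x :=
  Submodule.iSup_induction Γ.gr (motive := p)
    (by rw [Γ.isInternal.submodule_iSup_eq_top]; trivial) gr (gr 0 0 (zero_mem _)) add

theorem fil_induction {p : L → Prop} {i : ℤ} (gr : ∀ j, i ≤ j → ∀ x ∈ Γ.gr j, p x)
    (add : ∀ x y, p x → p y → p (x + y)) {x : L} (hx : x ∈ Γ.fil i) : p x :=
  Submodule.iSup_induction (fun j : {j : ℤ // i ≤ j} => Γ.gr j) (motive := p) hx
    (fun j x hx => gr j j.2 x hx) (gr i le_rfl 0 (zero_mem _)) add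

theorem eq_zero_of_depth_lt {i : ℤ} (hi : (Γ.depth : ℤ) < |i|) {x : L} (hx : x ∈ Γ.gr i) :
    x = 0 := by
  rw [Γ.bounded i hi] at hx
  simpa using hx

theorem sum_proj (x : L) : ∑ i ∈ Finset.Icc (-(Γ.depth : ℤ)) Γ.depth, Γ.proj i x = x := by
  induction x using Γ.homogeneous_induction with
  | add x y hx hy => simp only [map_add, Finset.sum_add_distrib, hx, hy]
  | gr i x hx =>
    simp_rw [Γ.proj_of_mem hx]
    rw [Finset.sum_ite_eq]
    split_ifs with h
    · rfl
    · refine (Γ.eq_zero_of_depth_lt ?_ hx).symm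
      by_contra h'
      rw [not_lt, abs_le] at h'
      exact h (Finset.mem_Icc.mpr h')

/-- The projection of `L` to `L_{-depth} ⊕ ⋯ ⊕ L_{-1}` with kernel `𝔭`. -/
def negProj : L →ₗ[ℝ] L := ∑ i ∈ Finset.Icc 1 (Γ.depth : ℤ), Γ.proj (-i)

/-- The projection of `L` to `𝔭₊`. -/
def posProj : L →ₗ[ℝ] L := ∑ i ∈ Finset.Icc 1 (Γ.depth : ℤ), Γ.proj i

theorem posProj_mem (x : L) : Γ.posProj x ∈ Γ.fil 1 := by
  rw [posProj, LinearMap.sum_apply]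
  exact Submodule.sum_mem _ fun i hi =>
    Γ.gr_le_fil (Finset.mem_Icc.mp hi).1 (Γ.proj_mem i x)

theorem sub_negProj_mem (x : L) : x - Γ.negProj x ∈ Γ.fil 0 := by
  induction x using Γ.homogeneous_induction with
  | add x y hx hy =>
    rw [map_add, add_sub_add_comm]
    exact add_mem hx hy
  | gr j x hx =>
    rw [negProj, LinearMap.sum_apply]
    simp_rw [Γ.proj_of_mem hx]
    rcases le_or_gt 0 j with hj | hj
    · rw [Finset.sum_eq_zero, sub_zero]
      · exact Γ.gr_le_fil hj hx
      · intro i hi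
        have := (Finset.mem_Icc.mp hi).1
        rw [if_neg (by omega)]
    · by_cases hd : (Γ.depth : ℤ) < |j|
      · rw [Γ.eq_zero_of_depth_lt hd hx]
        simp
      · rw [Finset.sum_eq_single (-j), neg_neg, if_pos rfl, sub_self]
        · exact zero_mem _
        · intro i _ hi
          rw [if_neg (by omega)]
        · intro h
          rw [abs_of_neg hj] at hd
          exact absurd (Finset.mem_Icc.mpr ⟨by omega, by omega⟩) h

end Grading

variable [LieAlgebra.IsSemisimple ℝ L]

theorem killingForm_comm (x y : L) : killingForm ℝ L x y = killingForm ℝ L y x :=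
  LieModule.traceForm_comm ℝ L L x y

theorem killingForm_lie (x y z : L) : killingForm ℝ L ⁅x, y⁆ z = -killingForm ℝ L y ⁅x, z⁆ := by
  rw [← lie_skew, map_neg, LinearMap.neg_apply, killingForm,
    LieModule.traceForm_apply_lie_apply]

variable (L) in
/-- A basis of `L`. -/
abbrev basis : Fin (Module.finrank ℝ L) → L := Module.finBasis ℝ L

variable (L) in
/-- The dual basis with respect to the Killing form. -/
abbrev cobasis : Fin (Module.finrank ℝ L) → L :=
  LinearMap.BilinForm.dualBasis (killingForm ℝ L)
      (LieAlgebra.IsKilling.killingForm_nondegenerate ℝ L) (Module.finBasis ℝ L)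

/-- The coefficients of x in the basis are its pairings with the dual basis, and conversely;
nondegeneracy comes from semisimplicity. -/
theorem isDualPair_killingForm : IsDualPair (killingForm ℝ L) (basis L) (cobasis L) where
  symm := killingForm_comm
  expand x := by
    have hs : (killingForm ℝ L).IsSymm := ⟨fun x y => by simpa using killingForm_comm x y⟩
    have h : ∀ l, killingForm ℝ L x (cobasis L l) = (Module.finBasis ℝ L).repr x l := fun l => by
      refine (congrArg (fun z => killingForm ℝ L z (cobasis L l))
        ((Module.finBasis ℝ L).sum_repr x).symm).trans ?_
      simp only [map_sum, LinearMap.sum_apply, map_smul, LinearMap.smul_apply,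
        LinearMap.BilinForm.apply_dualBasis_right _ hs]
      simp
    simp_rw [h]
    exact (Module.finBasis ℝ L).sum_repr x
  expand' x := by
    have := (LinearMap.BilinForm.dualBasis (killingForm ℝ L)
      (LieAlgebra.IsKilling.killingForm_nondegenerate ℝ L) (Module.finBasis ℝ L)).sum_repr x
    simpa only [LinearMap.BilinForm.dualBasis_repr_apply] using this

theorem killingTrace_eq {V : Type*} [AddCommGroup V] [Module ℝ V] (T : L →ₗ[ℝ] L →ₗ[ℝ] V) :
    killingTrace T = ∑ l, T (basis L l) (cobasis L l) := rfl

namespace Grading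

variable (Γ : Grading L)

theorem isGradingElement_gradingElement : Γ.IsGradingElement Γ.gradingElement :=
  Γ.existsUnique_gradingElement.choose_spec.1

/-- Invariance under the grading element gives (i + j) B(x, y) = 0. -/
theorem killingForm_gr {i j : ℤ} (hij : i + j ≠ 0) {x y : L} (hx : x ∈ Γ.gr i) (hy : y ∈ Γ.gr j) :
    killingForm ℝ L x y = 0 := by
  have h := killingForm_lie Γ.gradingElement x y
  rw [Γ.isGradingElement_gradingElement i x hx, Γ.isGradingElement_gradingElement j y hy,
    map_smul, map_smul, LinearMap.smul_apply, smul_eq_mul, smul_eq_mul] at h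
  have h2 : ((i + j : ℤ) : ℝ) * killingForm ℝ L x y = 0 := by push_cast; linarith
  exact (mul_eq_zero.mp h2).resolve_left (by exact_mod_cast hij)

theorem killingForm_fil {i j : ℤ} (hij : 0 < i + j) {x y : L} (hx : x ∈ Γ.fil i)
    (hy : y ∈ Γ.fil j) : killingForm ℝ L x y = 0 := by
  refine Γ.fil_induction (p := fun x => killingForm ℝ L x y = 0) (fun a ha x hx => ?_)
    (fun x y hx hy => by rw [map_add, LinearMap.add_apply, hx, hy, add_zero]) hx
  exact Γ.fil_induction (p := fun y => killingForm ℝ L x y = 0)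
    (fun b hb y hy => Γ.killingForm_gr (by omega) hx hy)
    (fun x y hx hy => by rw [map_add, hx, hy, add_zero]) hy

theorem killingForm_proj (i : ℤ) (x y : L) :
    killingForm ℝ L (Γ.proj i x) y = killingForm ℝ L x (Γ.proj (-i) y) := by
  induction x using Γ.homogeneous_induction with
  | add x y hx hy => simp only [map_add, LinearMap.add_apply, hx, hy]
  | gr a x hx =>
    induction y using Γ.homogeneous_induction with
    | add x y hx hy => simp only [map_add, hx, hy]
    | gr b y hy =>
      rw [Γ.proj_of_mem hx, Γ.proj_of_mem hy]
      by_cases hab : a + b = 0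
      · obtain rfl : b = -a := by omega
        by_cases hi : a = i
        · simp [hi]
        · simp [hi]
      · have := Γ.killingForm_gr hab hx hy
        split_ifs <;> simp [this]

/-- This adjointness expresses that 𝔭₊ is the dual of 𝔤/𝔭, in a form suited to `sum_adjoint`. -/
theorem killingForm_negProj (x y : L) :
    killingForm ℝ L (Γ.negProj x) y = killingForm ℝ L x (Γ.posProj y) := by
  simp only [negProj, posProj, LinearMap.sum_apply, map_sum]
  exact Finset.sum_congr rfl fun i _ => by rw [Γ.killingForm_proj, neg_neg]

/-- In each degree the projection is idempotent and adjoint to the opposite one, so both entries can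
be projected; the brackets then lie in [𝔤_i, 𝔤_{-i}] ⊆ 𝔤_0. -/
theorem sum_lie_negProj_mem :
    ∑ l, ⁅basis L l, Γ.negProj (cobasis L l)⁆ ∈ Γ.fil 0 := by
  simp only [negProj, LinearMap.sum_apply, lie_sum]
  rw [Finset.sum_comm]
  refine Submodule.sum_mem _ fun i _ => ?_
  have h := isDualPair_killingForm.sum_adjoint (L := L)
    ((LieModule.toEnd ℝ L L : L →ₗ[ℝ] L →ₗ[ℝ] L).compl₂ (Γ.proj (-i)))
    (f := Γ.proj i) (g := Γ.proj (-i)) (Γ.killingForm_proj i)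
  simp only [LinearMap.compl₂_apply, LieHom.coe_toLinearMap, LieModule.toEnd_apply_apply,
    Γ.proj_proj] at h
  rw [← h]
  refine Submodule.sum_mem _ fun l _ => Γ.gr_le_fil le_rfl ?_
  have := Γ.lie_mem i (-i) _ _ (Γ.proj_mem i (basis L l)) (Γ.proj_mem (-i) (cobasis L l))
  rwa [add_neg_cancel] at this

end Grading

/-! ### Horizontal forms in the Fock space -/

variable {V : Type*} [AddCommGroup V] [Module ℝ V] (Γ : Grading L)

/-- The inclusion of `𝔭₊` into `L`. -/
abbrev pIncl : Γ.pPlus →ₗ[ℝ] L := Γ.pPlus.toSubmodule.subtype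

variable (V) in
/-- Contraction via the Killing form. -/
abbrev annihilate : L →ₗ[ℝ] Module.End ℝ (FockSpace V L) := annihilateOp V (killingForm ℝ L)

variable (V) in
/-- The inclusion of `Λ^k 𝔭₊ ⊗ V` into the Fock space. -/
abbrev formIncl (k : ℕ) : V ⊗[ℝ] (⋀[ℝ]^k Γ.pPlus) →ₗ[ℝ] FockSpace V L := fockIncl (pIncl Γ) k

theorem formIncl_injective (k : ℕ) : Function.Injective (formIncl V Γ k) :=
  fockIncl_injective Subtype.val_injective k

/-- Replaces the determinant description of a form by iterated contractions, for which the operator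
identities are available. -/
theorem toForm_eq_evalForm (k : ℕ) (w : V ⊗[ℝ] (⋀[ℝ]^k Γ.pPlus)) (X : Fin k → L) :
    toForm Γ k w X = evalForm (killingForm ℝ L) k X (formIncl V Γ k w) := by
  induction w using forms_induction with
  | tmul v Z =>
    rw [toForm_tmul, fockIncl_tmul, evalForm_wedge _ killingForm_comm]
    rfl
  | add x y hx hy =>
    rw [map_add, map_add, ← hx, ← hy, toForm, toForm, toForm, map_add]

variable {Γ} in
-- 𝔭 is orthogonal to 𝔭₊ for the Killing form.
theorem annihilate_formIncl_of_mem (k : ℕ) (w : V ⊗[ℝ] (⋀[ℝ]^k Γ.pPlus)) {a : L}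
    (ha : a ∈ Γ.fil 0) : annihilate V a (formIncl V Γ k w) = 0 := by
  induction w using forms_induction with
  | tmul v Z =>
    cases k with
    | zero => exact annihilateOp_fockIncl_zero _ _ _ _
    | succ k =>
      rw [fockIncl_tmul, annihilateOp_wedge _ killingForm_comm]
      refine Finset.sum_eq_zero fun i _ => ?_
      have h0 : killingForm ℝ L a (pIncl Γ (Z i)) = 0 :=
        Γ.killingForm_fil (by norm_num) ha (Z i).2
      rw [h0, zero_smul, smul_zero]
  | add x y hx hy => rw [map_add, map_add, hx, hy, add_zero]

theorem fockIncl_id_zero (w : V ⊗[ℝ] (⋀[ℝ]^0 L)) :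
    fockIncl (LinearMap.id : L →ₗ[ℝ] L) 0 w =
      vacuum V L (fockIncl LinearMap.id 0 w) ⊗ₜ ExteriorAlgebra.ιMulti ℝ 0 (0 : Fin 0 → L) := by
  induction w using forms_induction with
  | tmul v Z =>
    rw [fockIncl_tmul, vacuum_wedge_zero, wedge, Subsingleton.elim (0 : Fin 0 → L)]
  | add x y hx hy => rw [map_add, map_add, TensorProduct.add_tmul, ← hx, ← hy]

theorem formIncl_mem (k : ℕ) (w : V ⊗[ℝ] (⋀[ℝ]^k Γ.pPlus)) :
    formIncl V Γ k w ∈ LinearMap.range (fockIncl (V := V) (LinearMap.id : L →ₗ[ℝ] L) k) := by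
  induction w using forms_induction with
  | tmul v Z =>
    exact ⟨v ⊗ₜ exteriorPower.ιMulti ℝ k (fun i => (Z i : L)), by
      rw [fockIncl_tmul, fockIncl_tmul]; rfl⟩
  | add x y hx hy => rw [map_add]; exact add_mem hx hy

/-- A form of degree `k` on `L` which vanishes upon insertion of elements of `𝔭` is in
`Λ^k 𝔭₊ ⊗ V`. -/
theorem mem_range_formIncl {k : ℕ} {w : FockSpace V L}
    (hw : w ∈ LinearMap.range (fockIncl (V := V) (LinearMap.id : L →ₗ[ℝ] L) k))
    (h : ∀ a ∈ Γ.fil 0, annihilate V a w = 0) : w ∈ LinearMap.range (formIncl V Γ k) := by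
  induction k generalizing w with
  | zero =>
    obtain ⟨w, rfl⟩ := hw
    rw [fockIncl_id_zero]
    refine ⟨vacuum V L (fockIncl LinearMap.id 0 w) ⊗ₜ exteriorPower.ιMulti ℝ 0 0, ?_⟩
    rw [fockIncl_tmul, wedge]
    congr 2
  | succ k ih =>
    have h1 : ∀ x, annihilate V x w ∈ LinearMap.range (formIncl V Γ k) := fun x => by
      refine ih ?_ fun a ha => ?_
      · obtain ⟨w, rfl⟩ := hw
        exact annihilateOp_fockIncl_mem _ killingForm_comm x _ k w
      · have := LinearMap.congr_fun (annihilate_annihilateOp (V := V) (killingForm ℝ L) a x) w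
        simpa [h a ha] using this
    -- The number operator reconstructs w from its contractions, which are horizontal by induction.
    have h2 : ∑ l, createOp V (cobasis L l) (annihilate V (basis L l) w) =
        ((k + 1 : ℕ) : ℝ) • w := by
      obtain ⟨w, rfl⟩ := hw
      exact numberOp_fockIncl isDualPair_killingForm _ (k + 1) w
    have h3 : ∀ x, annihilate V x w = annihilate V (Γ.negProj x) w := fun x => by
      have := h _ (Γ.sub_negProj_mem x)
      rwa [map_sub, LinearMap.sub_apply, sub_eq_zero] at this
    -- Only the negative part of ξ_l contributes to the contraction; by adjointness only the part of
    -- ξ^l in 𝔭₊ contributes to the creation, so w is built from elements of 𝔭₊.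
    have h4 := isDualPair_killingForm.sum_adjoint (L := L)
      (((createOp V).compl₂ ((annihilate V).flip w)).flip)
      (f := Γ.negProj) (g := Γ.posProj) Γ.killingForm_negProj
    simp only [LinearMap.flip_apply, LinearMap.compl₂_apply] at h4
    simp_rw [h3 (basis L _)] at h2
    rw [h4] at h2
    have h5 : w = ((k + 1 : ℕ) : ℝ)⁻¹ •
        ∑ l, createOp V (Γ.posProj (cobasis L l)) (annihilate V (basis L l) w) := by
      rw [h2, smul_smul, inv_mul_cancel₀ (by positivity), one_smul]
    rw [h5]
    refine Submodule.smul_mem _ _ (Submodule.sum_mem _ fun l _ => ?_)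
    obtain ⟨w', hw'⟩ := h1 (basis L l)
    rw [← hw']
    exact createOp_fockIncl_mem (pIncl Γ) k ⟨_, Γ.posProj_mem (cobasis L l)⟩ w'

/-- An element of degree `k` is determined by its evaluations. -/
theorem eq_zero_of_evalForm {k : ℕ} {w : FockSpace V L}
    (hw : w ∈ LinearMap.range (fockIncl (V := V) (LinearMap.id : L →ₗ[ℝ] L) k))
    (h : ∀ X, evalForm (killingForm ℝ L) k X w = 0) : w = 0 := by
  induction k generalizing w with
  | zero =>
    obtain ⟨w, rfl⟩ := hw
    rw [fockIncl_id_zero]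
    have h0 : vacuum V L (fockIncl LinearMap.id 0 w) = 0 := h 0
    rw [h0, TensorProduct.zero_tmul]
  | succ k ih =>
    have h1 : ∀ x, annihilate V x w = 0 := fun x => by
      refine ih ?_ fun X => ?_
      · obtain ⟨w, rfl⟩ := hw
        exact annihilateOp_fockIncl_mem _ killingForm_comm x _ k w
      · have := h (Fin.cons x X)
        rwa [evalForm_succ, Fin.cons_zero, Fin.tail_cons] at this
    have h2 : ∑ l, createOp V (cobasis L l) (annihilate V (basis L l) w) =
        ((k + 1 : ℕ) : ℝ) • w := by
      obtain ⟨w, rfl⟩ := hw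
      exact numberOp_fockIncl isDualPair_killingForm _ (k + 1) w
    simp only [h1, map_zero, Finset.sum_const_zero] at h2
    exact (smul_eq_zero.mp h2.symm).resolve_left (by positivity)

theorem evalForm_actOp (θ : L →ₗ[ℝ] Module.End ℝ V) (k : ℕ) (X : Fin k → L) (x : L)
    (w : FockSpace V L) :
    evalForm (killingForm ℝ L) k X (actOp θ x w) =
      θ x (evalForm (killingForm ℝ L) k X w) := by
  induction k generalizing w with
  | zero =>
    have : vacuum V L ∘ₗ actOp θ x = θ x ∘ₗ vacuum V L :=
      TensorProduct.ext' fun v a => by simp [vacuum, actOp_tmul]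
    exact LinearMap.congr_fun this w
  | succ k ih =>
    have : annihilate V (X 0) ∘ₗ actOp θ x = actOp θ x ∘ₗ annihilate V (X 0) :=
      TensorProduct.ext' fun v a => rfl
    rw [evalForm_succ, evalForm_succ, ← ih]
    congr 1
    exact LinearMap.congr_fun this w

/-- The exterior derivative of a form with first order jet `(w, D)` with respect to a bracket `b`. -/
def extDiff (θ : L →ₗ[ℝ] Module.End ℝ V) (b : L →ₗ[ℝ] L →ₗ[ℝ] L) (w : FockSpace V L)
    (D : L →ₗ[ℝ] FockSpace V L) : FockSpace V L :=
  ∑ l, createOp V (cobasis L l) (D (basis L l) + actOp θ (basis L l) w) -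
    FockRelations.insertOp (basis L) (cobasis L) (createOp V) (annihilate V) b w

theorem evalForm_sum_create (k : ℕ) (X : Fin (k + 1) → L) (S : L →ₗ[ℝ] FockSpace V L) :
    evalForm (killingForm ℝ L) (k + 1) X (∑ l, createOp V (cobasis L l) (S (basis L l))) =
      ∑ i : Fin (k + 1), (-1 : ℝ) ^ (i : ℕ) •
        evalForm (killingForm ℝ L) k (i.removeNth X) (S (X i)) := by
  simp_rw [map_sum, evalForm_create _ killingForm_comm]
  rw [Finset.sum_comm]
  refine Finset.sum_congr rfl fun i _ => ?_
  rw [← Finset.smul_sum]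
  congr 1
  exact isDualPair_killingForm.sum_contract'
    (evalForm (killingForm ℝ L) k (i.removeNth X) ∘ₗ S) (X i)

theorem insertOp_degree_zero (b : L →ₗ[ℝ] L →ₗ[ℝ] L) (w : V ⊗[ℝ] (⋀[ℝ]^0 Γ.pPlus)) :
    FockRelations.insertOp (basis L) (cobasis L) (createOp V) (annihilate V) b
      (formIncl V Γ 0 w) = 0 := by
  simp [FockRelations.insertOp, LinearMap.sum_apply, annihilateOp_fockIncl_zero]

theorem evalForm_extDiff_zero (θ : L →ₗ[ℝ] Module.End ℝ V) (b : L →ₗ[ℝ] L →ₗ[ℝ] L)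
    (w : V ⊗[ℝ] (⋀[ℝ]^0 Γ.pPlus)) (D : L →ₗ[ℝ] V ⊗[ℝ] (⋀[ℝ]^0 Γ.pPlus)) (X : Fin 1 → L) :
    evalForm (killingForm ℝ L) 1 X (extDiff θ b (formIncl V Γ 0 w) (formIncl V Γ 0 ∘ₗ D)) =
      toForm Γ 0 (D (X 0)) (Fin.removeNth 0 X) +
        θ (X 0) (toForm Γ 0 w (Fin.removeNth 0 X)) := by
  have h := evalForm_sum_create 0 X
    (formIncl V Γ 0 ∘ₗ D + (actOp θ).flip (formIncl V Γ 0 w))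
  simp only [LinearMap.add_apply, LinearMap.flip_apply] at h
  rw [extDiff, map_sub, insertOp_degree_zero, map_zero, sub_zero]
  refine h.trans ?_
  simp [toForm_eq_evalForm, evalForm_actOp]

/-- Two applications of `evalForm_sum_create` give a double alternation of b. Skewness of b makes
every pair of arguments occur twice, which cancels the factor 1/2 in `insertOp`. -/
theorem evalForm_insertOp (k : ℕ) (b : L →ₗ[ℝ] L →ₗ[ℝ] L) (hb : ∀ x y, b y x = -b x y)
    (w : FockSpace V L) (X : Fin (k + 2) → L) :
    evalForm (killingForm ℝ L) (k + 2) X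
      (FockRelations.insertOp (basis L) (cobasis L) (createOp V) (annihilate V) b w) =
    ∑ i : Fin (k + 1), ∑ j ≥ i, (-1 : ℝ) ^ ((i : ℕ) + (j : ℕ)) •
      evalForm (killingForm ℝ L) (k + 1) (Fin.cons (b (X i.castSucc) (X j.succ))
        (j.removeNth (i.castSucc.removeNth X))) w := by
  have h1 : ∀ x, ∑ m, createOp V (cobasis L m) (annihilate V (b x (basis L m)) w) =
      ∑ m, createOp V (cobasis L m) (((annihilate V).flip w ∘ₗ b x) (basis L m)) := fun x => rfl
  -- The inner sum is written as a linear function of ξ_l so that `evalForm_sum_create` applies to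
  -- the outer one.
  have h2 : FockRelations.insertOp (basis L) (cobasis L) (createOp V) (annihilate V) b w =
      (1 / 2 : ℝ) • ∑ l, createOp V (cobasis L l)
        ((∑ m, (LinearMap.llcomp ℝ L (FockSpace V L) (FockSpace V L) (createOp V (cobasis L m)) ∘ₗ
          LinearMap.llcomp ℝ L L (FockSpace V L) ((annihilate V).flip w) ∘ₗ b).flip
            (basis L m)) (basis L l)) := by
    simp [FockRelations.insertOp, LinearMap.sum_apply, map_sum]
  have h3 := AlternatingMap.alternatizeUncurryFin_alternatizeUncurryFinLM_comp_apply
    (b.compr₂ (evalAlt (killingForm ℝ L) k ∘ₗ (annihilate V).flip w)) X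
  have h4 : AlternatingMap.alternatizeUncurryFin (AlternatingMap.alternatizeUncurryFinLM ∘ₗ
      b.compr₂ (evalAlt (killingForm ℝ L) k ∘ₗ (annihilate V).flip w)) X =
      ∑ i : Fin (k + 2), (-1 : ℝ) ^ (i : ℕ) • ∑ j : Fin (k + 1), (-1 : ℝ) ^ (j : ℕ) •
        evalForm (killingForm ℝ L) k (j.removeNth (i.removeNth X))
          (annihilate V (b (X i) (i.removeNth X j)) w) := by
    rw [AlternatingMap.alternatizeUncurryFin_apply]
    refine Finset.sum_congr rfl fun i _ => ?_
    rw [intPow_neg_one_smul, LinearMap.comp_apply, AlternatingMap.alternatizeUncurryFinLM_apply,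
      AlternatingMap.alternatizeUncurryFin_apply]
    congr 1
    refine Finset.sum_congr rfl fun j _ => ?_
    rw [intPow_neg_one_smul]
    rfl
  have h5 : ∀ i : Fin (k + 2), evalForm (killingForm ℝ L) (k + 1) (i.removeNth X)
      ((∑ m, (LinearMap.llcomp ℝ L (FockSpace V L) (FockSpace V L) (createOp V (cobasis L m)) ∘ₗ
          LinearMap.llcomp ℝ L L (FockSpace V L) ((annihilate V).flip w) ∘ₗ b).flip
            (basis L m)) (X i)) = ∑ j : Fin (k + 1), (-1 : ℝ) ^ (j : ℕ) •
        evalForm (killingForm ℝ L) k (j.removeNth (i.removeNth X))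
          (annihilate V (b (X i) (i.removeNth X j)) w) := fun i => by
    have := evalForm_sum_create k (i.removeNth X) ((annihilate V).flip w ∘ₗ b (X i))
    simpa [LinearMap.sum_apply] using this
  rw [h2, map_smul, evalForm_sum_create]
  simp_rw [h5]
  rw [← h4, h3, Finset.smul_sum]
  refine Finset.sum_congr rfl fun i _ => ?_
  rw [Finset.smul_sum]
  refine Finset.sum_congr rfl fun j _ => ?_
  have h6 : ∀ Y, b.compr₂ (evalAlt (killingForm ℝ L) k ∘ₗ (annihilate V).flip w)
      (X i.castSucc) (X j.succ) Y =
      evalForm (killingForm ℝ L) (k + 1) (Fin.cons (b (X i.castSucc) (X j.succ)) Y) w :=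
    fun Y => rfl
  have h7 : b.compr₂ (evalAlt (killingForm ℝ L) k ∘ₗ (annihilate V).flip w)
      (X j.succ) (X i.castSucc) = -b.compr₂ (evalAlt (killingForm ℝ L) k ∘ₗ (annihilate V).flip w)
      (X i.castSucc) (X j.succ) := by
    rw [LinearMap.compr₂_apply, hb, map_neg]
    rfl
  rw [intPow_neg_one_smul, h7, AlternatingMap.neg_apply, sub_neg_eq_add, h6, ← two_smul ℝ]
  module

theorem evalForm_extDiff_succ (θ : L →ₗ[ℝ] Module.End ℝ V) (b : L →ₗ[ℝ] L →ₗ[ℝ] L)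
    (hb : ∀ x y, b y x = -b x y) (k : ℕ)
    (w : V ⊗[ℝ] (⋀[ℝ]^(k + 1) Γ.pPlus)) (D : L →ₗ[ℝ] V ⊗[ℝ] (⋀[ℝ]^(k + 1) Γ.pPlus))
    (X : Fin (k + 2) → L) :
    evalForm (killingForm ℝ L) (k + 2) X
      (extDiff θ b (formIncl V Γ (k + 1) w) (formIncl V Γ (k + 1) ∘ₗ D)) =
      ∑ i : Fin (k + 2), (-1 : ℝ) ^ (i : ℕ) • (toForm Γ (k + 1) (D (X i)) (i.removeNth X) +
        θ (X i) (toForm Γ (k + 1) w (i.removeNth X))) +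
      ∑ i : Fin (k + 1), ∑ j ≥ i, (-1 : ℝ) ^ ((i.castSucc : ℕ) + (j.succ : ℕ)) •
        toForm Γ (k + 1) w (Fin.cons (b (X i.castSucc) (X j.succ))
          (j.removeNth (i.castSucc.removeNth X))) := by
  have h := evalForm_sum_create (k + 1) X
    (formIncl V Γ (k + 1) ∘ₗ D + (actOp θ).flip (formIncl V Γ (k + 1) w))
  simp only [LinearMap.add_apply, LinearMap.comp_apply, LinearMap.flip_apply] at h
  rw [extDiff, map_sub, evalForm_insertOp k b hb, sub_eq_add_neg]
  refine congrArg₂ _ (h.trans ?_) ?_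
  · refine Finset.sum_congr rfl fun i _ => ?_
    rw [map_add, evalForm_actOp, toForm_eq_evalForm, toForm_eq_evalForm]
  · rw [← Finset.sum_neg_distrib]
    refine Finset.sum_congr rfl fun i _ => ?_
    rw [← Finset.sum_neg_distrib]
    refine Finset.sum_congr rfl fun j _ => ?_
    -- The minus sign before the insertion is absorbed by the shift from j to j + 1 in the exponent.
    rw [toForm_eq_evalForm, Fin.val_castSucc, Fin.val_succ, ← add_assoc, pow_succ]
    module

end GradingProjections

/-! ### The Weitzenböck formula and horizontality of the exterior derivative -/

section Weitzenboeck

open FockRelations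

variable {L : Type*} [LieRing L] [LieAlgebra ℝ L] [FiniteDimensional ℝ L]
  [LieAlgebra.IsSemisimple ℝ L] {V : Type*} [AddCommGroup V] [Module ℝ V] {Γ : Grading L}
  (θ : L →ₗ[ℝ] Module.End ℝ V)

variable (V) in
/-- The operator on the Fock space inserting a two-form with values in `L`. -/
abbrev insert (K : L →ₗ[ℝ] L →ₗ[ℝ] L) : Module.End ℝ (FockSpace V L) :=
  insertOp (basis L) (cobasis L) (createOp V) (annihilate V) K

/-- The Kostant codifferential on the Fock space. -/
abbrev codiff : Module.End ℝ (FockSpace V L) :=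
  homolOp (basis L) (cobasis L) (createOp V) (annihilate V) (actOp θ)

/-- The natural action of `L` on the Fock space. -/
abbrev totalAct : L →ₗ[ℝ] Module.End ℝ (FockSpace V L) :=
  lieOp (basis L) (cobasis L) (createOp V) (annihilate V) (actOp θ)

/-- The bracket of `L` as a bilinear map. -/
abbrev lieBilin (L : Type*) [LieRing L] [LieAlgebra ℝ L] : L →ₗ[ℝ] L →ₗ[ℝ] L :=
  (LieModule.toEnd ℝ L L : L →ₗ[ℝ] Module.End ℝ L)

variable {θ}

theorem fock (hθ : ∀ x y : L, θ ⁅x, y⁆ = θ x * θ y - θ y * θ x) :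
    FockRelations (killingForm ℝ L) (createOp V) (annihilate V) (actOp θ) :=
  fockRelations _ killingForm_comm killingForm_lie θ hθ

/-- Writing b as the Lie bracket minus K turns the inserted bracket into the algebraic part of the
Chevalley–Eilenberg differential plus the insertion of K. -/
theorem extDiff_eq (hθ : ∀ x y : L, θ ⁅x, y⁆ = θ x * θ y - θ y * θ x)
    (b : L →ₗ[ℝ] L →ₗ[ℝ] L) (w : FockSpace V L) (D : L →ₗ[ℝ] FockSpace V L) :
    extDiff θ b w D = ∑ l, createOp V (cobasis L l) (D (basis L l)) +
      cohomOp (basis L) (cobasis L) (createOp V) (annihilate V) (actOp θ) w +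
      insert V (lieBilin L - b) w := by
  have h := insertOp_lie isDualPair_killingForm (fock hθ) (lieBilin L) (fun _ _ => rfl)
  rw [insert, insertOp_sub, h, extDiff, cohomOp]
  simp only [map_add, Finset.sum_add_distrib, LinearMap.add_apply, LinearMap.sub_apply,
    LinearMap.neg_apply, LinearMap.sum_apply, Module.End.mul_apply]
  abel

/-- The Weitzenböck type formula relating the Laplacian built from the exterior derivative and the
codifferential to the Casimir operators. -/
theorem codiff_extDiff (hθ : ∀ x y : L, θ ⁅x, y⁆ = θ x * θ y - θ y * θ x)
    (b : L →ₗ[ℝ] L →ₗ[ℝ] L) (w : FockSpace V L) (D : L →ₗ[ℝ] FockSpace V L) :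
    codiff θ (extDiff θ b w D) + extDiff θ b (codiff θ w) (codiff θ ∘ₗ D) =
      -∑ l, totalAct θ (cobasis L l) (D (basis L l)) -
      (1 / 2 : ℝ) • (∑ l, totalAct θ (basis L l) (totalAct θ (cobasis L l) w) +
        ∑ l, actOp θ (basis L l) (actOp θ (cobasis L l) w)) +
      (codiff θ (insert V (lieBilin L - b) w) + insert V (lieBilin L - b) (codiff θ w)) := by
  have hF := fock hθ
  have h1 := LinearMap.congr_fun (homolOp_cohomOp isDualPair_killingForm hF) w
  simp only [LinearMap.add_apply, Module.End.mul_apply, LinearMap.neg_apply, LinearMap.smul_apply,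
    LinearMap.sum_apply] at h1
  -- The codifferential has constant coefficients, so it meets the derivative term only through its
  -- anticommutator with ε.
  have h2 : ∀ l, codiff θ (createOp V (cobasis L l) (D (basis L l))) +
      createOp V (cobasis L l) (codiff θ (D (basis L l))) =
      -totalAct θ (cobasis L l) (D (basis L l)) := fun l => by
    have := LinearMap.congr_fun (homolOp_create isDualPair_killingForm hF (cobasis L l))
      (D (basis L l))
    simpa only [LinearMap.add_apply, Module.End.mul_apply, LinearMap.neg_apply] using this
  have h3 := Finset.sum_congr rfl fun l (_ : l ∈ Finset.univ) => h2 l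
  rw [Finset.sum_add_distrib, Finset.sum_neg_distrib] at h3
  rw [extDiff_eq hθ, extDiff_eq hθ, map_add, map_add, map_sum]
  generalize lieBilin L - b = K
  rw [sub_eq_add_neg, ← h3]
  refine Eq.trans ?_ (congrArg (fun y => _ + y + _) h1)
  simp only [LinearMap.comp_apply]
  abel

/-- The trace of the second derivatives twisted by the action of `L` vanishes on the two-jet of a
`𝔭`-equivariant function. -/
theorem sum_twisted_derivatives (hθ : ∀ x y : L, θ ⁅x, y⁆ = θ x * θ y - θ y * θ x)
    (w : FockSpace V L) (D : L →ₗ[ℝ] FockSpace V L) (D2 : L →ₗ[ℝ] L →ₗ[ℝ] FockSpace V L)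
    (hD : ∀ a ∈ Γ.fil 0, D a = -totalAct θ a w)
    (hD2 : ∀ a ∈ Γ.fil 0, ∀ x, D2 x a = -totalAct θ a (D x))
    (hcomm : ∀ a ∈ Γ.fil 0, ∀ x, D2 a x = D2 x a + D ⁅a, x⁆) :
    ∑ l, D2 (basis L l) (cobasis L l) +
      (2 : ℝ) • ∑ l, totalAct θ (cobasis L l) (D (basis L l)) +
      ∑ l, totalAct θ (basis L l) (totalAct θ (cobasis L l) w) = 0 := by
  have hF := fock hθ
  have hP : IsDualPair (killingForm ℝ L) (basis L) (cobasis L) := isDualPair_killingForm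
  set Λ : L →ₗ[ℝ] Module.End ℝ (FockSpace V L) := totalAct θ with hΛ
  let A : L →ₗ[ℝ] L →ₗ[ℝ] FockSpace V L := Λ.compl₂ D
  let C : L →ₗ[ℝ] L →ₗ[ℝ] FockSpace V L := Λ.compl₂ (Λ.flip w)
  -- The formal square of D + Λ, with the derivatives ordered so that an element of 𝔭 in the second
  -- slot gives zero; t is its first order analogue.
  let T : L →ₗ[ℝ] L →ₗ[ℝ] FockSpace V L := D2 + A.flip + A + C
  let t : L →ₗ[ℝ] FockSpace V L := D + Λ.flip w
  have hT : ∀ x y, T x y = D2 x y + Λ y (D x) + Λ x (D y) + Λ x (Λ y w) := fun x y => rfl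
  have ht : ∀ x, t x = D x + Λ x w := fun x => rfl
  have h1 : ∀ a ∈ Γ.fil 0, ∀ x, T x a = 0 := fun a ha x => by
    rw [hT, hD a ha, hD2 a ha, map_neg]
    abel
  -- Exchanging the slots costs only commutators, both for the derivatives and for Λ, and T(x, a) =
  -- 0.
  have h2 : ∀ a ∈ Γ.fil 0, ∀ x, T a x = t ⁅a, x⁆ := fun a ha x => by
    have h3 := LinearMap.congr_fun (lieOp_lie hP hF a x) w
    simp only [LinearMap.sub_apply, Module.End.mul_apply] at h3
    have h4 := h1 a ha x
    rw [hT] at h4 ⊢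
    rw [ht, hcomm a ha, hΛ, h3, ← hΛ]
    rw [← sub_eq_zero]
    rw [← h4]
    abel
  have h5 : ∀ x y, T x y = T x (Γ.negProj y) := fun x y => by
    have := h1 _ (Γ.sub_negProj_mem y) x
    rwa [map_sub, sub_eq_zero] at this
  -- The second slot may be projected to the negative part, hence the first to 𝔭₊, where T becomes t
  -- of a bracket. Moving the projection back gives t of an element of 𝔤_0 ⊆ 𝔭, where t vanishes by
  -- equivariance.
  have h6 : ∑ l, T (basis L l) (cobasis L l) = 0 := by
    rw [Finset.sum_congr rfl fun l _ => h5 (basis L l) (cobasis L l)]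
    rw [← hP.sum_adjoint T (f := Γ.posProj) (g := Γ.negProj)
      (fun x y => by rw [killingForm_comm, ← Γ.killingForm_negProj, killingForm_comm])]
    have h7 : ∀ l, T (Γ.posProj (basis L l)) (cobasis L l) =
        t ⁅Γ.posProj (basis L l), cobasis L l⁆ := fun l =>
      h2 _ (Γ.fil_anti (by norm_num) (Γ.posProj_mem _)) _
    simp_rw [h7]
    refine (hP.sum_adjoint ((lieBilin L).compr₂ t) (f := Γ.posProj) (g := Γ.negProj)
      (fun x y => by rw [killingForm_comm, ← Γ.killingForm_negProj, killingForm_comm])).trans ?_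
    have h8 : ∀ l, (lieBilin L).compr₂ t (basis L l) (Γ.negProj (cobasis L l)) =
        t ⁅basis L l, Γ.negProj (cobasis L l)⁆ := fun l => rfl
    simp_rw [h8]
    rw [← map_sum, ht, hD _ Γ.sum_lie_negProj_mem]
    abel
  simp only [hT, Finset.sum_add_distrib] at h6
  have h9 : ∑ l, Λ (basis L l) (D (cobasis L l)) = ∑ l, Λ (cobasis L l) (D (basis L l)) :=
    hP.sum_symm A
  rw [h9] at h6
  rw [two_smul, ← h6]
  abel

/-- By Cartan's formula the algebraic part contributes Λ_a w and the derivative part contributes D a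
= -Λ_a w; the curvature part is zero because b agrees with the Lie bracket on a. -/
theorem annihilate_extDiff (hθ : ∀ x y : L, θ ⁅x, y⁆ = θ x * θ y - θ y * θ x)
    {b : L →ₗ[ℝ] L →ₗ[ℝ] L} (hb : ∀ x y, b y x = -b x y) {k : ℕ}
    {w : V ⊗[ℝ] (⋀[ℝ]^k Γ.pPlus)} {D : L →ₗ[ℝ] V ⊗[ℝ] (⋀[ℝ]^k Γ.pPlus)} {a : L}
    (ha : a ∈ Γ.fil 0) (hba : ∀ x, b a x = ⁅a, x⁆)
    (hD : formIncl V Γ k (D a) = -totalAct θ a (formIncl V Γ k w)) :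
    annihilate V a (extDiff θ b (formIncl V Γ k w) (formIncl V Γ k ∘ₗ D)) = 0 := by
  have hF := fock hθ
  have hP : IsDualPair (killingForm ℝ L) (basis L) (cobasis L) := isDualPair_killingForm
  have h1 := LinearMap.congr_fun (annihilate_cohomOp hP hF a) (formIncl V Γ k w)
  have h2 := LinearMap.congr_fun (annihilate_insertOp hP hF (lieBilin L - b)
    (fun x y => by
      rw [LinearMap.sub_apply, LinearMap.sub_apply, LinearMap.sub_apply, LinearMap.sub_apply, hb]
      change ⁅y, x⁆ - _ = -(⁅x, y⁆ - _)
      rw [← lie_skew]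
      abel) a) (formIncl V Γ k w)
  have h3 : ∀ x, (lieBilin L - b) a x = 0 := fun x => by
    rw [LinearMap.sub_apply, LinearMap.sub_apply, hba]
    exact sub_self _
  have h4 := hP.sum_contract' (formIncl V Γ k ∘ₗ D) a
  simp only [LinearMap.add_apply, Module.End.mul_apply, annihilate_formIncl_of_mem _ _ ha, map_zero,
    add_zero, h3, mul_zero, Finset.sum_const_zero, LinearMap.zero_apply] at h1 h2
  simp only [LinearMap.comp_apply] at h4
  rw [extDiff_eq hθ, map_add, map_add, h1, h2, map_sum]
  simp_rw [LinearMap.comp_apply, annihilateOp_create _ killingForm_comm,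
    annihilate_formIncl_of_mem _ _ ha, map_zero, sub_zero]
  rw [h4, hD]
  abel

theorem createOp_fockIncl_id_mem {k : ℕ} {x : L} {w : FockSpace V L}
    (hw : w ∈ LinearMap.range (fockIncl (V := V) (LinearMap.id : L →ₗ[ℝ] L) k)) :
    createOp V x w ∈ LinearMap.range (fockIncl (V := V) (LinearMap.id : L →ₗ[ℝ] L) (k + 1)) := by
  obtain ⟨w, rfl⟩ := hw
  exact createOp_fockIncl_mem LinearMap.id k x w

theorem insert_mem (K : L →ₗ[ℝ] L →ₗ[ℝ] L) (k : ℕ) (w : V ⊗[ℝ] (⋀[ℝ]^k Γ.pPlus)) :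
    insert V K (formIncl V Γ k w) ∈
      LinearMap.range (fockIncl (V := V) (LinearMap.id : L →ₗ[ℝ] L) (k + 1)) := by
  cases k with
  | zero => rw [insert, insertOp_degree_zero]; exact zero_mem _
  | succ k =>
    simp only [insert, insertOp, LinearMap.smul_apply, LinearMap.sum_apply, Module.End.mul_apply]
    refine Submodule.smul_mem _ _ (Submodule.sum_mem _ fun l _ => Submodule.sum_mem _ fun m _ =>
      createOp_fockIncl_id_mem (createOp_fockIncl_id_mem ?_))
    obtain ⟨w', hw'⟩ := formIncl_mem Γ (k + 1) w
    rw [← hw']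
    exact annihilateOp_fockIncl_mem _ killingForm_comm _ _ _ _

theorem extDiff_mem (b : L →ₗ[ℝ] L →ₗ[ℝ] L) (k : ℕ)
    (w : V ⊗[ℝ] (⋀[ℝ]^k Γ.pPlus)) (D : L →ₗ[ℝ] V ⊗[ℝ] (⋀[ℝ]^k Γ.pPlus)) :
    extDiff θ b (formIncl V Γ k w) (formIncl V Γ k ∘ₗ D) ∈
      LinearMap.range (fockIncl (V := V) (LinearMap.id : L →ₗ[ℝ] L) (k + 1)) := by
  refine sub_mem (Submodule.sum_mem _ fun l _ => createOp_fockIncl_id_mem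
    (add_mem (formIncl_mem Γ k _) ?_)) (insert_mem b k w)
  induction w using forms_induction with
  | tmul v Z =>
    rw [fockIncl_tmul]
    exact ⟨θ (basis L l) v ⊗ₜ exteriorPower.ιMulti ℝ k fun i => (Z i : L), fockIncl_tmul _ _ _ _⟩
  | add x y hx hy => rw [map_add, map_add]; exact add_mem hx hy

theorem extDiff_mem_range_formIncl (hθ : ∀ x y : L, θ ⁅x, y⁆ = θ x * θ y - θ y * θ x)
    {b : L →ₗ[ℝ] L →ₗ[ℝ] L} (hb : ∀ x y, b y x = -b x y)
    (hba : ∀ a ∈ Γ.fil 0, ∀ x, b a x = ⁅a, x⁆) {k : ℕ}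
    {w : V ⊗[ℝ] (⋀[ℝ]^k Γ.pPlus)} {D : L →ₗ[ℝ] V ⊗[ℝ] (⋀[ℝ]^k Γ.pPlus)}
    (hD : ∀ a ∈ Γ.fil 0, formIncl V Γ k (D a) = -totalAct θ a (formIncl V Γ k w)) :
    extDiff θ b (formIncl V Γ k w) (formIncl V Γ k ∘ₗ D) ∈ LinearMap.range (formIncl V Γ (k + 1)) :=
  mem_range_formIncl Γ (extDiff_mem b k w D) fun a ha =>
    annihilate_extDiff hθ hb ha (hba a ha) (hD a ha)

theorem codiff_formIncl_zero (w : V ⊗[ℝ] (⋀[ℝ]^0 Γ.pPlus)) :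
    codiff θ (formIncl V Γ 0 w) = 0 := by
  induction w using forms_induction with
  | tmul v Z => rw [fockIncl_tmul, homolOp_wedge_zero]
  | add x y hx hy => rw [map_add, map_add, hx, hy, add_zero]

theorem codiff_formIncl (hθ : ∀ x y : L, θ ⁅x, y⁆ = θ x * θ y - θ y * θ x) (k : ℕ)
    (w : V ⊗[ℝ] (⋀[ℝ]^(k + 1) Γ.pPlus)) :
    codiff θ (formIncl V Γ (k + 1) w) = formIncl V Γ k (kostantCodiff Γ θ k w) :=
  homolOp_fockIncl isDualPair_killingForm θ (fock hθ) (pIncl Γ) _ (fun _ _ => rfl) k w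

theorem totalAct_codiff (hθ : ∀ x y : L, θ ⁅x, y⁆ = θ x * θ y - θ y * θ x) (x : L)
    (w : FockSpace V L) : totalAct θ x (codiff θ w) = codiff θ (totalAct θ x w) :=
  LinearMap.congr_fun (lieOp_homolOp isDualPair_killingForm (fock hθ) x) w

theorem sum_actOp_actOp {c₀ : ℝ} (hc : casimir θ = c₀ • LinearMap.id) (w : FockSpace V L) :
    ∑ l, actOp θ (basis L l) (actOp θ (cobasis L l) w) = c₀ • w := by
  have h : ∀ v, ∑ l, θ (basis L l) (θ (cobasis L l) v) = c₀ • v := fun v => by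
    have := LinearMap.congr_fun hc v
    rw [casimir, killingTrace_eq, LinearMap.sum_apply] at this
    exact this
  induction w using TensorProduct.induction_on with
  | zero => simp
  | tmul v a =>
    simp_rw [actOp_tmul]
    rw [← TensorProduct.sum_tmul, h, TensorProduct.smul_tmul']
  | add x y hx hy => simp only [map_add, Finset.sum_add_distrib, hx, hy, smul_add]

end Weitzenboeck

/-! ### Filtrations -/

section Filtration

open FockRelations

variable {L : Type*} [LieRing L] [LieAlgebra ℝ L] [FiniteDimensional ℝ L]
  [LieAlgebra.IsSemisimple ℝ L] {V : Type*} [AddCommGroup V] [Module ℝ V] {Γ : Grading L}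
  {θ : L →ₗ[ℝ] Module.End ℝ V}

/-- An element of 𝔤_j shifts eigenvalues of the grading element by j. -/
theorem act_mem_repFil (hθ : ∀ x y : L, θ ⁅x, y⁆ = θ x * θ y - θ y * θ x) {n : ℤ} {r : ℝ} {x : L}
    {v : V} (hx : x ∈ Γ.fil n) (hv : v ∈ repFil Γ θ r) : θ x v ∈ repFil Γ θ (n + r) := by
  refine Γ.fil_induction (p := fun x => θ x v ∈ repFil Γ θ (n + r)) (fun j hj x hx => ?_)
    (fun x y hx hy => by rw [map_add]; exact add_mem hx hy) hx
  induction hv using Submodule.span_induction with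
  | zero => rw [map_zero]; exact zero_mem _
  | add v w _ _ hv hw => rw [map_add]; exact add_mem hv hw
  | smul c v _ hv => rw [map_smul]; exact Submodule.smul_mem _ _ hv
  | mem v hv =>
    obtain ⟨s, hs, hv⟩ := hv
    refine Submodule.subset_span ⟨j + s, add_le_add (by exact_mod_cast hj) hs, ?_⟩
    have h := LinearMap.congr_fun (hθ Γ.gradingElement x) v
    rw [Γ.isGradingElement_gradingElement j x hx, map_smul, LinearMap.sub_apply,
      Module.End.mul_apply, Module.End.mul_apply, hv, map_smul, LinearMap.smul_apply] at h
    rw [eq_add_of_sub_eq h.symm]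
    module

theorem tmul_mem_formFil {k : ℕ} {a r : ℝ} {n : Fin k → ℤ} {Z : Fin k → Γ.pPlus} {v : V}
    (hZ : ∀ i, (Z i : L) ∈ Γ.fil (n i)) (hv : v ∈ repFil Γ θ r)
    (h : a ≤ (∑ i, (n i : ℝ)) + r) :
    v ⊗ₜ exteriorPower.ιMulti ℝ k Z ∈ formFil Γ θ k a :=
  Submodule.subset_span ⟨n, r, Z, v, hZ, hv, h, rfl⟩

theorem sum_removeNth {k : ℕ} (n : Fin (k + 1) → ℤ) (i : Fin (k + 1)) :
    (∑ j, ((i.removeNth n) j : ℝ)) = (∑ j, (n j : ℝ)) - n i := by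
  rw [Fin.sum_univ_succAbove _ i]
  simp [Fin.removeNth]

/-- Applying a factor to v, or bracketing two factors, adds their degrees, so the total degree is
not lowered. -/
theorem kostantCodiff_mem_formFil (hθ : ∀ x y : L, θ ⁅x, y⁆ = θ x * θ y - θ y * θ x) {k : ℕ}
    {a : ℝ} {w : V ⊗[ℝ] (⋀[ℝ]^(k + 1) Γ.pPlus)} (hw : w ∈ formFil Γ θ (k + 1) a) :
    kostantCodiff Γ θ k w ∈ formFil Γ θ k a := by
  induction hw using Submodule.span_induction with
  | zero => rw [map_zero]; exact zero_mem _
  | add v w _ _ hv hw => rw [map_add]; exact add_mem hv hw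
  | smul c v _ hv => rw [map_smul]; exact Submodule.smul_mem _ _ hv
  | mem w hw =>
    obtain ⟨n, r, Z, v, hZ, hv, h, rfl⟩ := hw
    have h1 : ∀ i : Fin (k + 1), θ (Z i) v ⊗ₜ exteriorPower.ιMulti ℝ k (i.removeNth Z) ∈
        formFil Γ θ k a := fun i => by
      refine tmul_mem_formFil (n := i.removeNth n) (r := n i + r) (fun j => hZ _)
        (act_mem_repFil hθ (hZ i) hv) ?_
      rw [sum_removeNth]
      linarith
    cases k with
    | zero =>
      rw [kostantCodiff, homologyDiff_zero_apply]
      exact neg_mem (h1 0)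
    | succ k =>
      rw [kostantCodiff, homologyDiff_succ_apply _ (fun x y => by
        rw [LinearMap.mk₂_apply, LinearMap.mk₂_apply]; exact (lie_skew y x).symm)]
      refine add_mem (Submodule.sum_mem _ fun i _ => Submodule.smul_mem _ _ (h1 i))
        (Submodule.sum_mem _ fun i _ => Submodule.sum_mem _ fun j hj => Submodule.smul_mem _ _ ?_)
      refine tmul_mem_formFil (n := Fin.cons (n i.castSucc + n j.succ)
        (j.removeNth (i.castSucc.removeNth n))) (r := r) (fun l => ?_) hv ?_
      · refine Fin.cases ?_ (fun l => ?_) l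
        · exact Γ.lie_mem_fil (hZ i.castSucc) (hZ j.succ)
        · exact hZ _
      · have hij : i ≤ j := by simpa using hj
        -- As i ≤ j, after removal of position i the entry at j is the original one at j + 1.
        have h2 : (i.castSucc.removeNth n) j = n j.succ := by
          rw [Fin.removeNth, Fin.succAbove_of_le_castSucc _ _ (by simpa using hij)]
        rw [Fin.sum_univ_succ]
        simp only [Fin.cons_zero, Fin.cons_succ]
        rw [sum_removeNth, sum_removeNth, h2]
        push_cast
        linarith

/-- The insertion replaces a factor Z_i by two dual basis vectors, weighted by B(K(ξ_l, ξ_m), Z_i).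
Decomposing ξ_l, ξ_m into degrees p, q, a weight can be nonzero only if the new factors, of degrees
-p and -q, have total degree at least one more than n_i. -/
theorem insert_mem_formFil {K : L →ₗ[ℝ] L →ₗ[ℝ] L} (hK : ∀ x y, K y x = -K x y)
    (hKp : ∀ a ∈ Γ.fil 0, ∀ x, K a x = 0)
    (hreg : ∀ i j : ℤ, i < 0 → j < 0 → ∀ x ∈ Γ.fil i, ∀ y ∈ Γ.fil j, K x y ∈ Γ.fil (i + j + 1))
    {k : ℕ} {a : ℝ} {w : V ⊗[ℝ] (⋀[ℝ]^k Γ.pPlus)} (hw : w ∈ formFil Γ θ k a) :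
    insert V K (formIncl V Γ k w) ∈ (formFil Γ θ (k + 1) (a + 1)).map (formIncl V Γ (k + 1)) := by
  cases k with
  | zero => rw [insert, insertOp_degree_zero]; exact zero_mem _
  | succ k =>
  induction hw using Submodule.span_induction with
  | zero => rw [map_zero, map_zero]; exact zero_mem _
  | add v w _ _ hv hw => rw [map_add, map_add]; exact add_mem hv hw
  | smul c v _ hv => rw [map_smul, map_smul]; exact Submodule.smul_mem _ _ hv
  | mem w hw =>
    obtain ⟨n, r, Z, v, hZ, hv, h, rfl⟩ := hw
    have hP : IsDualPair (killingForm ℝ L) (basis L) (cobasis L) := isDualPair_killingForm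
    set F := (formFil Γ θ (k + 2) (a + 1)).map (formIncl V Γ (k + 2)) with hF
    have key : ∀ i : Fin (k + 1), ∑ l, ∑ m, killingForm ℝ L (K (basis L l) (basis L m)) (Z i) •
        createOp V (cobasis L l) (createOp V (cobasis L m)
          (wedge k v (i.removeNth fun i => (Z i : L)))) ∈ F := by
      intro i
      set u : FockSpace V L := wedge k v (i.removeNth fun i => (Z i : L)) with hu
      let T : L → L → L → L → FockSpace V L := fun x y x' y' =>
        killingForm ℝ L (K x y) (Z i) • createOp V x' (createOp V y' u)
      have hT : ∀ p q l m, T (Γ.proj p (basis L l)) (Γ.proj q (basis L m))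
          (Γ.proj (-p) (cobasis L l)) (Γ.proj (-q) (cobasis L m)) ∈ F := by
        intro p q l m
        -- Nonnegative components lie in 𝔭, where K vanishes; for negative p and q the projected
        -- dual vectors lie in 𝔭₊.
        by_cases hp : 0 ≤ p
        · simp only [T]
          rw [hKp _ (Γ.gr_le_fil hp (Γ.proj_mem p _)), map_zero, LinearMap.zero_apply, zero_smul]
          exact zero_mem _
        by_cases hq : 0 ≤ q
        · simp only [T]
          rw [hK, hKp _ (Γ.gr_le_fil hq (Γ.proj_mem q _)), neg_zero, map_zero,
            LinearMap.zero_apply, zero_smul]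
          exact zero_mem _
        have hK' := hreg p q (by omega) (by omega) _ (Γ.gr_le_fil le_rfl (Γ.proj_mem p (basis L l)))
          _ (Γ.gr_le_fil le_rfl (Γ.proj_mem q (basis L m)))
        -- K takes values in 𝔤^{p+q+1}, which is orthogonal to 𝔤^{n_i} in this case. Otherwise -p -
        -- q ≥ n_i + 1, which is the required gain.
        by_cases hn : 0 < p + q + 1 + n i
        · simp only [T]
          rw [Γ.killingForm_fil hn hK' (hZ i), zero_smul]
          exact zero_mem _
        have hx : Γ.proj (-p) (cobasis L l) ∈ Γ.fil 1 := Γ.gr_le_fil (by omega) (Γ.proj_mem _ _)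
        have hy : Γ.proj (-q) (cobasis L m) ∈ Γ.fil 1 := Γ.gr_le_fil (by omega) (Γ.proj_mem _ _)
        refine Submodule.smul_mem _ _ ?_
        refine ⟨v ⊗ₜ exteriorPower.ιMulti ℝ (k + 2) (Fin.cons ⟨_, hx⟩ (Fin.cons ⟨_, hy⟩
          (i.removeNth Z)) : Fin (k + 2) → Γ.pPlus), ?_, ?_⟩
        · refine tmul_mem_formFil (n := Fin.cons (-p) (Fin.cons (-q) (i.removeNth n))) (r := r)
            (fun j => ?_) hv ?_
          · refine Fin.cases ?_ (fun j => Fin.cases ?_ (fun j => ?_) j) j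
            · exact Γ.gr_le_fil le_rfl (Γ.proj_mem _ _)
            · exact Γ.gr_le_fil le_rfl (Γ.proj_mem _ _)
            · exact hZ _
          · have h3 : (p : ℝ) + q + 1 + n i ≤ 0 := by exact_mod_cast not_lt.mp hn
            rw [Fin.sum_univ_succ, Fin.sum_univ_succ]
            simp only [Fin.cons_zero, Fin.cons_succ]
            rw [sum_removeNth]
            push_cast
            linarith
        · rw [fockIncl_tmul, wedge_succ, wedge_succ]
          rfl
      have h1 : ∀ l m, T (basis L l) (basis L m) (cobasis L l) (cobasis L m) =
          ∑ p ∈ Finset.Icc (-(Γ.depth : ℤ)) Γ.depth, ∑ q ∈ Finset.Icc (-(Γ.depth : ℤ)) Γ.depth,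
            T (Γ.proj p (basis L l)) (Γ.proj q (basis L m)) (cobasis L l) (cobasis L m) := by
        intro l m
        simp only [T]
        simp_rw [← Finset.sum_smul]
        congr 1
        conv_lhs => rw [← Γ.sum_proj (basis L l), ← Γ.sum_proj (basis L m)]
        simp only [map_sum, LinearMap.sum_apply]
        exact Finset.sum_comm
      -- Adjointness of the projections under the Killing form transfers the degrees p, q of the
      -- basis vectors to degrees -p, -q of the dual vectors.
      have h2 : ∀ p q, ∑ l, ∑ m, T (Γ.proj p (basis L l)) (Γ.proj q (basis L m)) (cobasis L l)
          (cobasis L m) = ∑ l, ∑ m, T (Γ.proj p (basis L l)) (Γ.proj q (basis L m))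
            (Γ.proj (-p) (cobasis L l)) (Γ.proj (-q) (cobasis L m)) := by
        intro p q
        have h3 : ∀ l, ∑ m, T (Γ.proj p (basis L l)) (Γ.proj q (basis L m)) (cobasis L l)
          (cobasis L m) = ∑ m, T (Γ.proj p (basis L l)) (Γ.proj q (basis L m)) (cobasis L l)
            (Γ.proj (-q) (cobasis L m)) := fun l => by
          have := hP.sum_adjoint (LinearMap.mk₂ ℝ
            (fun x y => T (Γ.proj p (basis L l)) (Γ.proj q x) (cobasis L l) y)
            (fun x x' y => by simp [T, add_smul]) (fun c x y => by simp [T, mul_smul])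
            (fun x y y' => by simp [T]) (fun c x y => by
              simp only [T, map_smul, LinearMap.smul_apply]; rw [smul_comm]))
            (Γ.killingForm_proj q)
          simpa only [LinearMap.mk₂_apply, Γ.proj_proj] using this
        have h4 : ∀ m, ∑ l, T (Γ.proj p (basis L l)) (Γ.proj q (basis L m)) (cobasis L l)
          (Γ.proj (-q) (cobasis L m)) = ∑ l, T (Γ.proj p (basis L l)) (Γ.proj q (basis L m))
            (Γ.proj (-p) (cobasis L l)) (Γ.proj (-q) (cobasis L m)) := fun m => by
          have := hP.sum_adjoint (LinearMap.mk₂ ℝ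
            (fun x y => T (Γ.proj p x) (Γ.proj q (basis L m)) y (Γ.proj (-q) (cobasis L m)))
            (fun x x' y => by simp [T, add_smul]) (fun c x y => by simp [T, mul_smul])
            (fun x y y' => by simp [T])
            (fun c x y => by simp only [T, map_smul, LinearMap.smul_apply]; rw [smul_comm]))
            (Γ.killingForm_proj p)
          simpa only [LinearMap.mk₂_apply, Γ.proj_proj] using this
        simp_rw [h3]
        rw [Finset.sum_comm]
        simp_rw [h4]
        rw [Finset.sum_comm]
      change ∑ l, ∑ m, T (basis L l) (basis L m) (cobasis L l) (cobasis L m) ∈ F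
      simp_rw [h1]
      have h5 : ∑ l, ∑ m, ∑ p ∈ Finset.Icc (-(Γ.depth : ℤ)) Γ.depth,
          ∑ q ∈ Finset.Icc (-(Γ.depth : ℤ)) Γ.depth, T (Γ.proj p (basis L l))
          (Γ.proj q (basis L m)) (cobasis L l) (cobasis L m) =
          ∑ p ∈ Finset.Icc (-(Γ.depth : ℤ)) Γ.depth, ∑ q ∈ Finset.Icc (-(Γ.depth : ℤ)) Γ.depth,
          ∑ l, ∑ m, T (Γ.proj p (basis L l))
          (Γ.proj q (basis L m)) (cobasis L l) (cobasis L m) := by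
        simp_rw [Finset.sum_comm (s := Finset.univ) (t := Finset.Icc (-(Γ.depth : ℤ)) Γ.depth)]
      rw [h5]
      refine Submodule.sum_mem _ fun p _ => Submodule.sum_mem _ fun q _ => ?_
      rw [h2]
      exact Submodule.sum_mem _ fun l _ => Submodule.sum_mem _ fun m _ => hT p q l m
    have h6 : insert V K (formIncl V Γ (k + 1) (v ⊗ₜ exteriorPower.ιMulti ℝ (k + 1) Z)) =
        ∑ i : Fin (k + 1), (1 / 2 : ℝ) • (-1 : ℝ) ^ (i : ℕ) •
          ∑ l, ∑ m, killingForm ℝ L (K (basis L l) (basis L m)) (Z i) •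
            createOp V (cobasis L l) (createOp V (cobasis L m)
              (wedge k v (i.removeNth fun i => (Z i : L)))) := by
      rw [fockIncl_tmul]
      simp only [insert, insertOp, LinearMap.smul_apply, LinearMap.sum_apply, Module.End.mul_apply,
        annihilateOp_wedge _ killingForm_comm, map_sum, map_smul]
      simp_rw [Finset.sum_comm (s := Finset.univ (α := Fin (Module.finrank ℝ L)))
        (t := Finset.univ (α := Fin (k + 1))), Finset.smul_sum]
      rfl
    rw [h6]
    exact Submodule.sum_mem _ fun i _ => Submodule.smul_mem _ _ (Submodule.smul_mem _ _ (key i))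

end Filtration

/-! ### Calculus on manifolds -/

section SmoothMaps

variable {E H : Type*} [NormedAddCommGroup E] [NormedSpace ℝ E] [TopologicalSpace H]
  {I : ModelWithCorners ℝ E H} {N : Type*} [TopologicalSpace N] [ChartedSpace H N]

theorem mvfderiv_const_mul {f : N → ℝ} {x : N} (hf : MDifferentiableAt I 𝓘(ℝ, ℝ) f x) (c : ℝ)
    (v : TangentSpace I x) :
    mvfderiv I (fun y => c * f y) x v = c * mvfderiv I f x v := by
  rw [mvfderiv_fun_mul mdifferentiableAt_const hf, mvfderiv_const]
  simp

theorem mdifferentiableAt_sum {ι : Type*} (s : Finset ι) {f : ι → N → ℝ} {x : N}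
    (hf : ∀ i, MDifferentiableAt I 𝓘(ℝ, ℝ) (f i) x) :
    MDifferentiableAt I 𝓘(ℝ, ℝ) (fun y => ∑ i ∈ s, f i y) x := by
  classical
  induction s using Finset.induction_on with
  | empty => simpa using mdifferentiableAt_const
  | insert i s hi h =>
    simp only [Finset.sum_insert hi]
    exact (hf i).add h

theorem mvfderiv_sum {ι : Type*} (s : Finset ι) {f : ι → N → ℝ} {x : N}
    (hf : ∀ i, MDifferentiableAt I 𝓘(ℝ, ℝ) (f i) x) (v : TangentSpace I x) :
    mvfderiv I (fun y => ∑ i ∈ s, f i y) x v = ∑ i ∈ s, mvfderiv I (f i) x v := by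
  classical
  induction s using Finset.induction_on with
  | empty => simp [mvfderiv_const]
  | insert i s hi h =>
    simp only [Finset.sum_insert hi]
    rw [mvfderiv_fun_add (hf i) (mdifferentiableAt_sum s hf), add_apply, h]

theorem contMDiff_finset_sum {ι : Type*} (s : Finset ι) {f : ι → N → ℝ}
    (hf : ∀ i, ContMDiff I 𝓘(ℝ, ℝ) ∞ (f i)) :
    ContMDiff I 𝓘(ℝ, ℝ) ∞ (fun y => ∑ i ∈ s, f i y) := by
  classical
  induction s using Finset.induction_on with
  | empty => simpa using contMDiff_const
  | insert i s hi h =>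
    simp only [Finset.sum_insert hi]
    exact (hf i).add h

variable {W W' W'' : Type*} [AddCommGroup W] [Module ℝ W] [AddCommGroup W'] [Module ℝ W']
  [AddCommGroup W''] [Module ℝ W''] {f g : N → W}

theorem IsSmooth.mdifferentiableAt (hf : IsSmooth I f) (l : Module.Dual ℝ W) (x : N) :
    MDifferentiableAt I 𝓘(ℝ, ℝ) (fun x => l (f x)) x :=
  (hf l).mdifferentiableAt (by simp)

theorem isSmooth_iff {f : N → ℝ} : IsSmooth I f ↔ ContMDiff I 𝓘(ℝ, ℝ) ∞ f := by
  refine ⟨fun h => h LinearMap.id, fun h l => ?_⟩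
  have : (fun x => l (f x)) = fun x => f x * l 1 := by
    funext x
    rw [← smul_eq_mul, ← map_smul, smul_eq_mul, mul_one]
  rw [this]
  exact h.mul contMDiff_const

theorem isSmooth_const (w : W) : IsSmooth I (fun _ : N => w) := fun _ => contMDiff_const

theorem IsSmooth.add (hf : IsSmooth I f) (hg : IsSmooth I g) :
    IsSmooth I (fun x => f x + g x) := fun l => by
  simp only [map_add]
  exact (hf l).add (hg l)

theorem IsSmooth.linear (hf : IsSmooth I f) (T : W →ₗ[ℝ] W') : IsSmooth I (fun x => T (f x)) :=
  fun l => hf (l ∘ₗ T)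

theorem IsSmooth.sum {ι : Type*} {s : Finset ι} {f : ι → N → W} (hf : ∀ i, IsSmooth I (f i)) :
    IsSmooth I (fun x => ∑ i ∈ s, f i x) := fun l => by
  simpa only [map_sum] using contMDiff_finset_sum s fun i => hf i l

theorem IsSmooth.comp {E' H' : Type*} [NormedAddCommGroup E'] [NormedSpace ℝ E']
    [TopologicalSpace H'] {I' : ModelWithCorners ℝ E' H'} {N' : Type*} [TopologicalSpace N']
    [ChartedSpace H' N'] (hf : IsSmooth I f) {a : N' → N} (ha : ContMDiff I' I ∞ a) :
    IsSmooth I' (fun x => f (a x)) := fun l => (hf l).comp ha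

variable [FiniteDimensional ℝ W]

/-- A bilinear map evaluated on bases. -/
theorem bilinear_expand [FiniteDimensional ℝ W'] (b : W →ₗ[ℝ] W' →ₗ[ℝ] W'') (w : W) (w' : W') :
    b w w' = ∑ i, ∑ j, ((Module.finBasis ℝ W).coord i w * (Module.finBasis ℝ W').coord j w') •
      b (Module.finBasis ℝ W i) (Module.finBasis ℝ W' j) := by
  conv_lhs => rw [← (Module.finBasis ℝ W).sum_repr w, ← (Module.finBasis ℝ W').sum_repr w']
  simp only [map_sum, LinearMap.sum_apply, map_smul, LinearMap.smul_apply, Module.Basis.coord_apply]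
  rw [Finset.sum_comm]
  simp only [Finset.smul_sum, mul_smul]
  exact Finset.sum_congr rfl fun i _ => Finset.sum_congr rfl fun j _ => smul_comm _ _ _

theorem IsSmooth.bilinear [FiniteDimensional ℝ W'] (b : W →ₗ[ℝ] W' →ₗ[ℝ] W'') {f : N → W}
    {g : N → W'} (hf : IsSmooth I f) (hg : IsSmooth I g) : IsSmooth I (fun x => b (f x) (g x)) := by
  intro l
  have hb : ∀ x, b (f x) (g x) = _ := fun x => bilinear_expand b (f x) (g x)
  simp only [hb, map_sum, map_smul, smul_eq_mul]
  exact contMDiff_finset_sum _ fun i => contMDiff_finset_sum _ fun j =>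
    ((hf _).mul (hg _)).mul contMDiff_const

theorem IsSmooth.smul {a : N → ℝ} (ha : ContMDiff I 𝓘(ℝ, ℝ) ∞ a) (hf : IsSmooth I f) :
    IsSmooth I (fun x => a x • f x) :=
  (isSmooth_iff.mpr ha).bilinear (LinearMap.lsmul ℝ W) hf

/-- A linear map is determined linearly by its values on a basis, so pointwise smoothness suffices.
-/
theorem isSmooth_hom {f : N → W →ₗ[ℝ] W'} (hf : ∀ w, IsSmooth I (fun x => f x w)) :
    IsSmooth I f := by
  have h : f = fun x => ∑ i, ((Module.finBasis ℝ W).coord i).smulRightₗ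
      (f x (Module.finBasis ℝ W i)) := by
    funext x
    refine (Module.finBasis ℝ W).ext fun j => ?_
    simp [LinearMap.sum_apply, Finsupp.single_apply]
  rw [h]
  exact IsSmooth.sum fun i => (hf _).linear _

theorem IsSmooth.apply {f : N → W →ₗ[ℝ] W'} (hf : IsSmooth I f) (w : W) :
    IsSmooth I (fun x => f x w) :=
  hf.linear (LinearMap.applyₗ w)

/-! #### The differential -/

/-- A functional is a finite combination of coordinates; smoothness lets the derivative pass through
the sum. With `differential_eq` this reduces vector-valued calculus to real functions. -/
theorem apply_differential (hf : IsSmooth I f) (l : Module.Dual ℝ W) (x : N)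
    (v : TangentSpace I x) : l (differential I f x v) = mvfderiv I (fun y => l (f y)) x v := by
  have h : (fun y => l (f y)) = fun y => ∑ i, l (Module.finBasis ℝ W i) *
      (Module.finBasis ℝ W).coord i (f y) := by
    funext y
    conv_lhs => rw [← (Module.finBasis ℝ W).sum_repr (f y)]
    simp only [map_sum, map_smul, smul_eq_mul, Module.Basis.coord_apply, mul_comm]
  have h1 : ∀ i, MDifferentiableAt I 𝓘(ℝ, ℝ) (fun y => l (Module.finBasis ℝ W i) *
      (Module.finBasis ℝ W).coord i (f y)) x := fun i =>
    mdifferentiableAt_const.mul (hf.mdifferentiableAt _ x)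
  rw [h, mvfderiv_sum _ h1]
  simp_rw [mvfderiv_const_mul (hf.mdifferentiableAt _ x)]
  simp only [differential, LinearMap.sum_apply, map_sum, LinearMap.smulRight_apply, map_smul,
    smul_eq_mul]
  exact Finset.sum_congr rfl fun i _ => mul_comm _ _

theorem differential_eq {x : N} {v : TangentSpace I x} (hf : IsSmooth I f) {w : W}
    (h : ∀ l : Module.Dual ℝ W, l w = mvfderiv I (fun y => l (f y)) x v) :
    differential I f x v = w := by
  rw [← sub_eq_zero, ← Module.forall_dual_apply_eq_zero_iff ℝ]
  intro l
  rw [map_sub, apply_differential hf, h, sub_self]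

theorem differential_const (w : W) (x : N) (v : TangentSpace I x) :
    differential I (fun _ : N => w) x v = 0 :=
  differential_eq (isSmooth_const w) fun l => by simp [mvfderiv_const]

theorem differential_add (hf : IsSmooth I f) (hg : IsSmooth I g) (x : N) (v : TangentSpace I x) :
    differential I (fun y => f y + g y) x v = differential I f x v + differential I g x v :=
  differential_eq (hf.add hg) fun l => by
    simp only [map_add]
    rw [mvfderiv_fun_add (hf.mdifferentiableAt l x) (hg.mdifferentiableAt l x),
      apply_differential hf, apply_differential hg]
    rfl

theorem differential_linear [FiniteDimensional ℝ W'] (hf : IsSmooth I f) (T : W →ₗ[ℝ] W') (x : N)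
    (v : TangentSpace I x) :
    differential I (fun y => T (f y)) x v = T (differential I f x v) :=
  differential_eq (hf.linear T) fun l => apply_differential hf (l ∘ₗ T) x v

theorem differential_bilinear [FiniteDimensional ℝ W'] [FiniteDimensional ℝ W'']
    (b : W →ₗ[ℝ] W' →ₗ[ℝ] W'') {f : N → W} {g : N → W'} (hf : IsSmooth I f) (hg : IsSmooth I g)
    (x : N) (v : TangentSpace I x) :
    differential I (fun y => b (f y) (g y)) x v =
      b (differential I f x v) (g x) + b (f x) (differential I g x v) :=
  differential_eq (hf.bilinear b hg) fun l => by
    have h1 : ∀ i j, MDifferentiableAt I 𝓘(ℝ, ℝ) (fun y => (Module.finBasis ℝ W).coord i (f y) *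
        (Module.finBasis ℝ W').coord j (g y)) x := fun i j =>
      (hf.mdifferentiableAt _ x).mul (hg.mdifferentiableAt _ x)
    have h2 : ∀ i j, MDifferentiableAt I 𝓘(ℝ, ℝ) (fun y => l (b (Module.finBasis ℝ W i)
        (Module.finBasis ℝ W' j)) * ((Module.finBasis ℝ W).coord i (f y) *
        (Module.finBasis ℝ W').coord j (g y))) x := fun i j =>
      mdifferentiableAt_const.mul (h1 i j)
    have hb : ∀ x, b (f x) (g x) = _ := fun x => bilinear_expand b (f x) (g x)
    simp only [hb, bilinear_expand b _ (g x), bilinear_expand b (f x), map_add, map_sum, map_smul,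
      smul_eq_mul]
    simp only [mul_comm _ (l (b _ _))]
    rw [mvfderiv_sum _ fun i => mdifferentiableAt_sum _ (h2 i), ← Finset.sum_add_distrib]
    refine Finset.sum_congr rfl fun i _ => ?_
    rw [mvfderiv_sum _ (h2 i), ← Finset.sum_add_distrib]
    refine Finset.sum_congr rfl fun j _ => ?_
    rw [mvfderiv_const_mul (h1 i j), mvfderiv_fun_mul (hf.mdifferentiableAt _ x)
      (hg.mdifferentiableAt _ x), apply_differential hf, apply_differential hg]
    simp only [add_apply, smul_apply, smul_eq_mul]
    ring

theorem differential_apply [FiniteDimensional ℝ W'] {f : N → W →ₗ[ℝ] W'} (hf : IsSmooth I f) (w : W)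
    (x : N) (v : TangentSpace I x) :
    differential I (fun y => f y w) x v = differential I f x v w :=
  differential_linear hf (LinearMap.applyₗ w) x v

theorem differential_comp {E' H' : Type*} [NormedAddCommGroup E'] [NormedSpace ℝ E']
    [TopologicalSpace H'] {I' : ModelWithCorners ℝ E' H'} {N' : Type*} [TopologicalSpace N']
    [ChartedSpace H' N'] (hf : IsSmooth I f) {a : N' → N} (ha : ContMDiff I' I ∞ a) (x : N')
    (v : TangentSpace I' x) :
    differential I' (fun y => f (a y)) x v = differential I f (a x) (mfderiv I' I a x v) :=
  differential_eq (hf.comp ha) fun l => by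
    rw [apply_differential hf]
    exact (mvfderiv_comp_apply (g := fun y => l (f y)) x (hf.mdifferentiableAt l _)
      (ha.mdifferentiableAt (by simp)) v).symm

end SmoothMaps

/-! ### Smoothness of derivatives along smooth families of tangent vectors -/

section Smoothness

variable {E H : Type*} [NormedAddCommGroup E] [NormedSpace ℝ E] [TopologicalSpace H]
  {I : ModelWithCorners ℝ E H} {N : Type*} [TopologicalSpace N] [ChartedSpace H N]
  [IsManifold I ∞ N]

/-- The derivative is the fibre coordinate of the tangent map, which is smooth. -/
theorem contMDiffOn_mvfderiv {f : N → ℝ} {U : Set N} (hU : IsOpen U)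
    (hf : ContMDiffOn I 𝓘(ℝ, ℝ) ∞ f U) {E' H' : Type*} [NormedAddCommGroup E']
    [NormedSpace ℝ E'] [TopologicalSpace H'] {I' : ModelWithCorners ℝ E' H'} {N' : Type*}
    [TopologicalSpace N'] [ChartedSpace H' N'] {s : Set N'} {g : N' → TangentBundle I N}
    (hg : ContMDiffOn I' I.tangent ∞ g s) (hs : ∀ y ∈ s, (g y).1 ∈ U) :
    ContMDiffOn I' 𝓘(ℝ, ℝ) ∞ (fun y => mvfderiv I f (g y).1 (g y).2) s := by
  have h1 := hf.contMDiffOn_tangentMapWithin (m := ∞) (by simp) hU.uniqueMDiffOn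
  have h2 := (contMDiff_snd_tangentBundle_modelSpace (n := ∞) ℝ 𝓘(ℝ, ℝ)).comp_contMDiffOn
    (h1.comp hg hs)
  refine h2.congr fun y hy => ?_
  have h3 : mfderivWithin I 𝓘(ℝ, ℝ) f U (g y).1 = mfderiv I 𝓘(ℝ, ℝ) f (g y).1 :=
    mfderivWithin_of_isOpen hU (hs y hy)
  exact (congrArg (fun T : TangentSpace I (g y).1 →L[ℝ] TangentSpace 𝓘(ℝ, ℝ) (f (g y).1) =>
    (T (g y).2 : ℝ)) h3).symm

theorem contMDiff_mvfderiv {f : N → ℝ} (hf : ContMDiff I 𝓘(ℝ, ℝ) ∞ f) {E' H' : Type*}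
    [NormedAddCommGroup E'] [NormedSpace ℝ E'] [TopologicalSpace H'] {I' : ModelWithCorners ℝ E' H'}
    {N' : Type*} [TopologicalSpace N'] [ChartedSpace H' N'] {g : N' → TangentBundle I N}
    (hg : ContMDiff I' I.tangent ∞ g) :
    ContMDiff I' 𝓘(ℝ, ℝ) ∞ (fun y => mvfderiv I f (g y).1 (g y).2) :=
  contMDiffOn_univ.mp (contMDiffOn_mvfderiv isOpen_univ hf.contMDiffOn hg.contMDiffOn fun _ _ =>
    Set.mem_univ _)

end Smoothness

/-! ### Vector fields and brackets as derivations -/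

section VectorFields

variable {E : Type*} [NormedAddCommGroup E] [NormedSpace ℝ E] {N : Type*} [TopologicalSpace N]
  [ChartedSpace E N]

theorem mvfderiv_eq_fderiv {f : N → ℝ} {x : N} (hf : MDifferentiableAt 𝓘(ℝ, E) 𝓘(ℝ, ℝ) f x)
    (v : TangentSpace 𝓘(ℝ, E) x) :
    mvfderiv 𝓘(ℝ, E) f x v =
      fderiv ℝ (f ∘ (extChartAt 𝓘(ℝ, E) x).symm) (extChartAt 𝓘(ℝ, E) x x) v := by
  rw [hf.mvfderiv, modelWithCornersSelf_coe, Set.range_id, fderivWithin_univ]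
  rfl

variable [IsManifold 𝓘(ℝ, E) ∞ N]

/-- Every linear functional on `T_x N` is the derivative of a smooth function. -/
theorem exists_mvfderiv_eq [FiniteDimensional ℝ E] (x : N) (l : Module.Dual ℝ E) :
    ∃ (U : Set N) (f : N → ℝ), IsOpen U ∧ x ∈ U ∧ ContMDiffOn 𝓘(ℝ, E) 𝓘(ℝ, ℝ) ∞ f U ∧
      ∀ v : TangentSpace 𝓘(ℝ, E) x, mvfderiv 𝓘(ℝ, E) f x v = l v := by
  set L := LinearMap.toContinuousLinearMap l
  refine ⟨(extChartAt 𝓘(ℝ, E) x).source, fun y => L (extChartAt 𝓘(ℝ, E) x y),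
    isOpen_extChartAt_source x, mem_extChartAt_source x, L.contMDiff.comp_contMDiffOn
        (by rw [extChartAt_source]; exact contMDiffOn_extChartAt), fun v => ?_⟩
  have h1 : ContMDiffAt 𝓘(ℝ, E) 𝓘(ℝ, ℝ) ∞ (fun y => L (extChartAt 𝓘(ℝ, E) x y)) x :=
    L.contMDiffAt.comp x contMDiffAt_extChartAt
  rw [mvfderiv_eq_fderiv (h1.mdifferentiableAt (by simp))]
  have h2 : (fun y => L (extChartAt 𝓘(ℝ, E) x y)) ∘ (extChartAt 𝓘(ℝ, E) x).symm
      =ᶠ[nhds (extChartAt 𝓘(ℝ, E) x x)] L := by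
    filter_upwards [extChartAt_target_mem_nhds x] with y hy
    rw [Function.comp_apply, PartialEquiv.right_inv _ hy]
  rw [h2.fderiv_eq, ContinuousLinearMap.fderiv]
  rfl

/-- Smooth functions near `x` separate the tangent vectors at `x`. -/
theorem eq_of_mvfderiv_eq [FiniteDimensional ℝ E] {x : N} {v w : TangentSpace 𝓘(ℝ, E) x}
    (h : ∀ (U : Set N) (f : N → ℝ), IsOpen U → x ∈ U → ContMDiffOn 𝓘(ℝ, E) 𝓘(ℝ, ℝ) ∞ f U →
      mvfderiv 𝓘(ℝ, E) f x v = mvfderiv 𝓘(ℝ, E) f x w) : v = w := by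
  have h3 : ∀ (l : Module.Dual ℝ E), l v = l w := fun l => by
    obtain ⟨U, f, hU, hx, hf, hl⟩ := exists_mvfderiv_eq x l
    exact ((hl v).symm.trans (h U f hU hx hf)).trans (hl w)
  have h4 : ∀ v w : E, (∀ l : Module.Dual ℝ E, l v = l w) → v = w := fun v w h =>
    sub_eq_zero.mp ((Module.forall_dual_apply_eq_zero_iff ℝ _).mp fun l => by
      rw [map_sub, h, sub_self])
  exact h4 v w h3

/-- A vector field read in the extended chart at `x`. -/
def chartField (Z : ∀ y : N, TangentSpace 𝓘(ℝ, E) y) (x : N) (y : E) : E :=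
  VectorField.mpullbackWithin 𝓘(ℝ, E) 𝓘(ℝ, E) (extChartAt 𝓘(ℝ, E) x).symm Z Set.univ y

theorem mfderiv_chartField (Z : ∀ y : N, TangentSpace 𝓘(ℝ, E) y) (x : N) {y : E}
    (hy : y ∈ (extChartAt 𝓘(ℝ, E) x).target) :
    mfderiv 𝓘(ℝ, E) 𝓘(ℝ, E) (extChartAt 𝓘(ℝ, E) x).symm y (chartField (E := E) Z x y) =
      Z ((extChartAt 𝓘(ℝ, E) x).symm y) := by
  have h := isInvertible_mfderivWithin_extChartAt_symm (I := 𝓘(ℝ, E)) hy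
  rw [modelWithCornersSelf_coe, Set.range_id] at h
  rw [← mfderivWithin_univ]
  exact h.self_apply_inverse _

theorem fderiv_comp_extChartAt_symm {f : N → ℝ} {x : N} {y : E}
    (hy : y ∈ (extChartAt 𝓘(ℝ, E) x).target)
    (hf : MDifferentiableAt 𝓘(ℝ, E) 𝓘(ℝ, ℝ) f ((extChartAt 𝓘(ℝ, E) x).symm y)) (v : E) :
    fderiv ℝ (f ∘ (extChartAt 𝓘(ℝ, E) x).symm) y v =
      mvfderiv 𝓘(ℝ, E) f ((extChartAt 𝓘(ℝ, E) x).symm y)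
        (mfderiv 𝓘(ℝ, E) 𝓘(ℝ, E) (extChartAt 𝓘(ℝ, E) x).symm y v) := by
  have hsymm : MDifferentiableAt 𝓘(ℝ, E) 𝓘(ℝ, E) (extChartAt 𝓘(ℝ, E) x).symm y :=
    ((contMDiffOn_extChartAt_symm (n := ∞) x).contMDiffAt
      ((isOpen_extChartAt_target x).mem_nhds hy)).mdifferentiableAt (by simp)
  have h2 := mvfderiv_comp_apply y hf hsymm v
  rw [mvfderiv, mfderiv_eq_fderiv] at h2
  exact h2

/-- The Lie bracket of vector fields is the commutator of derivations. -/
theorem mvfderiv_mlieBracket [CompleteSpace E] {X Y : ∀ x : N, TangentSpace 𝓘(ℝ, E) x} {x : N}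
    (hX : MDifferentiableAt 𝓘(ℝ, E) 𝓘(ℝ, E).tangent
      (fun y => (⟨y, X y⟩ : TangentBundle 𝓘(ℝ, E) N)) x)
    (hY : MDifferentiableAt 𝓘(ℝ, E) 𝓘(ℝ, E).tangent
      (fun y => (⟨y, Y y⟩ : TangentBundle 𝓘(ℝ, E) N)) x)
    {f : N → ℝ} {U : Set N} (hU : IsOpen U) (hx : x ∈ U)
    (hf : ContMDiffOn 𝓘(ℝ, E) 𝓘(ℝ, ℝ) ∞ f U)
    (hXf : MDifferentiableAt 𝓘(ℝ, E) 𝓘(ℝ, ℝ) (fun y => mvfderiv 𝓘(ℝ, E) f y (X y)) x)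
    (hYf : MDifferentiableAt 𝓘(ℝ, E) 𝓘(ℝ, ℝ) (fun y => mvfderiv 𝓘(ℝ, E) f y (Y y)) x) :
    mvfderiv 𝓘(ℝ, E) f x (VectorField.mlieBracket 𝓘(ℝ, E) X Y x) =
      mvfderiv 𝓘(ℝ, E) (fun y => mvfderiv 𝓘(ℝ, E) f y (Y y)) x (X x) -
      mvfderiv 𝓘(ℝ, E) (fun y => mvfderiv 𝓘(ℝ, E) f y (X y)) x (Y x) := by
  set e := extChartAt 𝓘(ℝ, E) x with he
  have hfx : ContMDiffAt 𝓘(ℝ, E) 𝓘(ℝ, ℝ) ∞ f x := hf.contMDiffAt (hU.mem_nhds hx)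
  have hmem : e x ∈ e.target := mem_extChartAt_target x
  have hfU : ∀ᶠ y in nhds (e x), e.symm y ∈ U :=
    (continuousAt_extChartAt_symm x).preimage_mem_nhds
      (by rw [extChartAt_to_inv]; exact hU.mem_nhds hx)
  have hinv : e.symm (e x) = x := extChartAt_to_inv x
  -- Near the base point, the derivative along a field and the derivative in the chart along its
  -- chart representative are the same function, so they may be differentiated again.
  have hpull : ∀ Z : ∀ x : N, TangentSpace 𝓘(ℝ, E) x,
      (fun y => fderiv ℝ (f ∘ e.symm) y (chartField Z x y)) =ᶠ[nhds (e x)]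
        (fun y => mvfderiv 𝓘(ℝ, E) f y (Z y)) ∘ e.symm := fun Z => by
    filter_upwards [extChartAt_target_mem_nhds x, hfU] with y hy hyU
    rw [fderiv_comp_extChartAt_symm hy
      ((hf.contMDiffAt (hU.mem_nhds hyU)).mdifferentiableAt (by simp)), mfderiv_chartField Z x hy]
    rfl
  have hbase : ∀ (g : N → ℝ) (Z : ∀ x : N, TangentSpace 𝓘(ℝ, E) x),
      MDifferentiableAt 𝓘(ℝ, E) 𝓘(ℝ, ℝ) g x →
      fderiv ℝ (g ∘ e.symm) (e x) (chartField Z x (e x)) = mvfderiv 𝓘(ℝ, E) g x (Z x) := by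
    intro g Z hg
    rw [fderiv_comp_extChartAt_symm hmem (by rwa [← he, hinv]), mfderiv_chartField Z x hmem, ← he,
      hinv]
  have hdiff : ∀ Z : ∀ x : N, TangentSpace 𝓘(ℝ, E) x, MDifferentiableAt 𝓘(ℝ, E) 𝓘(ℝ, E).tangent
      (fun y => (⟨y, Z y⟩ : TangentBundle 𝓘(ℝ, E) N)) x →
      DifferentiableAt ℝ (chartField Z x) (e x) := fun Z hZ => by
    have := hZ.mdifferentiableWithinAt (s := Set.univ)
    have := this.differentiableWithinAt_mpullbackWithin_vectorField
    simp only [Set.preimage_univ, modelWithCornersSelf_coe, Set.range_id, Set.univ_inter] at this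
    exact this.differentiableAt Filter.univ_mem
  have hfe : ContDiffAt ℝ ∞ (f ∘ e.symm) (e x) := by
    have := (hfx.comp_of_eq ((contMDiffOn_extChartAt_symm (n := ∞) x).contMDiffAt
      ((isOpen_extChartAt_target x).mem_nhds hmem)) hinv)
    exact contMDiffAt_iff_contDiffAt.mp this
  have h1 := VectorField.fderiv_apply_lieBracket hfe (by rw [minSmoothness_of_isRCLikeNormedField]; exact WithTop.coe_le_coe.mpr le_top) (hdiff Y hY) (hdiff X hX)
  rw [(hpull X).fderiv_eq, (hpull Y).fderiv_eq, hbase _ X hYf, hbase _ Y hXf] at h1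
  rw [← h1]
  -- The bracket on the manifold is the chart bracket transported back by the inverse of the chart's
  -- derivative.
  have h2 : mfderiv 𝓘(ℝ, E) 𝓘(ℝ, E) e x (VectorField.mlieBracket 𝓘(ℝ, E) X Y x) =
      VectorField.lieBracket (E := E) ℝ (chartField X x) (chartField Y x) (e x) := by
    have h3 : VectorField.mlieBracket 𝓘(ℝ, E) X Y x = (mfderiv 𝓘(ℝ, E) 𝓘(ℝ, E) e x).inverse
        (VectorField.lieBracketWithin (E := E) ℝ (chartField X x) (chartField Y x) Set.univ (e x)) := by
      have := VectorField.mlieBracketWithin_apply (I := 𝓘(ℝ, E)) (V := X) (W := Y) (s := Set.univ)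
        (x₀ := x)
      rw [modelWithCornersSelf_coe, Set.range_id, Set.preimage_univ, Set.univ_inter] at this
      exact this
    rw [h3, VectorField.lieBracketWithin_univ]
    exact (isInvertible_mfderiv_extChartAt (mem_extChartAt_source x)).self_apply_inverse _
  rw [← h2]
  have h4 : MDifferentiableAt 𝓘(ℝ, E) 𝓘(ℝ, E) e x :=
    (contMDiffAt_extChartAt (n := ∞)).mdifferentiableAt (by simp)
  have h5 := mvfderiv_comp_apply x
    (hfe.contMDiffAt.mdifferentiableAt (by simp)) h4 (VectorField.mlieBracket 𝓘(ℝ, E) X Y x)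
  have h6 : (f ∘ e.symm) ∘ e =ᶠ[nhds x] f := by
    filter_upwards [extChartAt_source_mem_nhds (I := 𝓘(ℝ, E)) x] with y hy
    rw [Function.comp_apply, Function.comp_apply, e.left_inv hy]
  have h7 : mvfderiv 𝓘(ℝ, E) ((f ∘ e.symm) ∘ e) x (VectorField.mlieBracket 𝓘(ℝ, E) X Y x) =
      mvfderiv 𝓘(ℝ, E) f x (VectorField.mlieBracket 𝓘(ℝ, E) X Y x) := by
    have h8 : mfderiv 𝓘(ℝ, E) 𝓘(ℝ, ℝ) ((f ∘ e.symm) ∘ e) x = mfderiv 𝓘(ℝ, E) 𝓘(ℝ, ℝ) f x :=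
      h6.mfderiv_eq
    exact congrArg (fun T : E →L[ℝ] ℝ => T (VectorField.mlieBracket 𝓘(ℝ, E) X Y x)) h8
  rw [← h7]
  refine h5.trans ?_
  rw [mvfderiv, mfderiv_eq_fderiv]
  rfl

end VectorFields

/-! ### Partial derivatives on products -/

section Partials

variable {E : Type*} [NormedAddCommGroup E] [NormedSpace ℝ E] {N : Type*} [TopologicalSpace N]
  [ChartedSpace E N] [IsManifold 𝓘(ℝ, E) ∞ N]
  {E' : Type*} [NormedAddCommGroup E'] [NormedSpace ℝ E'] {Q : Type*} [TopologicalSpace Q]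
  [ChartedSpace E' Q] [IsManifold 𝓘(ℝ, E') ∞ Q]

theorem mvfderiv_partial_left {F : N × Q → ℝ} {u : N} {q : Q}
    (hF : MDifferentiableAt (𝓘(ℝ, E).prod 𝓘(ℝ, E')) 𝓘(ℝ, ℝ) F (u, q)) (X : TangentSpace 𝓘(ℝ, E) u) :
    mvfderiv 𝓘(ℝ, E) (fun w => F (w, q)) u X =
      mvfderiv (𝓘(ℝ, E).prod 𝓘(ℝ, E')) F (u, q) ((X, 0) : E × E') := by
  have h := mvfderiv_comp_apply (f := fun w : N => (w, q)) u hF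
    (mdifferentiableAt_id.prodMk mdifferentiableAt_const) X
  have h1 : mfderiv 𝓘(ℝ, E) (𝓘(ℝ, E).prod 𝓘(ℝ, E')) (fun w : N => (w, q)) u X =
    ((X, 0) : E × E') := by rw [mfderiv_prod_left]; rfl
  rw [h1] at h
  exact h

theorem mvfderiv_partial_right {F : N × Q → ℝ} {u : N} {q : Q}
    (hF : MDifferentiableAt (𝓘(ℝ, E).prod 𝓘(ℝ, E')) 𝓘(ℝ, ℝ) F (u, q))
    (A : TangentSpace 𝓘(ℝ, E') q) :
    mvfderiv 𝓘(ℝ, E') (fun r => F (u, r)) q A =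
      mvfderiv (𝓘(ℝ, E).prod 𝓘(ℝ, E')) F (u, q) ((0, A) : E × E') := by
  have h := mvfderiv_comp_apply (f := fun r : Q => (u, r)) q hF
    (mdifferentiableAt_const.prodMk mdifferentiableAt_id) A
  have h1 : mfderiv 𝓘(ℝ, E') (𝓘(ℝ, E).prod 𝓘(ℝ, E')) (fun r : Q => (u, r)) q A =
    ((0, A) : E × E') := by rw [mfderiv_prod_right]; rfl
  rw [h1] at h
  exact h

/-- A partial derivative is the full derivative on (X, 0), and these vectors form a smooth family
over the other factor. -/
theorem contMDiffOn_partial_left {F : N × Q → ℝ} {O : Set (N × Q)} (hO : IsOpen O)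
    (hF : ContMDiffOn (𝓘(ℝ, E).prod 𝓘(ℝ, E')) 𝓘(ℝ, ℝ) ∞ F O) (u : N)
    (X : TangentSpace 𝓘(ℝ, E) u) :
    ContMDiffOn 𝓘(ℝ, E') 𝓘(ℝ, ℝ) ∞ (fun q => mvfderiv 𝓘(ℝ, E) (fun w => F (w, q)) u X)
      {q | (u, q) ∈ O} := by
  have h1 : ContMDiff 𝓘(ℝ, E') (𝓘(ℝ, E).tangent.prod 𝓘(ℝ, E').tangent) ∞
      (fun q : Q => ((⟨u, X⟩ : TangentBundle 𝓘(ℝ, E) N), (⟨q, 0⟩ : TangentBundle 𝓘(ℝ, E') Q))) :=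
    contMDiff_const.prodMk (Bundle.contMDiff_zeroSection ℝ _)
  have h2 := (contMDiff_equivTangentBundleProd_symm (n := ∞)).comp h1
  refine (contMDiffOn_mvfderiv hO hF (h2.contMDiffOn (s := {q | (u, q) ∈ O}))
    (fun q hq => hq)).congr fun q hq => ?_
  exact mvfderiv_partial_left ((hF.contMDiffAt (hO.mem_nhds hq)).mdifferentiableAt (by simp)) X

theorem contMDiffOn_partial_right {F : N × Q → ℝ} {O : Set (N × Q)} (hO : IsOpen O)
    (hF : ContMDiffOn (𝓘(ℝ, E).prod 𝓘(ℝ, E')) 𝓘(ℝ, ℝ) ∞ F O) (q : Q)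
    (A : TangentSpace 𝓘(ℝ, E') q) :
    ContMDiffOn 𝓘(ℝ, E) 𝓘(ℝ, ℝ) ∞ (fun w => mvfderiv 𝓘(ℝ, E') (fun r => F (w, r)) q A)
      {w | (w, q) ∈ O} := by
  have h1 : ContMDiff 𝓘(ℝ, E) (𝓘(ℝ, E).tangent.prod 𝓘(ℝ, E').tangent) ∞
      (fun w : N => ((⟨w, 0⟩ : TangentBundle 𝓘(ℝ, E) N), (⟨q, A⟩ : TangentBundle 𝓘(ℝ, E') Q))) :=
    (Bundle.contMDiff_zeroSection ℝ _).prodMk contMDiff_const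
  have h2 := (contMDiff_equivTangentBundleProd_symm (n := ∞)).comp h1
  refine (contMDiffOn_mvfderiv hO hF (h2.contMDiffOn (s := {w | (w, q) ∈ O}))
    (fun w hw => hw)).congr fun w hw => ?_
  exact mvfderiv_partial_right ((hF.contMDiffAt (hO.mem_nhds hw)).mdifferentiableAt (by simp)) A

/-- Symmetry of the second derivative, applied to (X, 0) and (0, A). -/
theorem fderiv_fderiv_partial {F : E × E' → ℝ} {a : E} {b : E'} (hF : ContDiffAt ℝ 2 F (a, b))
    (X : E) (A : E') :
    fderiv ℝ (fun y => fderiv ℝ (fun x => F (x, y)) a X) b A =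
      fderiv ℝ (fun x => fderiv ℝ (fun y => F (x, y)) b A) a X := by
  have hev : ∀ᶠ p in nhds (a, b), DifferentiableAt ℝ F p :=
    (hF.eventually (by simp)).mono fun p hp => hp.differentiableAt (by simp)
  have hd : DifferentiableAt ℝ (fderiv ℝ F) (a, b) :=
    (hF.fderiv_right (m := 1) (by norm_num)).differentiableAt (by simp)
  have h1 : (fun y => fderiv ℝ (fun x => F (x, y)) a X) =ᶠ[nhds b]
      fun y => fderiv ℝ F (a, y) (X, 0) := by
    have : Filter.Tendsto (fun y : E' => (a, y)) (nhds b) (nhds (a, b)) :=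
      (Continuous.prodMk_right a).continuousAt
    filter_upwards [this.eventually hev] with y hy
    have := (HasFDerivAt.comp (g := F) (f := fun x => (x, y)) a hy.hasFDerivAt
      (hasFDerivAt_prodMk_left a y)).fderiv
    exact (congrArg (fun T : E →L[ℝ] ℝ => T X) this).trans (by simp)
  have h2 : (fun x => fderiv ℝ (fun y => F (x, y)) b A) =ᶠ[nhds a]
      fun x => fderiv ℝ F (x, b) (0, A) := by
    have : Filter.Tendsto (fun x : E => (x, b)) (nhds a) (nhds (a, b)) :=
      (Continuous.prodMk_left b).continuousAt
    filter_upwards [this.eventually hev] with x hx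
    have := (HasFDerivAt.comp (g := F) (f := fun y => (x, y)) b hx.hasFDerivAt
      (hasFDerivAt_prodMk_right x b)).fderiv
    exact (congrArg (fun T : E' →L[ℝ] ℝ => T A) this).trans (by simp)
  have h3 := ((HasFDerivAt.comp (g := fderiv ℝ F) (f := fun y => (a, y)) b hd.hasFDerivAt
    (hasFDerivAt_prodMk_right a b)).clm_apply
    (hasFDerivAt_const ((X, 0) : E × E') b)).fderiv
  have h4 := ((HasFDerivAt.comp (g := fderiv ℝ F) (f := fun x => (x, b)) a hd.hasFDerivAt
    (hasFDerivAt_prodMk_left a b)).clm_apply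
    (hasFDerivAt_const ((0, A) : E × E') a)).fderiv
  rw [h1.fderiv_eq, h2.fderiv_eq]
  have h5 := (hF.isSymmSndFDerivAt (by simp)) (X, 0) (0, A)
  refine (congrArg (fun T : E' →L[ℝ] ℝ => T A) h3).trans
    (Eq.trans ?_ (congrArg (fun T : E →L[ℝ] ℝ => T X) h4).symm)
  simpa using h5.symm

/-- Partial derivatives commute. -/
theorem mvfderiv_partial_comm {F : N × Q → ℝ} {O : Set (N × Q)} (hO : IsOpen O)
    (hF : ContMDiffOn (𝓘(ℝ, E).prod 𝓘(ℝ, E')) 𝓘(ℝ, ℝ) ∞ F O) {u : N} {q : Q} (hu : (u, q) ∈ O)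
    (X : TangentSpace 𝓘(ℝ, E) u) (A : TangentSpace 𝓘(ℝ, E') q) :
    mvfderiv 𝓘(ℝ, E') (fun r => mvfderiv 𝓘(ℝ, E) (fun w => F (w, r)) u X) q A =
      mvfderiv 𝓘(ℝ, E) (fun w => mvfderiv 𝓘(ℝ, E') (fun r => F (w, r)) q A) u X := by
  have hOl : IsOpen {r | (u, r) ∈ O} := hO.preimage (Continuous.prodMk_right u)
  have hOr : IsOpen {w | (w, q) ∈ O} := hO.preimage (Continuous.prodMk_left q)
  have hl := ((contMDiffOn_partial_left hO hF u X).contMDiffAt (hOl.mem_nhds hu)).mdifferentiableAt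
    (by simp)
  have hr := ((contMDiffOn_partial_right hO hF q A).contMDiffAt (hOr.mem_nhds hu)).mdifferentiableAt
    (by simp)
  rw [mvfderiv_eq_fderiv hl, mvfderiv_eq_fderiv hr]
  have hd : ∀ p ∈ O, MDifferentiableAt (𝓘(ℝ, E).prod 𝓘(ℝ, E')) 𝓘(ℝ, ℝ) F p := fun p hp =>
    (hF.contMDiffAt (hO.mem_nhds hp)).mdifferentiableAt (by simp)
  have h1 : (fun r => mvfderiv 𝓘(ℝ, E) (fun w => F (w, r)) u X) ∘ (extChartAt 𝓘(ℝ, E') q).symm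
      =ᶠ[nhds (extChartAt 𝓘(ℝ, E') q q)] fun y => fderiv ℝ (fun x => F ((extChartAt 𝓘(ℝ, E) u).symm x,
        (extChartAt 𝓘(ℝ, E') q).symm y)) (extChartAt 𝓘(ℝ, E) u u) X := by
    have : ∀ᶠ y in nhds (extChartAt 𝓘(ℝ, E') q q), (u, (extChartAt 𝓘(ℝ, E') q).symm y) ∈ O :=
      (continuousAt_extChartAt_symm (I := 𝓘(ℝ, E')) q).preimage_mem_nhds
        (t := {r | (u, r) ∈ O}) (by rw [extChartAt_to_inv]; exact hOl.mem_nhds hu)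
    filter_upwards [this] with y hy
    exact mvfderiv_eq_fderiv (f := fun w => F (w, (extChartAt 𝓘(ℝ, E') q).symm y))
      (MDifferentiableAt.comp (g := F) (f := fun w => (w, (extChartAt 𝓘(ℝ, E') q).symm y)) u (hd _ hy)
        (mdifferentiableAt_id.prodMk mdifferentiableAt_const)) X
  have h2 : (fun w => mvfderiv 𝓘(ℝ, E') (fun r => F (w, r)) q A) ∘ (extChartAt 𝓘(ℝ, E) u).symm
      =ᶠ[nhds (extChartAt 𝓘(ℝ, E) u u)] fun x => fderiv ℝ (fun y => F ((extChartAt 𝓘(ℝ, E) u).symm x,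
        (extChartAt 𝓘(ℝ, E') q).symm y)) (extChartAt 𝓘(ℝ, E') q q) A := by
    have : ∀ᶠ x in nhds (extChartAt 𝓘(ℝ, E) u u), ((extChartAt 𝓘(ℝ, E) u).symm x, q) ∈ O :=
      (continuousAt_extChartAt_symm (I := 𝓘(ℝ, E)) u).preimage_mem_nhds
        (t := {w | (w, q) ∈ O}) (by rw [extChartAt_to_inv]; exact hOr.mem_nhds hu)
    filter_upwards [this] with x hx
    exact mvfderiv_eq_fderiv (f := fun r => F ((extChartAt 𝓘(ℝ, E) u).symm x, r))
      (MDifferentiableAt.comp (g := F) (f := fun r => ((extChartAt 𝓘(ℝ, E) u).symm x, r)) q (hd _ hx)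
        (mdifferentiableAt_const.prodMk mdifferentiableAt_id)) A
  rw [h1.fderiv_eq, h2.fderiv_eq]
  refine fderiv_fderiv_partial (F := fun p => F ((extChartAt 𝓘(ℝ, E) u).symm p.1,
    (extChartAt 𝓘(ℝ, E') q).symm p.2)) ?_ X A
  have h3 : ContMDiffAt 𝓘(ℝ, E × E') 𝓘(ℝ, E) ∞ (fun p : E × E' => (extChartAt 𝓘(ℝ, E) u).symm p.1)
      (extChartAt 𝓘(ℝ, E) u u, extChartAt 𝓘(ℝ, E') q q) :=
    ((contMDiffOn_extChartAt_symm u).contMDiffAt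
      ((isOpen_extChartAt_target u).mem_nhds (mem_extChartAt_target u))).comp_of_eq
      contDiff_fst.contMDiff.contMDiffAt rfl
  have h4 : ContMDiffAt 𝓘(ℝ, E × E') 𝓘(ℝ, E') ∞
      (fun p : E × E' => (extChartAt 𝓘(ℝ, E') q).symm p.2)
      (extChartAt 𝓘(ℝ, E) u u, extChartAt 𝓘(ℝ, E') q q) :=
    ((contMDiffOn_extChartAt_symm q).contMDiffAt
      ((isOpen_extChartAt_target q).mem_nhds (mem_extChartAt_target q))).comp_of_eq
      contDiff_snd.contMDiff.contMDiffAt rfl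
  have h5 := (hF.contMDiffAt (hO.mem_nhds hu)).comp_of_eq (h3.prodMk h4)
    (by simp)
  exact (contMDiffAt_iff_contDiffAt.mp h5).of_le (WithTop.coe_le_coe.mpr le_top)

end Partials

/-! ### Brackets with fundamental vector fields -/

section Action

theorem mvfderiv_congr {E H : Type*} [NormedAddCommGroup E] [NormedSpace ℝ E] [TopologicalSpace H]
    {I : ModelWithCorners ℝ E H} {N : Type*} [TopologicalSpace N] [ChartedSpace H N] {f g : N → ℝ}
    {x : N} (h : f =ᶠ[nhds x] g) (v : TangentSpace I x) : mvfderiv I f x v = mvfderiv I g x v :=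
  congrArg (fun T : E →L[ℝ] ℝ => T v) (h.mfderiv_eq (I := I) (I' := 𝓘(ℝ, ℝ)))

variable {E : Type*} [NormedAddCommGroup E] [NormedSpace ℝ E] [FiniteDimensional ℝ E]
  {N : Type*} [TopologicalSpace N] [ChartedSpace E N] [IsManifold 𝓘(ℝ, E) ∞ N]
  {E' : Type*} [NormedAddCommGroup E'] [NormedSpace ℝ E'] {Q : Type*} [TopologicalSpace Q]
  [ChartedSpace E' Q] [IsManifold 𝓘(ℝ, E') ∞ Q]
  {K : Type*} [AddCommGroup K] [Module ℝ K] [FiniteDimensional ℝ K]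

/-- The Lie bracket of a fundamental vector field `Z` of an action `a` with a field `Y x` of a
family of vector fields which is permuted by the action. -/
theorem mlieBracket_fundamental {a : N × Q → N}
    (ha : ContMDiff (𝓘(ℝ, E).prod 𝓘(ℝ, E')) 𝓘(ℝ, E) ∞ a) {q : Q} (hq : ∀ w, a (w, q) = w)
    {Y : ∀ w, K →ₗ[ℝ] TangentSpace 𝓘(ℝ, E) w}
    (hY : ∀ x, ContMDiff 𝓘(ℝ, E) 𝓘(ℝ, E).tangent ∞
      (fun w => (⟨w, Y w x⟩ : TangentBundle 𝓘(ℝ, E) N)))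
    {Z : ∀ w : N, TangentSpace 𝓘(ℝ, E) w}
    (hZ : ContMDiff 𝓘(ℝ, E) 𝓘(ℝ, E).tangent ∞ (fun w => (⟨w, Z w⟩ : TangentBundle 𝓘(ℝ, E) N)))
    {A : TangentSpace 𝓘(ℝ, E') q}
    (hZA : ∀ (w : N) (f : N → ℝ), MDifferentiableAt 𝓘(ℝ, E) 𝓘(ℝ, ℝ) f w →
      mvfderiv 𝓘(ℝ, E) f w (Z w) = mvfderiv 𝓘(ℝ, E') (fun r => f (a (w, r))) q A)
    {u : N} {y : Q → K} (hy : IsSmooth 𝓘(ℝ, E') y)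
    (hpar : ∀ r, mfderiv 𝓘(ℝ, E) 𝓘(ℝ, E) (fun w => a (w, r)) u (Y u (y r)) = Y (a (u, r)) (y q)) :
    VectorField.mlieBracket 𝓘(ℝ, E) Z (fun w => Y w (y q)) u =
      Y u (differential 𝓘(ℝ, E') y q A) := by
  refine eq_of_mvfderiv_eq fun U f hU hu hf => ?_
  have hd : ∀ w ∈ U, MDifferentiableAt 𝓘(ℝ, E) 𝓘(ℝ, ℝ) f w := fun w hw =>
    (hf.contMDiffAt (hU.mem_nhds hw)).mdifferentiableAt (by simp)
  have hYf : MDifferentiableAt 𝓘(ℝ, E) 𝓘(ℝ, ℝ) (fun w => mvfderiv 𝓘(ℝ, E) f w (Y w (y q))) u :=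
    ((contMDiffOn_mvfderiv hU hf (hY (y q)).contMDiffOn fun _ h => h).contMDiffAt
      (hU.mem_nhds hu)).mdifferentiableAt (by simp)
  have hZf : MDifferentiableAt 𝓘(ℝ, E) 𝓘(ℝ, ℝ) (fun w => mvfderiv 𝓘(ℝ, E) f w (Z w)) u :=
    ((contMDiffOn_mvfderiv hU hf hZ.contMDiffOn fun _ h => h).contMDiffAt
      (hU.mem_nhds hu)).mdifferentiableAt (by simp)
  rw [mvfderiv_mlieBracket ((hZ u).mdifferentiableAt (by simp))
    ((hY (y q) u).mdifferentiableAt (by simp)) hU hu hf hZf hYf]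
  have hO : IsOpen (a ⁻¹' U) := hU.preimage ha.continuous
  have hF : ContMDiffOn (𝓘(ℝ, E).prod 𝓘(ℝ, E')) 𝓘(ℝ, ℝ) ∞ (fun p => f (a p)) (a ⁻¹' U) :=
    hf.comp ha.contMDiffOn fun _ h => h
  have huq : (u, q) ∈ a ⁻¹' U := by rw [Set.mem_preimage, hq]; exact hu
  have hOu : IsOpen {r | (u, r) ∈ a ⁻¹' U} := hO.preimage (Continuous.prodMk_right u)
  set b := Module.finBasis ℝ K
  have hexp : ∀ (x : K) (T : TangentSpace 𝓘(ℝ, E) u →L[ℝ] ℝ),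
      T (Y u x) = ∑ i, b.coord i x * T (Y u (b i)) := fun x T => by
    conv_lhs => rw [← b.sum_repr x]
    simp only [map_sum, map_smul, smul_eq_mul, Module.Basis.coord_apply]
  have hG : ∀ i, MDifferentiableAt 𝓘(ℝ, E') 𝓘(ℝ, ℝ)
      (fun r => mvfderiv 𝓘(ℝ, E) (fun w => f (a (w, r))) u (Y u (b i))) q := fun i =>
    ((contMDiffOn_partial_left hO hF u (Y u (b i))).contMDiffAt
      (hOu.mem_nhds huq)).mdifferentiableAt (by simp)
  -- Z differentiates along the orbit r ↦ a(u, r), and by `hpar` the field there is the image of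
  -- Y_u(y(r)); so Z(Y f) is one derivative in r, with r occurring both in the coefficients and in f
  -- ∘ a(·, r).
  have hfirst : mvfderiv 𝓘(ℝ, E) (fun w => mvfderiv 𝓘(ℝ, E) f w (Y w (y q))) u (Z u) =
      mvfderiv 𝓘(ℝ, E') (fun r => ∑ i, b.coord i (y r) *
        mvfderiv 𝓘(ℝ, E) (fun w => f (a (w, r))) u (Y u (b i))) q A := by
    rw [hZA u _ hYf]
    refine mvfderiv_congr ?_ A
    filter_upwards [hOu.mem_nhds huq] with r hr
    rw [← hexp, ← hpar]
    exact (mvfderiv_comp_apply (g := f) (f := fun w => a (w, r)) u (hd _ hr)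
      ((ha.comp (contMDiff_id.prodMk contMDiff_const)).mdifferentiableAt (by simp)) _).symm
  -- Commuting the partial derivatives identifies the derivative of f ∘ a(·, r) with Y(Z f), which
  -- the bracket subtracts; the derivative of the coefficients y(r) remains.
  have hsecond : ∀ i, mvfderiv 𝓘(ℝ, E')
      (fun r => mvfderiv 𝓘(ℝ, E) (fun w => f (a (w, r))) u (Y u (b i))) q A =
      mvfderiv 𝓘(ℝ, E) (fun w => mvfderiv 𝓘(ℝ, E) f w (Z w)) u (Y u (b i)) := fun i => by
    rw [mvfderiv_partial_comm (F := fun p => f (a p)) hO hF huq]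
    refine mvfderiv_congr ?_ _
    filter_upwards [hU.mem_nhds hu] with w hw
    rw [hZA w f (hd w hw)]
  have hbase : (fun w => f (a (w, q))) = f := funext fun w => by rw [hq]
  have hci : ∀ i, MDifferentiableAt 𝓘(ℝ, E') 𝓘(ℝ, ℝ) (fun r => b.coord i (y r)) q := fun i =>
    hy.mdifferentiableAt _ q
  have hmul : ∀ i, MDifferentiableAt 𝓘(ℝ, E') 𝓘(ℝ, ℝ) (fun r => b.coord i (y r) *
      mvfderiv 𝓘(ℝ, E) (fun w => f (a (w, r))) u (Y u (b i))) q := fun i => (hci i).mul (hG i)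
  rw [hfirst, mvfderiv_sum _ hmul]
  have hterm : ∀ i, mvfderiv 𝓘(ℝ, E') (fun r => b.coord i (y r) *
        mvfderiv 𝓘(ℝ, E) (fun w => f (a (w, r))) u (Y u (b i))) q A =
      b.coord i (y q) * mvfderiv 𝓘(ℝ, E) (fun w => mvfderiv 𝓘(ℝ, E) f w (Z w)) u (Y u (b i)) +
      b.coord i (differential 𝓘(ℝ, E') y q A) * mvfderiv 𝓘(ℝ, E) f u (Y u (b i)) := fun i => by
    rw [mvfderiv_fun_mul (hci i) (hG i), apply_differential hy, ← hsecond i, hbase]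
    simp only [add_apply, smul_apply, smul_eq_mul]
    ring
  rw [Finset.sum_congr rfl fun i _ => hterm i, Finset.sum_add_distrib, ← hexp, ← hexp]
  ring

end Action

/-! ### Lie groups -/

section LieGroups

variable {EG : Type*} [NormedAddCommGroup EG] [NormedSpace ℝ EG] [FiniteDimensional ℝ EG]
  {G : Type*} [TopologicalSpace G] [ChartedSpace EG G] [Group G] [LieGroup 𝓘(ℝ, EG) ∞ G]

/-- The base points are only propositionally equal, as in `Ad` and `homDeriv`, where tangent spaces
at such points are identified through the model space. -/
theorem mvfderiv_comp_of_eq' {E H : Type*} [NormedAddCommGroup E] [NormedSpace ℝ E]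
    [TopologicalSpace H] {I : ModelWithCorners ℝ E H} {N : Type*} [TopologicalSpace N]
    [ChartedSpace H N] {E' H' : Type*} [NormedAddCommGroup E'] [NormedSpace ℝ E']
    [TopologicalSpace H'] {I' : ModelWithCorners ℝ E' H'} {N' : Type*} [TopologicalSpace N']
    [ChartedSpace H' N'] {f : N' → ℝ} {a : N → N'} {x : N} {y : N'} (hy : a x = y)
    (hf : MDifferentiableAt I' 𝓘(ℝ, ℝ) f y) (ha : MDifferentiableAt I I' a x)
    (v : TangentSpace I x) :
    mvfderiv I' f y (show E' from mfderiv I I' a x v) = mvfderiv I (fun z => f (a z)) x v := by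
  subst hy
  exact (mvfderiv_comp_apply x hf ha v).symm

theorem contMDiff_conj (g : G) :
    ContMDiff 𝓘(ℝ, EG) 𝓘(ℝ, EG) ∞ (fun x : G => g * x * g⁻¹) :=
  (contMDiff_const.mul contMDiff_id).mul contMDiff_const

theorem mvfderiv_Ad {f : G → ℝ} (hf : MDifferentiableAt 𝓘(ℝ, EG) 𝓘(ℝ, ℝ) f 1) (g : G)
    (X : GroupLieAlgebra 𝓘(ℝ, EG) G) :
    mvfderiv 𝓘(ℝ, EG) f 1 (Ad g X) = mvfderiv 𝓘(ℝ, EG) (fun x => f (g * x * g⁻¹)) 1 X :=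
  mvfderiv_comp_of_eq' (by simp) hf ((contMDiff_conj g).mdifferentiableAt (by simp)) X

theorem mvfderiv_mulInvariantVectorField {f : G → ℝ} {g : G}
    (hf : MDifferentiableAt 𝓘(ℝ, EG) 𝓘(ℝ, ℝ) f g) (X : GroupLieAlgebra 𝓘(ℝ, EG) G) :
    mvfderiv 𝓘(ℝ, EG) f g (mulInvariantVectorField X g) =
      mvfderiv 𝓘(ℝ, EG) (fun x => f (g * x)) 1 X :=
  mvfderiv_comp_of_eq' (by simp) hf
    ((contMDiff_mul_left (n := ∞)).contMDiffAt.mdifferentiableAt (by simp)) X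

theorem Ad_one (X : GroupLieAlgebra 𝓘(ℝ, EG) G) : Ad (EG := EG) (1 : G) X = X :=
  eq_of_mvfderiv_eq fun U f hU h1 hf => by
    rw [mvfderiv_Ad ((hf.contMDiffAt (hU.mem_nhds h1)).mdifferentiableAt (by simp))]
    simp

theorem Ad_mul (g h : G) (X : GroupLieAlgebra 𝓘(ℝ, EG) G) :
    Ad (EG := EG) (g * h) X = Ad (EG := EG) g (Ad (EG := EG) h X) :=
  eq_of_mvfderiv_eq fun U f hU h1 hf => by
    have hd := (hf.contMDiffAt (hU.mem_nhds h1)).mdifferentiableAt (by simp)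
    rw [mvfderiv_Ad hd, mvfderiv_Ad hd, mvfderiv_Ad (f := fun x => f (g * x * g⁻¹))]
    · simp [mul_assoc]
    · exact MDifferentiableAt.comp_of_eq (g := f) 1 hd
        ((contMDiff_conj g).mdifferentiableAt (by simp)) (by simp)

theorem Ad_inv_Ad (g : G) (X : GroupLieAlgebra 𝓘(ℝ, EG) G) :
    Ad (EG := EG) g⁻¹ (Ad (EG := EG) g X) = X := by
  rw [← Ad_mul, inv_mul_cancel, Ad_one]

theorem Ad_Ad_inv (g : G) (X : GroupLieAlgebra 𝓘(ℝ, EG) G) :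
    Ad (EG := EG) g (Ad (EG := EG) g⁻¹ X) = X := by
  rw [← Ad_mul, mul_inv_cancel, Ad_one]

/-- A functional on the Lie algebra is the derivative at 1 of a local function f, so its value on
Ad(g) X is a partial derivative of f(g x g⁻¹) at x = 1. -/
theorem isSmooth_Ad_apply (X : GroupLieAlgebra 𝓘(ℝ, EG) G) :
    IsSmooth 𝓘(ℝ, EG) (fun g : G => Ad (EG := EG) g X) := by
  intro l
  obtain ⟨U, f, hU, h1, hf, hl⟩ := exists_mvfderiv_eq (E := EG) (1 : G) l
  have ha : ContMDiff (𝓘(ℝ, EG).prod 𝓘(ℝ, EG)) 𝓘(ℝ, EG) ∞ (fun p : G × G => p.2 * p.1 * p.2⁻¹) :=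
    (contMDiff_snd.mul contMDiff_fst).mul contMDiff_snd.inv
  have hO : IsOpen ((fun p : G × G => p.2 * p.1 * p.2⁻¹) ⁻¹' U) := hU.preimage ha.continuous
  have := contMDiffOn_partial_left hO (hf.comp ha.contMDiffOn fun _ h => h) 1 X
  -- Conjugation fixes 1, so a function defined only near 1 suffices for all g.
  have huniv : {g : G | ((1 : G), g) ∈ (fun p : G × G => p.2 * p.1 * p.2⁻¹) ⁻¹' U} = Set.univ := by
    ext g; simp [h1]
  rw [huniv, contMDiffOn_univ] at this
  refine this.congr fun g => ?_
  exact (hl _).symm.trans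
    (mvfderiv_Ad ((hf.contMDiffAt (hU.mem_nhds h1)).mdifferentiableAt (by simp)) g X)

/-- The value at g is the derivative of multiplication at (g, 1) on (0, X). -/
theorem contMDiff_mulInvariantVectorField_top (X : GroupLieAlgebra 𝓘(ℝ, EG) G) :
    ContMDiff 𝓘(ℝ, EG) 𝓘(ℝ, EG).tangent ∞
      (fun g : G => (⟨g, mulInvariantVectorField X g⟩ : TangentBundle 𝓘(ℝ, EG) G)) := by
  have h1 : ContMDiff 𝓘(ℝ, EG) (𝓘(ℝ, EG).tangent.prod 𝓘(ℝ, EG).tangent) ∞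
      (fun g : G => ((⟨g, 0⟩ : TangentBundle 𝓘(ℝ, EG) G), (⟨1, X⟩ : TangentBundle 𝓘(ℝ, EG) G))) :=
    (Bundle.contMDiff_zeroSection ℝ _).prodMk contMDiff_const
  have h2 := (contMDiff_equivTangentBundleProd_symm (n := ∞)).comp h1
  have h3 := ((contMDiff_mul 𝓘(ℝ, EG) ∞ (G := G)).contMDiff_tangentMap (m := ∞) (by simp)).comp h2
  refine h3.congr fun g => ?_
  have h4 : MDifferentiableAt (𝓘(ℝ, EG).prod 𝓘(ℝ, EG)) 𝓘(ℝ, EG) (fun p : G × G => p.1 * p.2) (g, 1) :=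
    (contMDiff_mul 𝓘(ℝ, EG) ∞).mdifferentiableAt (by simp)
  have h5 := mfderiv_comp_apply (f := fun r : G => (g, r)) 1 h4
    (mdifferentiableAt_const.prodMk mdifferentiableAt_id) X
  have h6 : mfderiv 𝓘(ℝ, EG) (𝓘(ℝ, EG).prod 𝓘(ℝ, EG)) (fun r : G => (g, r)) 1 X =
    ((0, X) : EG × EG) := by rw [mfderiv_prod_right]; rfl
  rw [h6] at h5
  have h7 : ∀ (a b : G) (v w : EG), a = b → v = w →
      (⟨a, v⟩ : TangentBundle 𝓘(ℝ, EG) G) = ⟨b, w⟩ := by rintro a b v w rfl rfl; rfl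
  exact h7 _ _ _ _ (mul_one g).symm h5

/-- The left invariant vector fields as a linear family. -/
def invariantField (g : G) : GroupLieAlgebra 𝓘(ℝ, EG) G →ₗ[ℝ] TangentSpace 𝓘(ℝ, EG) g where
  toFun X := mulInvariantVectorField X g
  map_add' X Y := congrFun (mulInvariantVectorField_add X Y) g
  map_smul' c X := congrFun (mulInvariantVectorField_smul c X) g

/-- The derivative of the adjoint representation is the bracket. -/
theorem differential_Ad_apply (A X : GroupLieAlgebra 𝓘(ℝ, EG) G) :
    differential 𝓘(ℝ, EG) (fun g : G => Ad (EG := EG) g X) 1 A = ⁅A, X⁆ := by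
  have hY : ∀ X : GroupLieAlgebra 𝓘(ℝ, EG) G, ContMDiff 𝓘(ℝ, EG) 𝓘(ℝ, EG).tangent ∞
      (fun g : G => (⟨g, invariantField g X⟩ : TangentBundle 𝓘(ℝ, EG) G)) :=
    contMDiff_mulInvariantVectorField_top
  -- For right multiplication of G on itself, left invariant fields are the fundamental fields, and
  -- right translation by r carries Ad(r) X at 1 to the invariant field of X at r.
  have h := mlieBracket_fundamental (a := fun p : G × G => p.1 * p.2) (contMDiff_mul 𝓘(ℝ, EG) ∞)
    (q := 1) mul_one hY (hY A) (A := A)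
    (fun w f hf => mvfderiv_mulInvariantVectorField hf A) (u := 1) (isSmooth_Ad_apply X)
    (fun r => eq_of_mvfderiv_eq fun U f hU hr hf => by
      have hd : MDifferentiableAt 𝓘(ℝ, EG) 𝓘(ℝ, ℝ) f (1 * r) :=
        (hf.contMDiffAt (hU.mem_nhds hr)).mdifferentiableAt (by simp)
      have h1 : MDifferentiableAt 𝓘(ℝ, EG) 𝓘(ℝ, EG) (fun w : G => w * r) 1 :=
        (contMDiff_mul_right (n := ∞)).mdifferentiableAt (by simp)
      have h2 : MDifferentiableAt 𝓘(ℝ, EG) 𝓘(ℝ, ℝ) (fun w : G => f (w * r)) 1 := hd.comp 1 h1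
      have h3 : MDifferentiableAt 𝓘(ℝ, EG) 𝓘(ℝ, ℝ) (fun w : G => f (1 * w * r)) 1 := by
        simpa only [one_mul] using h2
      refine (mvfderiv_comp_of_eq' (a := fun w : G => w * r) (x := 1) rfl hd h1 _).trans ?_
      refine (mvfderiv_mulInvariantVectorField h2 _).trans ((mvfderiv_Ad h3 r X).trans ?_)
      refine Eq.trans ?_ (mvfderiv_mulInvariantVectorField hd _).symm
      simp [mul_assoc, Ad_one])
  have h1 : ∀ X : GroupLieAlgebra 𝓘(ℝ, EG) G, invariantField (1 : G) X = X := fun X =>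
    eq_of_mvfderiv_eq fun U f hU hr hf => by
      refine (mvfderiv_mulInvariantVectorField
        ((hf.contMDiffAt (hU.mem_nhds hr)).mdifferentiableAt (by simp)) _).trans ?_
      simp
  rw [h1, Ad_one] at h
  exact h.symm

theorem differential_conj {W : Type*} [AddCommGroup W] [Module ℝ W] [FiniteDimensional ℝ W]
    {f : G → W} (hf : IsSmooth 𝓘(ℝ, EG) f) (g : G) (X : GroupLieAlgebra 𝓘(ℝ, EG) G) :
    differential 𝓘(ℝ, EG) (fun h => f (g * h * g⁻¹)) 1 X =
      differential 𝓘(ℝ, EG) f 1 (Ad (EG := EG) g X) :=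
  differential_eq (hf.comp (contMDiff_conj g)) fun l => by
    rw [apply_differential hf, mvfderiv_Ad (hf.mdifferentiableAt l 1)]

/-- Differentiate Ad(g) Ad(h) = Ad(g h g⁻¹) Ad(g) in h at 1. -/
theorem Ad_lie (g : G) (X Y : GroupLieAlgebra 𝓘(ℝ, EG) G) :
    Ad (EG := EG) g ⁅X, Y⁆ = ⁅Ad (EG := EG) g X, Ad (EG := EG) g Y⁆ := by
  rw [← differential_Ad_apply, ← differential_Ad_apply, ← differential_linear (isSmooth_Ad_apply Y),
    ← differential_conj (isSmooth_Ad_apply _)]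
  have h : (fun h : G => Ad (EG := EG) g (Ad (EG := EG) h Y)) =
      fun h => Ad (EG := EG) (g * h * g⁻¹) (Ad (EG := EG) g Y) := by
    funext h
    rw [← Ad_mul, ← Ad_mul]
    simp [mul_assoc]
  rw [h]

/-- The adjoint action by an element of the group as an automorphism of the Lie algebra. -/
def AdEquiv (g : G) : GroupLieAlgebra 𝓘(ℝ, EG) G ≃ₗ⁅ℝ⁆ GroupLieAlgebra 𝓘(ℝ, EG) G where
  toFun := Ad (EG := EG) g
  map_add' := map_add _
  map_smul' := map_smul _
  map_lie' := Ad_lie g _ _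
  invFun := Ad (EG := EG) g⁻¹
  left_inv := Ad_inv_Ad g
  right_inv := Ad_Ad_inv g

theorem killingForm_Ad (g : G) (X Y : GroupLieAlgebra 𝓘(ℝ, EG) G) :
    killingForm ℝ _ (Ad (EG := EG) g X) (Ad (EG := EG) g Y) = killingForm ℝ _ X Y :=
  LieAlgebra.killingForm_of_equiv_apply (AdEquiv g) X Y

section Representation

variable {V : Type*} [AddCommGroup V] [Module ℝ V] [FiniteDimensional ℝ V]
  {ρ : Representation ℝ G V} (hρ : IsSmooth 𝓘(ℝ, EG) (fun g : G => (ρ g : Module.End ℝ V)))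

include hρ in
theorem infRep_Ad (g : G) (X : GroupLieAlgebra 𝓘(ℝ, EG) G) :
    ρ g * infRep ρ X = infRep ρ (Ad (EG := EG) g X) * ρ g := by
  have h : ρ g * infRep ρ X * ρ g⁻¹ = infRep ρ (Ad (EG := EG) g X) := by
    have h1 := differential_linear hρ (LinearMap.mulRight ℝ (ρ g⁻¹) ∘ₗ LinearMap.mulLeft ℝ (ρ g)) 1 X
    have h2 := differential_conj hρ g X
    have h3 : (fun h : G => (ρ (g * h * g⁻¹) : Module.End ℝ V)) = fun h =>
        (LinearMap.mulRight ℝ (ρ g⁻¹) ∘ₗ LinearMap.mulLeft ℝ (ρ g)) (ρ h) := by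
      funext h
      rw [map_mul, map_mul]
      rfl
    rw [h3] at h2
    exact h1.symm.trans h2
  rw [← h, mul_assoc, ← map_mul, inv_mul_cancel, map_one, mul_one]

include hρ in
-- Differentiate the intertwining relation `infRep_Ad` at 1, using that the derivative of Ad is ad.
theorem infRep_lie (X Y : GroupLieAlgebra 𝓘(ℝ, EG) G) :
    infRep ρ ⁅X, Y⁆ = infRep ρ X * infRep ρ Y - infRep ρ Y * infRep ρ X := by
  have h1 := differential_linear hρ (LinearMap.mulRight ℝ (infRep ρ Y)) 1 X
  have h2 : ∀ g : G, LinearMap.mulRight ℝ (infRep ρ Y) (ρ g) =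
      LinearMap.mul ℝ (Module.End ℝ V) (infRep ρ (Ad (EG := EG) g Y)) (ρ g) := fun g => infRep_Ad hρ g Y
  simp_rw [h2] at h1
  rw [differential_bilinear _ ((isSmooth_Ad_apply Y).linear (infRep ρ)) hρ,
    differential_linear (isSmooth_Ad_apply Y), differential_Ad_apply, Ad_one, map_one] at h1
  exact eq_sub_of_add_eq h1

end Representation

end LieGroups

/-! ### Functoriality of the Fock space -/

section FockFunctoriality

variable {V : Type*} [AddCommGroup V] [Module ℝ V] {L : Type*} [AddCommGroup L] [Module ℝ L]

theorem fock_induction {p : FockSpace V L → Prop} (one : ∀ v : V, p (v ⊗ₜ 1))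
    (add : ∀ x y, p x → p y → p (x + y)) (create : ∀ x w, p w → p (createOp V x w))
    (w : FockSpace V L) : p w := by
  have zero : p 0 := by simpa using one 0
  induction w using TensorProduct.induction_on with
  | zero => exact zero
  | add x y hx hy => exact add x y hx hy
  | tmul v a =>
    induction a using CliffordAlgebra.left_induction with
    | algebraMap r =>
      rw [Algebra.algebraMap_eq_smul_one, TensorProduct.tmul_smul, TensorProduct.smul_tmul']
      exact one _
    | add a b ha hb => rw [TensorProduct.tmul_add]; exact add _ _ ha hb
    | ι_mul a x ha => exact create x _ ha

/-- The map on the Fock space induced by linear maps of `V` and `L`. -/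
def fockMap (r : Module.End ℝ V) (a : L →ₗ[ℝ] L) : Module.End ℝ (FockSpace V L) :=
  TensorProduct.map r (ExteriorAlgebra.map a).toLinearMap

theorem fockMap_tmul (r : Module.End ℝ V) (a : L →ₗ[ℝ] L) (v : V) (b : ExteriorAlgebra ℝ L) :
    fockMap r a (v ⊗ₜ b) = r v ⊗ₜ ExteriorAlgebra.map a b := rfl

theorem fockMap_createOp (r : Module.End ℝ V) (a : L →ₗ[ℝ] L) (x : L) :
    fockMap r a * createOp V x = createOp V (a x) * fockMap r a := by
  refine TensorProduct.ext' fun v b => ?_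
  simp only [Module.End.mul_apply, createOp_tmul, fockMap_tmul, map_mul,
    ExteriorAlgebra.map_apply_ι]

theorem fockMap_annihilateOp {B : LinearMap.BilinForm ℝ L} (r : Module.End ℝ V) {a : L →ₗ[ℝ] L}
    (ha : ∀ x y, B (a x) (a y) = B x y) (x : L) :
    fockMap r a * annihilateOp V B x = annihilateOp V B (a x) * fockMap r a := by
  refine TensorProduct.ext' fun v b => ?_
  simp only [Module.End.mul_apply, annihilateOp_tmul, fockMap_tmul]
  congr 1
  induction b using CliffordAlgebra.left_induction with
  | algebraMap c =>
    rw [CliffordAlgebra.contractLeft_algebraMap, map_zero, AlgHom.commutes]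
    exact (CliffordAlgebra.contractLeft_algebraMap _ _ _).symm
  | add b c hb hc => rw [map_add, map_add, map_add, map_add, hb, hc]
  | ι_mul b x ih =>
    rw [CliffordAlgebra.contractLeft_ι_mul, map_sub, map_smul, map_mul, ih, map_mul]
    change _ = CliffordAlgebra.contractLeft _ (ExteriorAlgebra.map a (ExteriorAlgebra.ι ℝ x) * _)
    change _ - ExteriorAlgebra.map a (ExteriorAlgebra.ι ℝ x) * _ = _
    rw [ExteriorAlgebra.map_apply_ι, ExteriorAlgebra.ι, CliffordAlgebra.contractLeft_ι_mul, ha]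

theorem fockMap_actOp (r : Module.End ℝ V) (a : L →ₗ[ℝ] L) {θ : L →ₗ[ℝ] Module.End ℝ V}
    (hθ : ∀ x, r * θ x = θ (a x) * r) (x : L) :
    fockMap r a * actOp θ x = actOp θ (a x) * fockMap r a := by
  refine TensorProduct.ext' fun v b => ?_
  simp only [Module.End.mul_apply, actOp_tmul, fockMap_tmul]
  rw [← Module.End.mul_apply, hθ, Module.End.mul_apply]

theorem fockMap_fockIncl {P : Type*} [AddCommGroup P] [Module ℝ P] (r : Module.End ℝ V)
    {a : L →ₗ[ℝ] L} {f : P →ₗ[ℝ] L} {c : P →ₗ[ℝ] P} (h : ∀ z, a (f z) = f (c z)) {k : ℕ}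
    (w : V ⊗[ℝ] (⋀[ℝ]^k P)) :
    fockMap r a (fockIncl f k w) =
      fockIncl f k (TensorProduct.map r (exteriorPower.map k c) w) := by
  induction w using forms_induction with
  | tmul v Z =>
    rw [TensorProduct.map_tmul, exteriorPower.map_apply_ιMulti, fockIncl_tmul, fockIncl_tmul, wedge,
      fockMap_tmul, ExteriorAlgebra.map_apply_ιMulti, wedge]
    simp only [Function.comp_def, h]
  | add x y hx hy => simp only [map_add, hx, hy]

end FockFunctoriality

/-! ### The group action on the Fock space and its derivative -/

section LieGroups

variable {EG : Type*} [NormedAddCommGroup EG] [NormedSpace ℝ EG] [FiniteDimensional ℝ EG]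
  {G : Type*} [TopologicalSpace G] [ChartedSpace EG G] [Group G] [LieGroup 𝓘(ℝ, EG) ∞ G]
  [LieAlgebra.IsSemisimple ℝ (GroupLieAlgebra 𝓘(ℝ, EG) G)]
  {V : Type*} [AddCommGroup V] [Module ℝ V] [FiniteDimensional ℝ V]
  {ρ : Representation ℝ G V} (hρ : IsSmooth 𝓘(ℝ, EG) (fun g : G => (ρ g : Module.End ℝ V)))

/-- The action of the group on the Fock space. -/
abbrev groupAct (ρ : Representation ℝ G V) (g : G) :
    Module.End ℝ (FockSpace V (GroupLieAlgebra 𝓘(ℝ, EG) G)) :=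
  fockMap (ρ g) (Ad (EG := EG) g)

theorem groupAct_createOp (g : G) (x : GroupLieAlgebra 𝓘(ℝ, EG) G) :
    groupAct ρ g * createOp V x = createOp V (Ad (EG := EG) g x) * groupAct ρ g :=
  fockMap_createOp _ _ _

theorem groupAct_annihilate (g : G) (x : GroupLieAlgebra 𝓘(ℝ, EG) G) :
    groupAct ρ g * annihilate V x = annihilate V (Ad (EG := EG) g x) * groupAct ρ g :=
  fockMap_annihilateOp _ (killingForm_Ad g) _

theorem killingForm_Ad_left (g : G) (x y : GroupLieAlgebra 𝓘(ℝ, EG) G) :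
    killingForm ℝ _ (Ad (EG := EG) g x) y = killingForm ℝ _ x (Ad (EG := EG) g⁻¹ y) := by
  rw [← killingForm_Ad g x, Ad_Ad_inv]

include hρ in
theorem groupAct_actOp (g : G) (x : GroupLieAlgebra 𝓘(ℝ, EG) G) :
    groupAct ρ g * actOp (infRep ρ) x = actOp (infRep ρ) (Ad (EG := EG) g x) * groupAct ρ g :=
  fockMap_actOp _ _ (fun x => infRep_Ad hρ g x) x

include hρ in
theorem groupAct_codiff (g : G) (w : FockSpace V (GroupLieAlgebra 𝓘(ℝ, EG) G)) :
    groupAct ρ g (codiff (L := GroupLieAlgebra 𝓘(ℝ, EG) G) (infRep ρ) w) =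
      codiff (L := GroupLieAlgebra 𝓘(ℝ, EG) G) (infRep ρ) (groupAct ρ g w) := by
  have h1 := groupAct_actOp hρ g
  have h := FockRelations.conj_homolOp (L := GroupLieAlgebra 𝓘(ℝ, EG) G) (a := Ad (EG := EG) g)
    (ε := createOp V) (ι := annihilate V) (u := groupAct ρ g)
    (θ := actOp (infRep ρ)) isDualPair_killingForm
    (killingForm_Ad_left g) (Ad_Ad_inv g) (groupAct_createOp (ρ := ρ) g)
    (groupAct_annihilate (ρ := ρ) g) h1 (Ad_lie g)
  exact LinearMap.congr_fun h w

theorem groupAct_insert (g : G) {K K' : GroupLieAlgebra 𝓘(ℝ, EG) G →ₗ[ℝ]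
      GroupLieAlgebra 𝓘(ℝ, EG) G →ₗ[ℝ] GroupLieAlgebra 𝓘(ℝ, EG) G}
    (hK : ∀ x y, Ad (EG := EG) g (K x y) = K' (Ad (EG := EG) g x) (Ad (EG := EG) g y))
    (w : FockSpace V (GroupLieAlgebra 𝓘(ℝ, EG) G)) :
    groupAct ρ g (insert V K w) = insert V K' (groupAct ρ g w) :=
  LinearMap.congr_fun (FockRelations.conj_insertOp isDualPair_killingForm (killingForm_Ad_left g)
    (Ad_Ad_inv g) (groupAct_createOp (ρ := ρ) g) (groupAct_annihilate g) K K' hK) w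

theorem groupAct_one (w : FockSpace V (GroupLieAlgebra 𝓘(ℝ, EG) G)) :
    groupAct ρ 1 w = w := by
  have h : Ad (EG := EG) (1 : G) = LinearMap.id := LinearMap.ext Ad_one
  rw [groupAct, fockMap, h, map_one, ExteriorAlgebra.map_id]
  exact LinearMap.congr_fun TensorProduct.map_id w

include hρ in
-- Induction on creation operators: the product rule for Ad(g) x acting on g · w matches the
-- commutation relation of the total action with creation operators.
theorem groupAct_smooth (w : FockSpace V (GroupLieAlgebra 𝓘(ℝ, EG) G)) :
    IsSmooth 𝓘(ℝ, EG) (fun g => groupAct ρ g w) ∧ ∀ X, differential 𝓘(ℝ, EG)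
      (fun g => groupAct ρ g w) 1 X = totalAct (infRep ρ) X w := by
  have hF := fock (infRep_lie hρ)
  induction w using fock_induction with
  | one v =>
    have h1 : IsSmooth 𝓘(ℝ, EG) (fun g : G => ρ g v) := IsSmooth.apply hρ v
    let T : V →ₗ[ℝ] FockSpace V (GroupLieAlgebra 𝓘(ℝ, EG) G) :=
      (TensorProduct.mk ℝ V (ExteriorAlgebra ℝ (GroupLieAlgebra 𝓘(ℝ, EG) G))).flip 1
    have h2 : (fun g : G => groupAct (EG := EG) ρ g (v ⊗ₜ 1)) = fun g => T (ρ g v) := by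
      funext g
      rw [groupAct, fockMap_tmul, map_one]
      rfl
    rw [h2]
    refine ⟨h1.linear T, fun X => ?_⟩
    rw [differential_linear h1 T, differential_apply hρ]
    have h3 : ∀ x, annihilate V x (v ⊗ₜ[ℝ] (1 : ExteriorAlgebra ℝ (GroupLieAlgebra 𝓘(ℝ, EG) G))) =
        0 := fun x => by
      rw [annihilateOp_tmul, CliffordAlgebra.contractLeft_one, TensorProduct.tmul_zero]
    simp only [totalAct, FockRelations.lieOp_apply, FockRelations.adOp_apply, LinearMap.add_apply,
      LinearMap.sum_apply, Module.End.mul_apply, h3, map_zero, Finset.sum_const_zero, add_zero]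
    rfl
  | add x y hx hy =>
    simp only [map_add]
    refine ⟨hx.1.add hy.1, fun X => ?_⟩
    rw [differential_add hx.1 hy.1, hx.2, hy.2]
  | create x w ih =>
    have h1 : (fun g : G => groupAct (EG := EG) ρ g (createOp V x w)) =
        fun g => createOp V (Ad (EG := EG) g x) (groupAct ρ g w) := funext fun g =>
      LinearMap.congr_fun (groupAct_createOp g x) w
    rw [h1]
    refine ⟨IsSmooth.bilinear _ (isSmooth_Ad_apply x) ih.1, fun X => ?_⟩
    rw [differential_bilinear _ (isSmooth_Ad_apply x) ih.1, ih.2, Ad_one, groupAct_one,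
      differential_Ad_apply]
    have h2 := LinearMap.congr_fun (FockRelations.lieOp_create isDualPair_killingForm hF X x) w
    rw [← h2]
    simp only [LinearMap.sub_apply, Module.End.mul_apply]
    abel

include hρ in
theorem isSmooth_groupAct : IsSmooth 𝓘(ℝ, EG) (fun g : G => groupAct (EG := EG) ρ g) :=
  isSmooth_hom fun w => (groupAct_smooth hρ w).1

include hρ in
theorem differential_groupAct (X : GroupLieAlgebra 𝓘(ℝ, EG) G) :
    differential 𝓘(ℝ, EG) (fun g : G => groupAct (EG := EG) ρ g) 1 X = totalAct (infRep ρ) X :=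
  LinearMap.ext fun w => by
    rw [← differential_apply (isSmooth_groupAct hρ), (groupAct_smooth hρ w).2]

end LieGroups

/-! ### Constant vector fields -/

section Coframe

variable {E : Type*} [NormedAddCommGroup E] [NormedSpace ℝ E] [FiniteDimensional ℝ E]
  {N : Type*} [TopologicalSpace N] [ChartedSpace E N] [IsManifold 𝓘(ℝ, E) ∞ N]
  {K : Type*} [NormedAddCommGroup K] [NormedSpace ℝ K] [FiniteDimensional ℝ K]

theorem contMDiffAt_of_forall_dual {E' : Type*} [NormedAddCommGroup E'] [NormedSpace ℝ E']
    [FiniteDimensional ℝ E'] {A : N → E' →L[ℝ] K} {x : N}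
    (h : ∀ (l : Module.Dual ℝ K) (v : E'), ContMDiffAt 𝓘(ℝ, E) 𝓘(ℝ, ℝ) ∞ (fun u => l (A u v)) x) :
    ContMDiffAt 𝓘(ℝ, E) 𝓘(ℝ, E' →L[ℝ] K) ∞ A x := by
  have hA : A = fun u => ∑ i, ∑ j, ((Module.finBasis ℝ K).coord j) (A u (Module.finBasis ℝ E' i)) •
      LinearMap.toContinuousLinearMap (((Module.finBasis ℝ E').coord i).smulRight
        (Module.finBasis ℝ K j)) := by
    funext u
    ext v
    simp only [sum_apply, smul_apply,
      LinearMap.coe_toContinuousLinearMap', LinearMap.smulRight_apply]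
    conv_lhs => rw [← (Module.finBasis ℝ E').sum_repr v]
    rw [map_sum]
    refine Finset.sum_congr rfl fun i _ => ?_
    rw [map_smul]
    conv_lhs => rw [← (Module.finBasis ℝ K).sum_repr (A u (Module.finBasis ℝ E' i)),
      Finset.smul_sum]
    exact Finset.sum_congr rfl fun j _ => smul_comm _ _ _
  rw [hA]
  exact contMDiffAt_finsetSum fun i _ => contMDiffAt_finsetSum fun j _ =>
    (h _ _).smul contMDiffAt_const

/-- A vector field with constant components with respect to a smooth coframe is smooth. -/
theorem contMDiff_of_coframe {τ : ∀ u : N, TangentSpace 𝓘(ℝ, E) u →ₗ[ℝ] K}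
    (hτ : IsSmooth 𝓘(ℝ, E).tangent (fun v : TangentBundle 𝓘(ℝ, E) N => τ v.1 v.2))
    (hb : ∀ u, Function.Bijective (τ u)) {Y : ∀ u : N, TangentSpace 𝓘(ℝ, E) u} {X : K}
    (hY : ∀ u, τ u (Y u) = X) :
    ContMDiff 𝓘(ℝ, E) 𝓘(ℝ, E).tangent ∞ (fun u => (⟨u, Y u⟩ : TangentBundle 𝓘(ℝ, E) N)) := by
  intro x
  set e := trivializationAt E (TangentSpace 𝓘(ℝ, E) : N → Type _) x with he
  have hx : x ∈ e.baseSet := FiberBundle.mem_baseSet_trivializationAt' x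
  let T : ∀ u, E →ₗ[ℝ] K := fun u => τ u ∘ₗ (e.symmL ℝ u).toLinearMap
  have hT : ∀ u ∈ e.baseSet, Function.Bijective (T u) := fun u hu =>
    (hb u).comp (Function.bijective_iff_has_inverse.mpr ⟨e.continuousLinearMapAt ℝ u,
      e.continuousLinearMapAt_symmL hu, e.symmL_continuousLinearMapAt hu⟩)
  have hsec : ∀ v : E, ContMDiffOn 𝓘(ℝ, E) 𝓘(ℝ, E).tangent ∞
      (fun u => (⟨u, e.symmL ℝ u v⟩ : TangentBundle 𝓘(ℝ, E) N)) e.baseSet := fun v => by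
    have h1 := (e.contMDiffOn_symm (IB := 𝓘(ℝ, E)) (n := ∞)).comp
      (contMDiffOn_id.prodMk (contMDiffOn_const (c := v)) :
        ContMDiffOn 𝓘(ℝ, E) (𝓘(ℝ, E).prod 𝓘(ℝ, E)) ∞ (fun u : N => (u, v)) e.baseSet)
      (fun u hu => e.mk_mem_target.mpr hu)
    refine h1.congr fun u hu => ?_
    exact (congrArg (Bundle.TotalSpace.mk u) (e.symmL_apply hu v)).trans (e.mk_symm hu v)
  have hA : ContMDiffAt 𝓘(ℝ, E) 𝓘(ℝ, E →L[ℝ] K) ∞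
      (fun u => LinearMap.toContinuousLinearMap (T u)) x :=
    contMDiffAt_of_forall_dual fun l v =>
      ((hτ l).comp_contMDiffOn (hsec v)).contMDiffAt (e.open_baseSet.mem_nhds hx)
  have hequiv : ∀ u ∈ e.baseSet, ∃ L : E ≃L[ℝ] K,
      (L : E →L[ℝ] K) = LinearMap.toContinuousLinearMap (T u) := fun u hu =>
    ⟨(LinearEquiv.ofBijective (T u) (hT u hu)).toContinuousLinearEquiv, rfl⟩
  -- In a trivialization the coframe is a smooth family of invertible linear maps, and inversion is
  -- smooth there.
  have hinv : ContMDiffAt 𝓘(ℝ, E) 𝓘(ℝ, E) ∞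
      (fun u => ContinuousLinearMap.inverse (LinearMap.toContinuousLinearMap (T u)) X) x := by
    obtain ⟨L, hL⟩ := hequiv x hx
    have h1 := contDiffAt_map_inverse (n := ∞) L
    rw [hL] at h1
    exact (h1.contMDiffAt.comp x hA).clm_apply contMDiffAt_const
  refine (Bundle.contMDiffAt_section x).mpr (hinv.congr_of_eventuallyEq ?_)
  filter_upwards [e.open_baseSet.mem_nhds hx] with u hu
  obtain ⟨L, hL⟩ := hequiv u hu
  have h2 : Y u = e.symmL ℝ u (ContinuousLinearMap.inverse
      (LinearMap.toContinuousLinearMap (T u)) X) := (hb u).1 <| by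
    rw [hY]
    rw [← hL, ContinuousLinearMap.inverse_equiv]
    exact ((congrArg (fun S : E →L[ℝ] K => S (L.symm X)) hL).symm.trans (L.apply_symm_apply X)).symm
  rw [← he, h2, e.symmL_apply hu]
  exact congrArg Prod.snd (e.apply_mk_symm hu _)

end Coframe

/-! ### Cartan geometries -/

section Geometry

variable {EG : Type*} [NormedAddCommGroup EG] [NormedSpace ℝ EG] [FiniteDimensional ℝ EG]
  {G : Type*} [TopologicalSpace G] [ChartedSpace EG G] [Group G] [LieGroup 𝓘(ℝ, EG) ∞ G]
  {Γ : Grading (GroupLieAlgebra 𝓘(ℝ, EG) G)}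
  {EP : Type*} [NormedAddCommGroup EP] [NormedSpace ℝ EP] [FiniteDimensional ℝ EP]
  {P : Type*} [TopologicalSpace P] [ChartedSpace EP P] [Group P] [LieGroup 𝓘(ℝ, EP) ∞ P]
  {S : ParabolicSubgroup (EP := EP) P Γ}

instance {E : Type*} [NormedAddCommGroup E] [NormedSpace ℝ E] {N : Type*} [TopologicalSpace N]
    [ChartedSpace E N] [IsManifold 𝓘(ℝ, E) ∞ N] : IsManifold 𝓘(ℝ, E) (minSmoothness ℝ 2) N := by
  rw [minSmoothness_of_isRCLikeNormedField]
  infer_instance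

theorem ParabolicSubgroup.differential_comp_incl (S : ParabolicSubgroup (EP := EP) P Γ) {W : Type*}
    [AddCommGroup W] [Module ℝ W] [FiniteDimensional ℝ W] {f : G → W} (hf : IsSmooth 𝓘(ℝ, EG) f)
    (A : GroupLieAlgebra 𝓘(ℝ, EP) P) :
    differential 𝓘(ℝ, EP) (fun r => f (S.incl r)) 1 A =
      differential 𝓘(ℝ, EG) f 1 (homDeriv (EG := EG) S.incl A) :=
  differential_eq (hf.comp S.contMDiff_incl) fun l => by
    rw [apply_differential hf]
    exact mvfderiv_comp_of_eq' (map_one S.incl) (hf.mdifferentiableAt l 1)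
      (S.contMDiff_incl.mdifferentiableAt (by simp)) A

variable {EM : Type*} [NormedAddCommGroup EM] [NormedSpace ℝ EM] [FiniteDimensional ℝ EM]
  {M : Type*} [TopologicalSpace M] [ChartedSpace EM M] [IsManifold 𝓘(ℝ, EM) ∞ M]
  {EB : Type*} [NormedAddCommGroup EB] [NormedSpace ℝ EB] [FiniteDimensional ℝ EB]
  {B : Type*} [TopologicalSpace B] [ChartedSpace EB B] [IsManifold 𝓘(ℝ, EB) ∞ B]
  (C : CartanGeometry (EM := EM) (EB := EB) M B S)

namespace CartanGeometry

theorem conn_connInv (u : B) (X : GroupLieAlgebra 𝓘(ℝ, EG) G) : C.conn u (C.connInv u X) = X :=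
  (LinearEquiv.ofBijective (C.conn u) (C.bijective_conn u)).apply_symm_apply X

theorem connInv_eq {u : B} {X : GroupLieAlgebra 𝓘(ℝ, EG) G} {v : TangentSpace 𝓘(ℝ, EB) u}
    (h : C.conn u v = X) : C.connInv u X = v :=
  (C.bijective_conn u).1 ((C.conn_connInv u X).trans h.symm)

theorem contMDiff_connInv (X : GroupLieAlgebra 𝓘(ℝ, EG) G) :
    ContMDiff 𝓘(ℝ, EB) 𝓘(ℝ, EB).tangent ∞
      (fun u => (⟨u, C.connInv u X⟩ : TangentBundle 𝓘(ℝ, EB) B)) :=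
  contMDiff_of_coframe (K := EG) C.isSmooth_conn C.bijective_conn fun u => C.conn_connInv u X

theorem mdifferentiableAt_connInv (X : GroupLieAlgebra 𝓘(ℝ, EG) G) (u : B) :
    MDifferentiableAt 𝓘(ℝ, EB) 𝓘(ℝ, EB).tangent
      (fun u => (⟨u, C.connInv u X⟩ : TangentBundle 𝓘(ℝ, EB) B)) u :=
  (C.contMDiff_connInv X u).mdifferentiableAt (by simp)

theorem contMDiff_act_left (p : P) : ContMDiff 𝓘(ℝ, EB) 𝓘(ℝ, EB) ∞ (fun u => C.act u p) :=
  C.contMDiff_act.comp (contMDiff_id.prodMk contMDiff_const)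

theorem contMDiff_act_right (u : B) : ContMDiff 𝓘(ℝ, EP) 𝓘(ℝ, EB) ∞ (C.act u) :=
  C.contMDiff_act.comp (contMDiff_const.prodMk contMDiff_id)

theorem mvfderiv_fundamental {f : B → ℝ} {u : B} (hf : MDifferentiableAt 𝓘(ℝ, EB) 𝓘(ℝ, ℝ) f u)
    (A : GroupLieAlgebra 𝓘(ℝ, EP) P) :
    mvfderiv 𝓘(ℝ, EB) f u (C.connInv u (homDeriv (EG := EG) S.incl A)) =
      mvfderiv 𝓘(ℝ, EP) (fun r => f (C.act u r)) 1 A := by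
  -- `fundamental_conn` is stated at the point act u 1, so it has to be transported to u.
  have h : ∀ (w : B) (hw : w = u) (v : EB), C.conn w v = homDeriv (EG := EG) S.incl A →
      C.connInv u (homDeriv (EG := EG) S.incl A) = v := by
    rintro w rfl v hv
    exact C.connInv_eq hv
  have h1 := h _ (C.act_one u) _ (C.fundamental_conn u A)
  refine Eq.trans (congrArg (fun v : EB => mvfderiv 𝓘(ℝ, EB) f u v) h1) ?_
  exact mvfderiv_comp_of_eq' (C.act_one u) hf
    ((C.contMDiff_act_right u).mdifferentiableAt (by simp)) A

/-- Equivariance of the connection, read as: right translations permute the constant vector fields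
through Ad. This is the form required by `mlieBracket_fundamental`. -/
theorem mfderiv_act_connInv (u : B) (p : P) (X : GroupLieAlgebra 𝓘(ℝ, EG) G) :
    mfderiv 𝓘(ℝ, EB) 𝓘(ℝ, EB) (fun w => C.act w p) u (C.connInv u (Ad (EG := EG) (S.incl p) X)) =
      C.connInv (C.act u p) X := by
  refine (C.connInv_eq ?_).symm
  rw [C.equivariant_conn, C.conn_connInv, map_inv, Ad_inv_Ad]

section Functions

variable {W : Type*} [AddCommGroup W] [Module ℝ W] [FiniteDimensional ℝ W] {φ : B → W}

theorem isSmooth_fundDeriv_apply (hφ : IsSmooth 𝓘(ℝ, EB) φ) (X : GroupLieAlgebra 𝓘(ℝ, EG) G) :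
    IsSmooth 𝓘(ℝ, EB) (fun u => C.fundDeriv φ u X) := fun l => by
  refine (contMDiff_mvfderiv (hφ l) (C.contMDiff_connInv X)).congr fun u => ?_
  exact apply_differential hφ l u _

theorem isSmooth_fundDeriv (hφ : IsSmooth 𝓘(ℝ, EB) φ) : IsSmooth 𝓘(ℝ, EB) (C.fundDeriv φ) :=
  isSmooth_hom (C.isSmooth_fundDeriv_apply hφ)

theorem fundDeriv_linear {W' : Type*} [AddCommGroup W'] [Module ℝ W'] [FiniteDimensional ℝ W']
    (hφ : IsSmooth 𝓘(ℝ, EB) φ) (T : W →ₗ[ℝ] W') (u : B) :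
    C.fundDeriv (fun w => T (φ w)) u = T ∘ₗ C.fundDeriv φ u :=
  LinearMap.ext fun X => differential_linear hφ T u (C.connInv u X)

theorem fundDeriv_apply {W' : Type*} [AddCommGroup W'] [Module ℝ W'] [FiniteDimensional ℝ W']
    {φ : B → W →ₗ[ℝ] W'} (hφ : IsSmooth 𝓘(ℝ, EB) φ) (w : W) (u : B)
    (X : GroupLieAlgebra 𝓘(ℝ, EG) G) :
    C.fundDeriv (fun v => φ v w) u X = C.fundDeriv φ u X w :=
  differential_apply hφ w u (C.connInv u X)

theorem fundDeriv_homDeriv (hφ : IsSmooth 𝓘(ℝ, EB) φ) (u : B) (A : GroupLieAlgebra 𝓘(ℝ, EP) P) :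
    C.fundDeriv φ u (homDeriv (EG := EG) S.incl A) =
      differential 𝓘(ℝ, EP) (fun r => φ (C.act u r)) 1 A :=
  (differential_eq (hφ.comp (C.contMDiff_act_right u)) fun l => by
    refine (apply_differential hφ l u _).trans ?_
    exact C.mvfderiv_fundamental (hφ.mdifferentiableAt l u) A).symm

theorem fundDeriv_act (hφ : IsSmooth 𝓘(ℝ, EB) φ) (u : B) (p : P)
    (X : GroupLieAlgebra 𝓘(ℝ, EG) G) :
    C.fundDeriv (fun w => φ (C.act w p)) u (Ad (EG := EG) (S.incl p) X) =
      C.fundDeriv φ (C.act u p) X := by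
  refine (differential_comp hφ (C.contMDiff_act_left p) u _).trans ?_
  exact congrArg (differential 𝓘(ℝ, EB) φ (C.act u p)) (C.mfderiv_act_connInv u p X)

end Functions

/-! #### The bracket of constant vector fields -/

theorem bracket_swap (u : B) (X Y : GroupLieAlgebra 𝓘(ℝ, EG) G) :
    C.bracket u Y X = -C.bracket u X Y := by
  rw [bracket, VectorField.mlieBracket_swap_apply]
  exact map_neg (C.conn u) _

theorem bracket_add_left (u : B) (X X' Y : GroupLieAlgebra 𝓘(ℝ, EG) G) :
    C.bracket u (X + X') Y = C.bracket u X Y + C.bracket u X' Y := by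
  have h : (fun w => C.connInv w (X + X')) =
      (fun w => C.connInv w X) + fun w => C.connInv w X' := funext fun w => map_add (C.connInv w) X X'
  have h1 := VectorField.mlieBracket_add_left (W := fun w => C.connInv w Y)
    (C.mdifferentiableAt_connInv X u) (C.mdifferentiableAt_connInv X' u)
  rw [bracket, h, h1]
  exact map_add (C.conn u) _ _

theorem bracket_smul_left (u : B) (c : ℝ) (X Y : GroupLieAlgebra 𝓘(ℝ, EG) G) :
    C.bracket u (c • X) Y = c • C.bracket u X Y := by
  have h : (fun w => C.connInv w (c • X)) = c • fun w => C.connInv w X :=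
    funext fun w => map_smul (C.connInv w) c X
  have h1 := VectorField.mlieBracket_const_smul_left (W := fun w => C.connInv w Y) (c := c)
    (C.mdifferentiableAt_connInv X u)
  rw [bracket, h, h1]
  exact map_smul (C.conn u) _ _

/-- The bracket of constant vector fields as a bilinear map. -/
def bracketMap (u : B) : GroupLieAlgebra 𝓘(ℝ, EG) G →ₗ[ℝ]
    GroupLieAlgebra 𝓘(ℝ, EG) G →ₗ[ℝ] GroupLieAlgebra 𝓘(ℝ, EG) G :=
  LinearMap.mk₂ ℝ (C.bracket u) (C.bracket_add_left u) (C.bracket_smul_left u)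
    (fun X Y Y' => by
      rw [C.bracket_swap u (Y + Y') X, C.bracket_add_left, neg_add, ← C.bracket_swap,
        ← C.bracket_swap])
    (fun c X Y => by rw [C.bracket_swap u (c • Y) X, C.bracket_smul_left, ← smul_neg, ← C.bracket_swap])

theorem isSmooth_bracketMap : IsSmooth 𝓘(ℝ, EB) C.bracketMap := by
  refine isSmooth_hom fun X => isSmooth_hom fun Y l => ?_
  have h : ContMDiff 𝓘(ℝ, EB) 𝓘(ℝ, EB).tangent ∞ (fun u => (⟨u, VectorField.mlieBracket 𝓘(ℝ, EB)
      (fun w => C.connInv w X) (fun w => C.connInv w Y) u⟩ : TangentBundle 𝓘(ℝ, EB) B)) := fun u => ?_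
  · exact (C.isSmooth_conn l).comp h
  have : IsManifold 𝓘(ℝ, EB) (((⊤ : ℕ∞) : WithTop ℕ∞) + 1) B :=
    inferInstanceAs (IsManifold 𝓘(ℝ, EB) ∞ B)
  exact ContMDiffAt.mlieBracket_vectorField (m := ⊤) (n := ⊤) (C.contMDiff_connInv X u)
    (C.contMDiff_connInv Y u) (by simp [minSmoothness_of_isRCLikeNormedField])

/-- Constant fields of elements of 𝔭 are fundamental, and the principal action permutes the constant
fields through Ad, whose derivative is ad. Hence the curvature is horizontal. -/
theorem bracket_of_mem (u : B) {A : GroupLieAlgebra 𝓘(ℝ, EG) G} (hA : A ∈ Γ.fil 0)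
    (X : GroupLieAlgebra 𝓘(ℝ, EG) G) : C.bracket u A X = ⁅A, X⁆ := by
  rw [← S.range_homDeriv] at hA
  obtain ⟨A, rfl⟩ := hA
  have h := mlieBracket_fundamental (a := fun z : B × P => C.act z.1 z.2) C.contMDiff_act
    C.act_one C.contMDiff_connInv (C.contMDiff_connInv (homDeriv (EG := EG) S.incl A))
    (fun w f hf => C.mvfderiv_fundamental hf A) (u := u)
    ((isSmooth_Ad_apply X).comp S.contMDiff_incl) (fun r => by
      have h1 := C.mfderiv_act_connInv u r X
      rw [map_one, Ad_one]
      exact h1)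
  rw [S.differential_comp_incl (isSmooth_Ad_apply X), differential_Ad_apply, map_one, Ad_one] at h
  rw [bracket, h, conn_connInv]

/-- Brackets are natural under pull-back by the right translation, which pulls constant fields back
to constant fields twisted by Ad. It is pointwise invertible because the connection is injective on
tangent spaces. -/
theorem bracket_act (u : B) (p : P) (X Y : GroupLieAlgebra 𝓘(ℝ, EG) G) :
    Ad (EG := EG) (S.incl p) (C.bracket (C.act u p) X Y) =
      C.bracket u (Ad (EG := EG) (S.incl p) X) (Ad (EG := EG) (S.incl p) Y) := by
  set T : ∀ w, EB →L[ℝ] EB := fun w => mfderiv 𝓘(ℝ, EB) 𝓘(ℝ, EB) (fun w => C.act w p) w with hT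
  have hconn : ∀ w (v : EB), C.conn w v =
      Ad (EG := EG) (S.incl p) (C.conn (C.act w p) (T w v)) := fun w v => by
    have := C.equivariant_conn p w v
    rw [map_inv] at this
    exact ((congrArg (Ad (EG := EG) (S.incl p)) this).trans (Ad_Ad_inv _ _)).symm
  have hinj : ∀ w, Function.Injective (T w) := fun w v v' hv => (C.bijective_conn w).1 <| by
    rw [hconn w v, hconn w v', hv]
  have hinv : ∀ w, ∃ L : EB ≃L[ℝ] EB, (L : EB →L[ℝ] EB) = T w := fun w =>
    ⟨(LinearEquiv.ofInjectiveEndo (T w).toLinearMap (hinj w)).toContinuousLinearEquiv, rfl⟩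
  have hinv' : ∀ w v, (T w).inverse (T w v) = v := fun w v => by
    obtain ⟨L, hL⟩ := hinv w
    rw [← hL, ContinuousLinearMap.inverse_equiv]
    exact L.symm_apply_apply v
  have hinv'' : ∀ w v, T w ((T w).inverse v) = v := fun w v => by
    obtain ⟨L, hL⟩ := hinv w
    rw [← hL, ContinuousLinearMap.inverse_equiv]
    exact L.apply_symm_apply v
  have hpull : ∀ X, VectorField.mpullback 𝓘(ℝ, EB) 𝓘(ℝ, EB) (fun w => C.act w p)
      (fun w => C.connInv w X) = fun w => C.connInv w (Ad (EG := EG) (S.incl p) X) := fun X => by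
    funext w
    have h1 := C.mfderiv_act_connInv w p X
    refine Eq.trans ?_ (hinv' w (C.connInv w (Ad (EG := EG) (S.incl p) X)))
    exact congrArg (fun v : EB => (T w).inverse v) h1.symm
  have h := VectorField.mpullback_mlieBracket (n := ∞) (I := 𝓘(ℝ, EB)) (I' := 𝓘(ℝ, EB))
    (f := fun w => C.act w p) (x₀ := u) (C.mdifferentiableAt_connInv X _)
    (C.mdifferentiableAt_connInv Y _) (C.contMDiff_act_left p u)
    (by rw [minSmoothness_of_isRCLikeNormedField]; exact WithTop.coe_le_coe.mpr le_top)
  rw [hpull, hpull] at h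
  rw [bracket, bracket, ← h]
  refine Eq.trans ?_ (hconn u _).symm
  exact congrArg (fun v : EB => Ad (EG := EG) (S.incl p) (C.conn (C.act u p) v)) (hinv'' u _).symm

end CartanGeometry

end Geometry

/-! ### The Laplacian as a curvature term -/

section CurvatureOperator

variable {L : Type*} [LieRing L] [LieAlgebra ℝ L] [FiniteDimensional ℝ L]
  [LieAlgebra.IsSemisimple ℝ L] {V : Type*} [AddCommGroup V] [Module ℝ V] {Γ : Grading L}
  {θ : L →ₗ[ℝ] Module.End ℝ V} (hθ : ∀ x y : L, θ ⁅x, y⁆ = θ x * θ y - θ y * θ x)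

variable (θ) in
/-- The anticommutator of the codifferential and the insertion of a two-form `K`, times two. -/
def curvOp (K : L →ₗ[ℝ] L →ₗ[ℝ] L) : Module.End ℝ (FockSpace V L) :=
  (2 : ℝ) • (codiff θ * insert V K + insert V K * codiff θ)

theorem curvOp_apply (K : L →ₗ[ℝ] L →ₗ[ℝ] L) (w : FockSpace V L) :
    curvOp θ K w = (2 : ℝ) • (codiff θ (insert V K w) + insert V K (codiff θ w)) := rfl

include hθ in
/-- Twice the Laplacian minus the trace of the second derivative plus the Casimir eigenvalue is
algebraic. -/
theorem two_smul_laplacian_sub_trace {c₀ : ℝ} (hc : casimir θ = c₀ • LinearMap.id)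
    (b : L →ₗ[ℝ] L →ₗ[ℝ] L) (w : FockSpace V L) (D : L →ₗ[ℝ] FockSpace V L)
    (D2 : L →ₗ[ℝ] L →ₗ[ℝ] FockSpace V L)
    (hD : ∀ a ∈ Γ.fil 0, D a = -totalAct θ a w)
    (hD2 : ∀ a ∈ Γ.fil 0, ∀ x, D2 x a = -totalAct θ a (D x))
    (hcomm : ∀ a ∈ Γ.fil 0, ∀ x, D2 a x = D2 x a + D ⁅a, x⁆) :
    (2 : ℝ) • (codiff θ (extDiff θ b w D) + extDiff θ b (codiff θ w) (codiff θ ∘ₗ D)) -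
      killingTrace D2 + c₀ • w = curvOp θ (lieBilin L - b) w := by
  have h := sum_twisted_derivatives hθ w D D2 hD hD2 hcomm
  rw [codiff_extDiff hθ, sum_actOp_actOp hc, killingTrace_eq, curvOp_apply,
    eq_neg_of_add_eq_zero_left ((add_assoc _ _ _).symm.trans h)]
  module

include hθ in
-- In degree zero the codifferential of the form and of its derivative vanish, so the symmetric
-- formula covers the case without a second summand.
theorem formIncl_kostantCodiff_extDiff_zero (b : L →ₗ[ℝ] L →ₗ[ℝ] L) (w : V ⊗[ℝ] (⋀[ℝ]^0 Γ.pPlus))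
    (D : L →ₗ[ℝ] V ⊗[ℝ] (⋀[ℝ]^0 Γ.pPlus)) {ψ : V ⊗[ℝ] (⋀[ℝ]^1 Γ.pPlus)}
    (hψ : formIncl V Γ 1 ψ = extDiff θ b (formIncl V Γ 0 w) (formIncl V Γ 0 ∘ₗ D)) :
    formIncl V Γ 0 (kostantCodiff Γ θ 0 ψ) =
      codiff θ (extDiff θ b (formIncl V Γ 0 w) (formIncl V Γ 0 ∘ₗ D)) +
      extDiff θ b (codiff θ (formIncl V Γ 0 w)) (codiff θ ∘ₗ formIncl V Γ 0 ∘ₗ D) := by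
  have h1 : codiff θ ∘ₗ formIncl V Γ 0 ∘ₗ D = 0 := LinearMap.ext fun x => codiff_formIncl_zero _
  rw [← hψ, codiff_formIncl hθ, h1, codiff_formIncl_zero, extDiff]
  simp

include hθ in
theorem formIncl_kostantCodiff_extDiff_succ {k : ℕ} (b : L →ₗ[ℝ] L →ₗ[ℝ] L)
    (w : V ⊗[ℝ] (⋀[ℝ]^(k + 1) Γ.pPlus)) (D : L →ₗ[ℝ] V ⊗[ℝ] (⋀[ℝ]^(k + 1) Γ.pPlus))
    {ψ : V ⊗[ℝ] (⋀[ℝ]^(k + 2) Γ.pPlus)} {χ : V ⊗[ℝ] (⋀[ℝ]^(k + 1) Γ.pPlus)}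
    (hψ : formIncl V Γ (k + 2) ψ = extDiff θ b (formIncl V Γ (k + 1) w) (formIncl V Γ (k + 1) ∘ₗ D))
    (hχ : formIncl V Γ (k + 1) χ = extDiff θ b (formIncl V Γ k (kostantCodiff Γ θ k w))
      (formIncl V Γ k ∘ₗ kostantCodiff Γ θ k ∘ₗ D)) :
    formIncl V Γ (k + 1) (kostantCodiff Γ θ (k + 1) ψ + χ) =
      codiff θ (extDiff θ b (formIncl V Γ (k + 1) w) (formIncl V Γ (k + 1) ∘ₗ D)) +
      extDiff θ b (codiff θ (formIncl V Γ (k + 1) w)) (codiff θ ∘ₗ formIncl V Γ (k + 1) ∘ₗ D) := by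
  have h1 : codiff θ ∘ₗ formIncl V Γ (k + 1) ∘ₗ D = formIncl V Γ k ∘ₗ kostantCodiff Γ θ k ∘ₗ D :=
    LinearMap.ext fun x => codiff_formIncl hθ k _
  rw [map_add, ← codiff_formIncl hθ, hψ, hχ, h1, codiff_formIncl hθ]

include hθ in
theorem formIncl_kostantCodiff_eq_neg {k : ℕ} {a : L} {w v : V ⊗[ℝ] (⋀[ℝ]^(k + 1) Γ.pPlus)}
    (h : formIncl V Γ (k + 1) v = -totalAct θ a (formIncl V Γ (k + 1) w)) :
    formIncl V Γ k (kostantCodiff Γ θ k v) =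
      -totalAct θ a (formIncl V Γ k (kostantCodiff Γ θ k w)) := by
  rw [← codiff_formIncl hθ, ← codiff_formIncl hθ, totalAct_codiff hθ, h, map_neg]

include hθ in
/-- The element of `Λ^{k+1} 𝔭₊ ⊗ V` representing the exterior derivative is determined by its
values. -/
theorem formIncl_eq_extDiff {b : L →ₗ[ℝ] L →ₗ[ℝ] L} (hb : ∀ x y, b y x = -b x y)
    (hba : ∀ a ∈ Γ.fil 0, ∀ x, b a x = ⁅a, x⁆) {k : ℕ}
    {w : V ⊗[ℝ] (⋀[ℝ]^k Γ.pPlus)} {D : L →ₗ[ℝ] V ⊗[ℝ] (⋀[ℝ]^k Γ.pPlus)}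
    (hD : ∀ a ∈ Γ.fil 0, formIncl V Γ k (D a) = -totalAct θ a (formIncl V Γ k w)) :
    formIncl V Γ (k + 1) (Classical.epsilon fun ψ => ∀ X, toForm Γ (k + 1) ψ X =
      evalForm (killingForm ℝ L) (k + 1) X (extDiff θ b (formIncl V Γ k w) (formIncl V Γ k ∘ₗ D))) =
    extDiff θ b (formIncl V Γ k w) (formIncl V Γ k ∘ₗ D) := by
  -- Horizontality gives existence of a representing element; its uniqueness follows because
  -- evaluations determine elements of fixed degree.
  obtain ⟨ψ, hψ⟩ := extDiff_mem_range_formIncl hθ hb hba hD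
  have h1 := Classical.epsilon_spec (p := fun ψ => ∀ X, toForm Γ (k + 1) ψ X =
    evalForm (killingForm ℝ L) (k + 1) X (extDiff θ b (formIncl V Γ k w) (formIncl V Γ k ∘ₗ D)))
    ⟨ψ, fun X => by rw [toForm_eq_evalForm, hψ]⟩
  set χ := Classical.epsilon fun ψ => ∀ X, toForm Γ (k + 1) ψ X =
    evalForm (killingForm ℝ L) (k + 1) X (extDiff θ b (formIncl V Γ k w) (formIncl V Γ k ∘ₗ D))
  rw [← hψ, ← sub_eq_zero, ← map_sub]
  refine eq_zero_of_evalForm (formIncl_mem Γ (k + 1) _) fun X => ?_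
  rw [map_sub, map_sub, hψ, ← toForm_eq_evalForm, sub_eq_zero]
  exact h1 X

include hθ in
-- Insertion of K gains one degree and the codifferential loses none, in either order.
theorem curvOp_mem_formFil {K : L →ₗ[ℝ] L →ₗ[ℝ] L} (hK : ∀ x y, K y x = -K x y)
    (hKp : ∀ a ∈ Γ.fil 0, ∀ x, K a x = 0)
    (hreg : ∀ i j : ℤ, i < 0 → j < 0 → ∀ x ∈ Γ.fil i, ∀ y ∈ Γ.fil j, K x y ∈ Γ.fil (i + j + 1))
    {k : ℕ} {a : ℝ} {w ψ : V ⊗[ℝ] (⋀[ℝ]^k Γ.pPlus)} (hw : w ∈ formFil Γ θ k a)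
    (hψ : formIncl V Γ k ψ = curvOp θ K (formIncl V Γ k w)) :
    ψ ∈ formFil Γ θ k (a + 1) := by
  obtain ⟨w₁, hw₁, h₁⟩ := insert_mem_formFil hK hKp hreg hw
  rw [curvOp_apply, ← h₁, codiff_formIncl hθ] at hψ
  cases k with
  | zero =>
    rw [codiff_formIncl_zero, map_zero, add_zero, ← map_smul] at hψ
    rw [formIncl_injective _ _ hψ]
    exact Submodule.smul_mem _ _ (kostantCodiff_mem_formFil hθ hw₁)
  | succ k =>
    obtain ⟨w₂, hw₂, h₂⟩ := insert_mem_formFil hK hKp hreg (kostantCodiff_mem_formFil hθ hw)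
    rw [codiff_formIncl hθ, ← h₂, ← map_add, ← map_smul] at hψ
    rw [formIncl_injective _ _ hψ]
    exact Submodule.smul_mem _ _ (add_mem (kostantCodiff_mem_formFil hθ hw₁) hw₂)

theorem map_killingTrace {W W' : Type*} [AddCommGroup W] [Module ℝ W] [AddCommGroup W'] [Module ℝ W']
    (f : W →ₗ[ℝ] W') (T : L →ₗ[ℝ] L →ₗ[ℝ] W) : f (killingTrace T) = killingTrace (T.compr₂ f) := by
  rw [killingTrace_eq, killingTrace_eq, map_sum]
  rfl

theorem formIncl_combination {k : ℕ} (c : ℝ) (x y z : V ⊗[ℝ] (⋀[ℝ]^k Γ.pPlus)) :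
    formIncl V Γ k ((2 : ℝ) • x - y + c • z) =
      (2 : ℝ) • formIncl V Γ k x - formIncl V Γ k y + c • formIncl V Γ k z := by
  rw [map_add, map_sub, map_smul, map_smul]

section Smoothness

variable [FiniteDimensional ℝ V] {E H : Type*} [NormedAddCommGroup E] [NormedSpace ℝ E]
  [TopologicalSpace H] {I : ModelWithCorners ℝ E H} {N : Type*} [TopologicalSpace N]
  [ChartedSpace H N] {K : N → L →ₗ[ℝ] L →ₗ[ℝ] L} (hK : IsSmooth I K) {Ψ : N → FockSpace V L}
  (hΨ : IsSmooth I Ψ)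
include hK hΨ

theorem isSmooth_insert : IsSmooth I (fun u => insert V (K u) (Ψ u)) := by
  simp only [insert, FockRelations.insertOp, LinearMap.smul_apply, LinearMap.sum_apply,
    Module.End.mul_apply]
  exact IsSmooth.smul contMDiff_const (IsSmooth.sum fun l => IsSmooth.sum fun m =>
    ((IsSmooth.bilinear (annihilate V) ((hK.apply _).apply _) hΨ).linear _).linear _)

theorem isSmooth_curvOp : IsSmooth I (fun u => curvOp θ (K u) (Ψ u)) := by
  simp only [curvOp_apply]
  exact IsSmooth.smul contMDiff_const (((isSmooth_insert hK hΨ).linear _).add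
    (isSmooth_insert hK (hΨ.linear _)))

end Smoothness

theorem isSmooth_of_formIncl {E H : Type*} [NormedAddCommGroup E] [NormedSpace ℝ E]
    [TopologicalSpace H] {I : ModelWithCorners ℝ E H} {N : Type*} [TopologicalSpace N]
    [ChartedSpace H N] {k : ℕ} {φ : N → V ⊗[ℝ] (⋀[ℝ]^k Γ.pPlus)}
    (h : IsSmooth I (fun u => formIncl V Γ k (φ u))) : IsSmooth I φ := by
  obtain ⟨r, hr⟩ := (formIncl V Γ k).exists_leftInverse_of_injective
    (LinearMap.ker_eq_bot.mpr (formIncl_injective _ k))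
  have h1 : φ = fun u => r (formIncl V Γ k (φ u)) := funext fun u =>
    (LinearMap.congr_fun hr (φ u)).symm
  rw [h1]
  exact h.linear r

end CurvatureOperator

/-! ### Differential forms with values in tractor bundles -/

section Forms

variable {EG : Type*} [NormedAddCommGroup EG] [NormedSpace ℝ EG] [FiniteDimensional ℝ EG]
  {G : Type*} [TopologicalSpace G] [ChartedSpace EG G] [Group G] [LieGroup 𝓘(ℝ, EG) ∞ G]
  [LieAlgebra.IsSemisimple ℝ (GroupLieAlgebra 𝓘(ℝ, EG) G)]
  {Γ : Grading (GroupLieAlgebra 𝓘(ℝ, EG) G)}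
  {EP : Type*} [NormedAddCommGroup EP] [NormedSpace ℝ EP] [FiniteDimensional ℝ EP]
  {P : Type*} [TopologicalSpace P] [ChartedSpace EP P] [Group P] [LieGroup 𝓘(ℝ, EP) ∞ P]
  {S : ParabolicSubgroup (EP := EP) P Γ}
  {EM : Type*} [NormedAddCommGroup EM] [NormedSpace ℝ EM] [FiniteDimensional ℝ EM]
  {M : Type*} [TopologicalSpace M] [ChartedSpace EM M] [IsManifold 𝓘(ℝ, EM) ∞ M]
  {EB : Type*} [NormedAddCommGroup EB] [NormedSpace ℝ EB] [FiniteDimensional ℝ EB]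
  {B : Type*} [TopologicalSpace B] [ChartedSpace EB B] [IsManifold 𝓘(ℝ, EB) ∞ B]
  {C : CartanGeometry (EM := EM) (EB := EB) M B S}
  {V : Type*} [AddCommGroup V] [Module ℝ V] [FiniteDimensional ℝ V]
  {ρ : Representation ℝ G V} (hρ : IsSmooth 𝓘(ℝ, EG) (fun g : G => (ρ g : Module.End ℝ V)))
  {k : ℕ} {φ : B → V ⊗[ℝ] (⋀[ℝ]^k Γ.pPlus)}

theorem groupAct_formIncl (p : P) (w : V ⊗[ℝ] (⋀[ℝ]^k Γ.pPlus)) :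
    groupAct (EG := EG) ρ (S.incl p) (formIncl V Γ k w) = formIncl V Γ k (S.formAction ρ k p w) :=
  fockMap_fockIncl (a := Ad (EG := EG) (S.incl p)) (f := pIncl Γ) (c := S.AdPlus p) (ρ (S.incl p))
    (fun _ => rfl) w

namespace CartanGeometry

theorem IsForm.groupAct_formIncl_act (hφ : C.IsForm ρ k φ) (u : B) (p : P) :
    groupAct (EG := EG) ρ (S.incl p) (formIncl V Γ k (φ (C.act u p))) = formIncl V Γ k (φ u) := by
  have h := hφ.equivariant (C.act u p) p⁻¹
  rw [← C.act_mul, mul_inv_cancel, C.act_one, inv_inv] at h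
  rw [groupAct_formIncl, ← h]

include hρ in
-- Differentiate r · Ψ(u r) = y(r) along P at 1. A general right side is needed because the
-- derivatives of a form are equivariant only together with Ad on the direction.
theorem fundDeriv_of_equivariant {Ψ : B → FockSpace V (GroupLieAlgebra 𝓘(ℝ, EG) G)}
    (hΨ : IsSmooth 𝓘(ℝ, EB) Ψ) {y : G → FockSpace V (GroupLieAlgebra 𝓘(ℝ, EG) G)}
    (hy : IsSmooth 𝓘(ℝ, EG) y) {u : B}
    (h : ∀ r, groupAct (EG := EG) ρ (S.incl r) (Ψ (C.act u r)) = y (S.incl r))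
    {A : GroupLieAlgebra 𝓘(ℝ, EG) G} (hA : A ∈ Γ.fil 0) :
    C.fundDeriv Ψ u A = differential 𝓘(ℝ, EG) y 1 A -
      totalAct (L := GroupLieAlgebra 𝓘(ℝ, EG) G) (infRep (EG := EG) ρ) A (Ψ u) := by
  rw [← S.range_homDeriv] at hA
  obtain ⟨A, rfl⟩ := hA
  have h1 := differential_bilinear
    (LinearMap.id : Module.End ℝ (FockSpace V (GroupLieAlgebra 𝓘(ℝ, EG) G)) →ₗ[ℝ] _)
    ((isSmooth_groupAct hρ).comp S.contMDiff_incl) (hΨ.comp (C.contMDiff_act_right u)) 1 A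
  simp only [LinearMap.id_apply, h] at h1
  rw [S.differential_comp_incl hy, S.differential_comp_incl (isSmooth_groupAct hρ),
    differential_groupAct hρ, C.act_one, map_one, groupAct_one, ← C.fundDeriv_homDeriv hΨ] at h1
  rw [h1]
  abel

theorem fundDeriv_formIncl (hφ : IsSmooth 𝓘(ℝ, EB) φ) (u : B) :
    C.fundDeriv (fun w => formIncl V Γ k (φ w)) u = formIncl V Γ k ∘ₗ C.fundDeriv φ u :=
  C.fundDeriv_linear hφ _ u

include hρ in
theorem IsForm.fundDeriv_of_mem (hφ : C.IsForm ρ k φ) (u : B) {A : GroupLieAlgebra 𝓘(ℝ, EG) G}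
    (hA : A ∈ Γ.fil 0) : formIncl V Γ k (C.fundDeriv φ u A) =
      -totalAct (L := GroupLieAlgebra 𝓘(ℝ, EG) G) (infRep (EG := EG) ρ) A (formIncl V Γ k (φ u)) := by
  have h := fundDeriv_of_equivariant hρ (hφ.smooth.linear (formIncl V Γ k))
    (isSmooth_const (formIncl V Γ k (φ u))) (hφ.groupAct_formIncl_act u) hA
  rw [differential_const, zero_sub, fundDeriv_formIncl hφ.smooth] at h
  exact h

include hρ in
-- Since D_A φ = -Λ_A φ holds at every point, it can be differentiated along ω⁻¹(X).
theorem IsForm.fundDeriv_fundDeriv_of_mem (hφ : C.IsForm ρ k φ) (u : B)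
    {A : GroupLieAlgebra 𝓘(ℝ, EG) G} (hA : A ∈ Γ.fil 0) (X : GroupLieAlgebra 𝓘(ℝ, EG) G) :
    formIncl V Γ k (C.fundDeriv (C.fundDeriv φ) u X A) =
      -totalAct (L := GroupLieAlgebra 𝓘(ℝ, EG) G) (infRep (EG := EG) ρ) A
        (formIncl V Γ k (C.fundDeriv φ u X)) := by
  have hs := C.isSmooth_fundDeriv hφ.smooth
  have h1 : (fun w => formIncl V Γ k (C.fundDeriv φ w A)) = fun w =>
      (-totalAct (L := GroupLieAlgebra 𝓘(ℝ, EG) G) (infRep (EG := EG) ρ) A ∘ₗ formIncl V Γ k) (φ w) :=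
    funext fun w => hφ.fundDeriv_of_mem hρ w hA
  have h2 := C.fundDeriv_linear (hs.apply A) (formIncl V Γ k) u
  have h3 := C.fundDeriv_linear hφ.smooth
    (-totalAct (L := GroupLieAlgebra 𝓘(ℝ, EG) G) (infRep (EG := EG) ρ) A ∘ₗ formIncl V Γ k) u
  rw [h1, h3] at h2
  have h4 := LinearMap.congr_fun h2 X
  rw [← C.fundDeriv_apply hs]
  exact h4.symm

theorem IsForm.groupAct_fundDeriv_act (hφ : C.IsForm ρ k φ) (u : B) (p : P)
    (X : GroupLieAlgebra 𝓘(ℝ, EG) G) :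
    groupAct (EG := EG) ρ (S.incl p) (formIncl V Γ k (C.fundDeriv φ (C.act u p) X)) =
      formIncl V Γ k (C.fundDeriv φ u (Ad (EG := EG) (S.incl p) X)) := by
  have hs : IsSmooth 𝓘(ℝ, EB) (fun w => φ (C.act w p)) := hφ.smooth.comp (C.contMDiff_act_left p)
  have h1 := C.fundDeriv_linear hs (groupAct (EG := EG) ρ (S.incl p) ∘ₗ formIncl V Γ k) u
  have h2 : (fun w => (groupAct (EG := EG) ρ (S.incl p) ∘ₗ formIncl V Γ k) (φ (C.act w p))) =
      fun w => formIncl V Γ k (φ w) := funext fun w => hφ.groupAct_formIncl_act w p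
  rw [h2, fundDeriv_formIncl hφ.smooth] at h1
  have h3 := LinearMap.congr_fun h1 (Ad (EG := EG) (S.incl p) X)
  rw [LinearMap.comp_apply, LinearMap.comp_apply, C.fundDeriv_act hφ.smooth] at h3
  exact h3.symm

include hρ in
-- `fundDeriv_of_equivariant` applied to D_X φ: the orbit function is D φ on Ad(g) X, whose
-- derivative produces D in the direction [A, X].
theorem IsForm.fundDeriv_fundDeriv_comm (hφ : C.IsForm ρ k φ) (u : B)
    {A : GroupLieAlgebra 𝓘(ℝ, EG) G} (hA : A ∈ Γ.fil 0) (X : GroupLieAlgebra 𝓘(ℝ, EG) G) :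
    formIncl V Γ k (C.fundDeriv (C.fundDeriv φ) u A X) =
      formIncl V Γ k (C.fundDeriv (C.fundDeriv φ) u X A) +
        formIncl V Γ k (C.fundDeriv φ u ⁅A, X⁆) := by
  have hs := C.isSmooth_fundDeriv hφ.smooth
  have hy : IsSmooth 𝓘(ℝ, EG) (fun g : G => (formIncl V Γ k ∘ₗ C.fundDeriv φ u)
      (Ad (EG := EG) g X)) := (isSmooth_Ad_apply X).linear _
  have h1 := fundDeriv_of_equivariant hρ ((hs.apply X).linear (formIncl V Γ k)) hy
    (fun r => hφ.groupAct_fundDeriv_act u r X) hA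
  have h2 := (differential_linear (isSmooth_Ad_apply (EG := EG) X)
    (formIncl V Γ k ∘ₗ C.fundDeriv φ u) 1 A).trans (congrArg _ (differential_Ad_apply A X))
  have h3 := (LinearMap.congr_fun (C.fundDeriv_linear (hs.apply X) (formIncl V Γ k) u) A).trans
    (congrArg (formIncl V Γ k) (C.fundDeriv_apply hs X u A))
  rw [hφ.fundDeriv_fundDeriv_of_mem hρ u hA]
  refine h3.symm.trans (h1.trans ((sub_eq_neg_add _ _).trans ?_))
  exact congrArg (fun v => _ + v) h2

theorem tractorDeriv_toForm (hφ : IsSmooth 𝓘(ℝ, EB) φ) (u : B) (X : GroupLieAlgebra 𝓘(ℝ, EG) G)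
    (Y : Fin k → GroupLieAlgebra 𝓘(ℝ, EG) G) :
    C.tractorDeriv ρ X (fun w => toForm Γ k (φ w) Y) u =
      toForm Γ k (C.fundDeriv φ u X) Y + infRep (EG := EG) ρ X (toForm Γ k (φ u) Y) := by
  have h := LinearMap.congr_fun (C.fundDeriv_linear hφ (evalForm (killingForm ℝ _) k Y ∘ₗ
    formIncl V Γ k) u) X
  simp only [tractorDeriv, toForm_eq_evalForm]
  exact congrArg (· + _) h

/-- Evaluation on fixed vectors is linear, so it commutes with differentiation along constant
fields. -/
theorem koszul_eq (hφ : IsSmooth 𝓘(ℝ, EB) φ) (u : B)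
    (X : Fin (k + 1) → GroupLieAlgebra 𝓘(ℝ, EG) G) :
    C.koszul ρ k φ u X = evalForm (killingForm ℝ _) (k + 1) X
      (extDiff (L := GroupLieAlgebra 𝓘(ℝ, EG) G) (infRep (EG := EG) ρ) (C.bracketMap u)
        (formIncl V Γ k (φ u)) (formIncl V Γ k ∘ₗ C.fundDeriv φ u)) := by
  cases k with
  | zero =>
    rw [evalForm_extDiff_zero, koszul, tractorDeriv_toForm hφ]
  | succ k =>
    refine Eq.trans ?_ (evalForm_extDiff_succ (L := GroupLieAlgebra 𝓘(ℝ, EG) G) Γ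
      (infRep (EG := EG) ρ) (C.bracketMap u) (fun x y => C.bracket_swap u x y) k (φ u)
      (C.fundDeriv φ u) X).symm
    rw [koszul]
    simp only [tractorDeriv_toForm hφ]
    rfl

include hρ in
/-- The covariant exterior derivative in terms of operators on the Fock space. -/
theorem formIncl_covExtDeriv (hφ : IsSmooth 𝓘(ℝ, EB) φ) {u : B}
    (hD : ∀ A ∈ Γ.fil 0, formIncl V Γ k (C.fundDeriv φ u A) =
      -totalAct (L := GroupLieAlgebra 𝓘(ℝ, EG) G) (infRep (EG := EG) ρ) A (formIncl V Γ k (φ u))) :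
    formIncl V Γ (k + 1) (C.covExtDeriv ρ k φ u) =
      extDiff (L := GroupLieAlgebra 𝓘(ℝ, EG) G) (infRep (EG := EG) ρ) (C.bracketMap u)
        (formIncl V Γ k (φ u)) (formIncl V Γ k ∘ₗ C.fundDeriv φ u) := by
  have h := formIncl_eq_extDiff (L := GroupLieAlgebra 𝓘(ℝ, EG) G) (infRep_lie hρ)
    (b := C.bracketMap u) (fun x y => C.bracket_swap u x y) (fun A hA => C.bracket_of_mem u hA) hD
  simp only [← koszul_eq hφ] at h
  exact h

/-- The curvature as a bilinear map. -/
def curvatureMap (C : CartanGeometry (EM := EM) (EB := EB) M B S) (u : B) :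
    GroupLieAlgebra 𝓘(ℝ, EG) G →ₗ[ℝ] GroupLieAlgebra 𝓘(ℝ, EG) G →ₗ[ℝ] GroupLieAlgebra 𝓘(ℝ, EG) G :=
  lieBilin (GroupLieAlgebra 𝓘(ℝ, EG) G) - C.bracketMap u

/-- The action of the curvature on forms. -/
def curvatureAct (C : CartanGeometry (EM := EM) (EB := EB) M B S) (ρ : Representation ℝ G V)
    (u : B) : Module.End ℝ (FockSpace V (GroupLieAlgebra 𝓘(ℝ, EG) G)) :=
  curvOp (L := GroupLieAlgebra 𝓘(ℝ, EG) G) (infRep (EG := EG) ρ) (C.curvatureMap u)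

include hρ in
theorem formIncl_boxR (hφ : C.IsForm ρ k φ) (u : B) :
    formIncl V Γ k (C.boxR ρ k φ u) =
      codiff (L := GroupLieAlgebra 𝓘(ℝ, EG) G) (infRep (EG := EG) ρ)
        (extDiff (L := GroupLieAlgebra 𝓘(ℝ, EG) G) (infRep (EG := EG) ρ) (C.bracketMap u)
          (formIncl V Γ k (φ u)) (formIncl V Γ k ∘ₗ C.fundDeriv φ u)) +
      extDiff (L := GroupLieAlgebra 𝓘(ℝ, EG) G) (infRep (EG := EG) ρ) (C.bracketMap u)
        (codiff (L := GroupLieAlgebra 𝓘(ℝ, EG) G) (infRep (EG := EG) ρ) (formIncl V Γ k (φ u)))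
        (codiff (L := GroupLieAlgebra 𝓘(ℝ, EG) G) (infRep (EG := EG) ρ) ∘ₗ formIncl V Γ k ∘ₗ
          C.fundDeriv φ u) := by
  have h := formIncl_covExtDeriv hρ hφ.smooth fun A hA => hφ.fundDeriv_of_mem hρ u hA
  cases k with
  | zero =>
    exact formIncl_kostantCodiff_extDiff_zero (L := GroupLieAlgebra 𝓘(ℝ, EG) G) (infRep_lie hρ)
      (C.bracketMap u) (φ u) (C.fundDeriv φ u) h
  | succ k =>
    have h1 := C.fundDeriv_linear hφ.smooth (kostantCodiff Γ (infRep (EG := EG) ρ) k) u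
    have h2 := formIncl_covExtDeriv (C := C) hρ
      (hφ.smooth.linear (kostantCodiff Γ (infRep (EG := EG) ρ) k)) (u := u) fun A hA => by
        rw [h1]
        exact formIncl_kostantCodiff_eq_neg (L := GroupLieAlgebra 𝓘(ℝ, EG) G) (infRep_lie hρ)
          (hφ.fundDeriv_of_mem hρ u hA)
    rw [h1] at h2
    exact formIncl_kostantCodiff_extDiff_succ (L := GroupLieAlgebra 𝓘(ℝ, EG) G) (infRep_lie hρ)
      (C.bracketMap u) (φ u) (C.fundDeriv φ u) h h2

include hρ in
/-- The operator `2 □^R - 𝒞 + c₀` is given by an algebraic action of the curvature. -/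
theorem formIncl_diffOp {c₀ : ℝ} (hc₀ : casimir (infRep ρ : GroupLieAlgebra 𝓘(ℝ, EG) G →ₗ[ℝ]
      Module.End ℝ V) = c₀ • (LinearMap.id : V →ₗ[ℝ] V)) (hφ : C.IsForm ρ k φ) (u : B) :
    formIncl V Γ k (C.diffOp ρ c₀ k φ u) = C.curvatureAct ρ u (formIncl V Γ k (φ u)) := by
  have h1 := formIncl_boxR hρ hφ u
  have h2 := two_smul_laplacian_sub_trace (L := GroupLieAlgebra 𝓘(ℝ, EG) G) (Γ := Γ)
    (infRep_lie hρ) hc₀ (C.bracketMap u) (formIncl V Γ k (φ u))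
    (formIncl V Γ k ∘ₗ C.fundDeriv φ u)
    ((C.fundDeriv (C.fundDeriv φ) u).compr₂ (formIncl V Γ k))
    (fun A hA => hφ.fundDeriv_of_mem hρ u hA)
    (fun A hA X => hφ.fundDeriv_fundDeriv_of_mem hρ u hA X)
    (fun A hA X => hφ.fundDeriv_fundDeriv_comm hρ u hA X)
  have h3 : formIncl V Γ k (C.curvedCasimir φ u) =
      killingTrace ((C.fundDeriv (C.fundDeriv φ) u).compr₂ (formIncl V Γ k)) :=
    map_killingTrace (L := GroupLieAlgebra 𝓘(ℝ, EG) G) _ _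
  refine (formIncl_combination (L := GroupLieAlgebra 𝓘(ℝ, EG) G) c₀ _ _ _).trans (Eq.trans ?_ h2)
  exact congrArg₂ (fun x y => (2 : ℝ) • x - y + c₀ • formIncl V Γ k (φ u)) h1 h3

/-! #### Properties of the curvature -/

theorem curvatureMap_act (u : B) (p : P) (X Y : GroupLieAlgebra 𝓘(ℝ, EG) G) :
    Ad (EG := EG) (S.incl p) (C.curvatureMap (C.act u p) X Y) =
      C.curvatureMap u (Ad (EG := EG) (S.incl p) X) (Ad (EG := EG) (S.incl p) Y) := by
  have h : ∀ u X Y, C.curvatureMap u X Y = ⁅X, Y⁆ - C.bracket u X Y := fun _ _ _ => rfl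
  rw [h, h, map_sub, Ad_lie, C.bracket_act]

theorem isSmooth_curvatureMap : IsSmooth 𝓘(ℝ, EB) C.curvatureMap := by
  have h : C.curvatureMap = fun u =>
      lieBilin (GroupLieAlgebra 𝓘(ℝ, EG) G) + (-1 : ℝ) • C.bracketMap u := by
    funext u
    exact (sub_eq_add_neg _ _).trans (congrArg _ ((neg_smul _ _).trans
      (congrArg Neg.neg (one_smul ℝ _))).symm)
  rw [h]
  exact (isSmooth_const _).add (IsSmooth.smul contMDiff_const C.isSmooth_bracketMap)

include hρ in
-- The curvature function is equivariant and the codifferential commutes with the group action.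
theorem groupAct_curvatureAct (u : B) (p : P)
    (w : FockSpace V (GroupLieAlgebra 𝓘(ℝ, EG) G)) :
    groupAct (EG := EG) ρ (S.incl p) (C.curvatureAct ρ (C.act u p) w) =
      C.curvatureAct ρ u (groupAct (EG := EG) ρ (S.incl p) w) := by
  have h := groupAct_insert (EG := EG) (V := V) (ρ := ρ) (S.incl p) (C.curvatureMap_act u p)
  have h1 := groupAct_codiff hρ (S.incl p)
  refine (map_smul (groupAct (EG := EG) ρ (S.incl p)) _ _).trans (congrArg _ ?_)
  refine (map_add (groupAct (EG := EG) ρ (S.incl p)) _ _).trans (congrArg₂ _ ?_ ?_)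
  · exact (h1 _).trans (congrArg _ (h _))
  · exact (h _).trans (congrArg _ (h1 _))

include hρ in
/-- In a regular geometry, the action of the curvature raises the filtration degree. -/
theorem curvatureAct_mem (hC : C.IsRegular) (u : B) {a : ℝ} {w ψ : V ⊗[ℝ] (⋀[ℝ]^k Γ.pPlus)}
    (hw : w ∈ formFil Γ (infRep (EG := EG) ρ) k a)
    (hψ : formIncl V Γ k ψ = C.curvatureAct ρ u (formIncl V Γ k w)) :
    ψ ∈ formFil Γ (infRep (EG := EG) ρ) k (a + 1) := by
  have h : ∀ X Y, C.curvatureMap u X Y = ⁅X, Y⁆ - C.bracket u X Y := fun _ _ => rfl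
  refine curvOp_mem_formFil (L := GroupLieAlgebra 𝓘(ℝ, EG) G) (infRep_lie hρ)
    (K := C.curvatureMap u) (fun X Y => ?_) (fun A hA X => ?_)
    (fun i j hi hj X hX Y hY => hC u i j hi hj X hX Y hY) hw hψ
  · rw [h, h, C.bracket_swap u X Y, ← lie_skew X Y]
    abel
  · rw [h, C.bracket_of_mem u hA, sub_self]

include hρ in
theorem IsForm.diffOp {c₀ : ℝ} (hc₀ : casimir (infRep (EG := EG) ρ : GroupLieAlgebra 𝓘(ℝ, EG) G →ₗ[ℝ]
      Module.End ℝ V) = c₀ • (LinearMap.id : V →ₗ[ℝ] V)) (hφ : C.IsForm ρ k φ) :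
    C.IsForm ρ k (C.diffOp ρ c₀ k φ) where
  smooth := by
    refine isSmooth_of_formIncl ?_
    simp only [formIncl_diffOp hρ hc₀ hφ]
    exact isSmooth_curvOp (L := GroupLieAlgebra 𝓘(ℝ, EG) G) isSmooth_curvatureMap
      (hφ.smooth.linear (formIncl V Γ k))
  equivariant u p := by
    have h : ∀ u p, C.diffOp ρ c₀ k φ u = S.formAction ρ k p (C.diffOp ρ c₀ k φ (C.act u p)) :=
      fun u p => formIncl_injective (V := V) Γ k <| by
        refine (formIncl_diffOp hρ hc₀ hφ u).trans (Eq.trans ?_ (groupAct_formIncl p _))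
        refine Eq.trans ?_ (congrArg (groupAct (EG := EG) ρ (S.incl p))
          (formIncl_diffOp hρ hc₀ hφ (C.act u p)).symm)
        refine Eq.trans ?_ (groupAct_curvatureAct hρ u p _).symm
        exact congrArg (C.curvatureAct ρ u) (hφ.groupAct_formIncl_act u p).symm
    rw [h (C.act u p) p⁻¹, ← C.act_mul, mul_inv_cancel, C.act_one]

theorem IsForm.add {ψ : B → V ⊗[ℝ] (⋀[ℝ]^k Γ.pPlus)} (hφ : C.IsForm ρ k φ)
    (hψ : C.IsForm ρ k ψ) : C.IsForm ρ k (fun u => φ u + ψ u) where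
  smooth := hφ.smooth.add hψ.smooth
  equivariant u p := by rw [hφ.equivariant, hψ.equivariant, map_add]

theorem IsForm.smul {f : M → ℝ} (hf : ContMDiff 𝓘(ℝ, EM) 𝓘(ℝ, ℝ) ∞ f) (hφ : C.IsForm ρ k φ) :
    C.IsForm ρ k (fun u => f (C.proj u) • φ u) where
  smooth := IsSmooth.smul (hf.comp C.contMDiff_proj) hφ.smooth
  equivariant u p := by rw [hφ.equivariant, C.proj_act, map_smul]

end CartanGeometry

end Forms

end ParabolicGeometry

open ParabolicGeometry in
/-- On a Cartan geometry of type `(G, P)`, with `G` semisimple and `P` parabolic, and a tractor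
bundle `V M` such that the Casimir operator acts on `V` by the scalar `c₀`, the operator
`2 □^R - 𝒞 + c₀` is a tensorial operator on `Ω^k(M, V M)`; if the geometry is regular, it maps each
component of the natural filtration to the next smaller one. -/
theorem proposition4p3
    {EG : Type*} [NormedAddCommGroup EG] [NormedSpace ℝ EG] [FiniteDimensional ℝ EG]
    {G : Type*} [TopologicalSpace G] [ChartedSpace EG G] [Group G] [LieGroup 𝓘(ℝ, EG) ∞ G]
    [LieAlgebra.IsSemisimple ℝ (GroupLieAlgebra 𝓘(ℝ, EG) G)]
    (Γ : Grading (GroupLieAlgebra 𝓘(ℝ, EG) G))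
    {EP : Type*} [NormedAddCommGroup EP] [NormedSpace ℝ EP] [FiniteDimensional ℝ EP]
    {P : Type*} [TopologicalSpace P] [ChartedSpace EP P] [Group P] [LieGroup 𝓘(ℝ, EP) ∞ P]
    (S : ParabolicSubgroup (EP := EP) P Γ)
    {EM : Type*} [NormedAddCommGroup EM] [NormedSpace ℝ EM] [FiniteDimensional ℝ EM]
    {M : Type*} [TopologicalSpace M] [ChartedSpace EM M] [IsManifold 𝓘(ℝ, EM) ∞ M]
    {EB : Type*} [NormedAddCommGroup EB] [NormedSpace ℝ EB] [FiniteDimensional ℝ EB]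
    {B : Type*} [TopologicalSpace B] [ChartedSpace EB B] [IsManifold 𝓘(ℝ, EB) ∞ B]
    (C : CartanGeometry (EM := EM) (EB := EB) M B S)
    {V : Type*} [AddCommGroup V] [Module ℝ V] [FiniteDimensional ℝ V]
    (ρ : Representation ℝ G V)
    (hρ : IsSmooth 𝓘(ℝ, EG) (fun g : G => (ρ g : Module.End ℝ V)))
    (c₀ : ℝ) (hc₀ : casimir (infRep ρ : GroupLieAlgebra 𝓘(ℝ, EG) G →ₗ[ℝ] Module.End ℝ V) =
      c₀ • (LinearMap.id : V →ₗ[ℝ] V))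
    (k : ℕ) :
    (∀ φ, C.IsForm ρ k φ → C.IsForm ρ k (C.diffOp ρ c₀ k φ)) ∧
    (∀ φ ψ, C.IsForm ρ k φ → C.IsForm ρ k ψ →
      C.diffOp ρ c₀ k (fun u => φ u + ψ u) =
        fun u => C.diffOp ρ c₀ k φ u + C.diffOp ρ c₀ k ψ u) ∧
    (∀ f : M → ℝ, ContMDiff 𝓘(ℝ, EM) 𝓘(ℝ, ℝ) ∞ f → ∀ φ, C.IsForm ρ k φ →
      C.diffOp ρ c₀ k (fun u => f (C.proj u) • φ u) =
        fun u => f (C.proj u) • C.diffOp ρ c₀ k φ u) ∧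
    (C.IsRegular → ∀ (a : ℝ) (φ), C.IsForm ρ k φ →
      (∀ u, φ u ∈ formFil Γ (infRep ρ) k a) →
        ∀ u, C.diffOp ρ c₀ k φ u ∈ formFil Γ (infRep ρ) k (a + 1)) := by
  refine ⟨fun φ hφ => hφ.diffOp hρ hc₀, fun φ ψ hφ hψ => funext fun u => ?_,
    fun f hf φ hφ => funext fun u => ?_, fun hC a φ hφ hmem u =>
      CartanGeometry.curvatureAct_mem hρ hC u (hmem u)
        (CartanGeometry.formIncl_diffOp hρ hc₀ hφ u)⟩
  -- At each point the operator is the linear map `curvatureAct` applied to the value of the form,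
  -- so additivity, and likewise linearity over functions below, hold pointwise.
  · have h1 := CartanGeometry.formIncl_diffOp hρ hc₀ hφ u
    have h2 := CartanGeometry.formIncl_diffOp hρ hc₀ hψ u
    have h3 := CartanGeometry.formIncl_diffOp hρ hc₀ (hφ.add hψ) u
    refine formIncl_injective (V := V) Γ k (h3.trans ?_)
    refine (congrArg (C.curvatureAct ρ u) (map_add (formIncl V Γ k) _ _)).trans ?_
    refine (map_add (C.curvatureAct ρ u) _ _).trans ?_
    exact (congrArg₂ (· + ·) h1 h2).symm.trans (map_add (formIncl V Γ k) _ _).symm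
  · have h1 := CartanGeometry.formIncl_diffOp hρ hc₀ hφ u
    have h2 := CartanGeometry.formIncl_diffOp hρ hc₀ (hφ.smul hf) u
    refine formIncl_injective (V := V) Γ k (h2.trans ?_)
    refine (congrArg (C.curvatureAct ρ u) (map_smul (formIncl V Γ k) _ _)).trans ?_
    refine (map_smul (C.curvatureAct ρ u) _ _).trans ?_
    exact (congrArg (f (C.proj u) • ·) h1).symm.trans (map_smul (formIncl V Γ k) _ _).symm
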